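/- Let $T=(V,A)$ be a directed tree with $n$ vertices, that is, an orientation of an undirected tree in which every edge receives exactly one of its two directions, and let $\mathcal{P}$ be a finite collection of dipaths of $T$ (repetitions allowed). Suppose that $\preceq$ is a reflexive and antisymmetric binary relation on $\mathcal{P}$ which induces, for each arc $a\in A$, a total order $\preceq_a$ on the set of those dipaths of $\mathcal{P}$ that contain $a$. Then it is possible to compute in $O(n|\mathcal{P}|^2)$ time a subset $\mathcal{K}\subseteq\mathcal{P}$ of pairwise arc-disjoint dipaths such that for every dipath $Q\in\mathcal{P}\setminus\mathcal{K}$ there are an arc $a$ and a dipath $P\in\mathcal{K}$ with $a\in P$, $a\in Q$ and $P\succeq_a Q$. Said differently, let $I(\mathcal{P},T)$ be the graph with vertex set $\mathcal{P}$ in which two dipaths are adjacent when they share an arc, and orient each of its edges from the smaller to the larger dipath with respect to $\preceq$; then $\mathcal{K}$ is a kernel of this oriented graph: a stable set such that each vertex outside $\mathcal{K}$ has an arc towards a vertex of $\mathcal{K}$. Here time is counted on a unit-cost random access machine with addition, subtraction, comparison and indirect addressing (no multiplication). The input consists of $n$, $|\mathcal{P}|$, the list of the arcs of $T$ in any order,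 the vertex sequences of the dipaths, and the $0/1$ table of $\preceq$. The claim is that there are one program and one constant $C$ such that on every such input the program halts with $\mathcal{K}$ as its output after at most $C\,(n|\mathcal{P}|^2+1)$ steps. -/

import Mathlib

/-! ### Directed trees, dipaths, intersection graphs and kernels -/

namespace DipathKernel

/-- A directed tree: an orientation of an undirected tree, every edge of the tree receiving exactly
one of its two directions (which also excludes loops). The orientation is otherwise arbitrary. -/
structure IsDirectedTree {V : Type} (T : Digraph V) : Prop where
  oriented : ∀ u v, T.Adj u v → ¬ T.Adj v u
  isTree : T.toSimpleGraphInclusive.IsTree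

/-- A dipath of a digraph, given by the sequence of its (pairwise distinct) vertices. -/
structure Dipath {V : Type} (T : Digraph V) where
  verts : List V
  ne_nil : verts ≠ []
  chain : verts.IsChain T.Adj
  nodup : verts.Nodup

/-- The list of the arcs of a dipath: the pairs of consecutive vertices. -/
def Dipath.arcs {V : Type} {T : Digraph V} (P : Dipath T) : List (V × V) :=
  P.verts.zip P.verts.tail

/-- The relation `R` on the (indices of the) dipaths `P i` induces, for each arc `a`, a total order
on the set of those dipaths that contain `a`. -/
def InducesTotalOrders {V ι : Type} {T : Digraph V} (P : ι → Dipath T) (R : ι → ι → Prop) : Prop :=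
  ∀ a : V × V, T.Adj a.1 a.2 →
    IsLinearOrder {i : ι // a ∈ (P i).arcs} (fun i j => R i.1 j.1)

/-- The arc-intersection graph of a family of dipaths. -/
def interGraph {V ι : Type} {T : Digraph V} (P : ι → Dipath T) : SimpleGraph ι where
  Adj i j := i ≠ j ∧ ∃ a, a ∈ (P i).arcs ∧ a ∈ (P j).arcs
  symm := ⟨fun _ _ h => ⟨h.1.symm, h.2.imp fun _ ha => ⟨ha.2, ha.1⟩⟩⟩
  loopless := ⟨fun _ h => h.1 rfl⟩

/-- The orientation of the arc-intersection graph given by the relation `R`: an edge `ij` is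
directed from `i` to `j` when `R i j`, that is, towards the larger dipath. -/
def orientation {V ι : Type} {T : Digraph V} (P : ι → Dipath T) (R : ι → ι → Prop) : Digraph ι where
  Adj i j := (interGraph P).Adj i j ∧ R i j

/-- A kernel of an oriented graph: a stable set `K` such that each vertex outside `K` has an arc
towards a vertex of `K`. -/
def IsKernel {ι : Type} (D : Digraph ι) (K : Set ι) : Prop :=
  (∀ v ∈ K, ∀ w ∈ K, ¬ D.Adj v w) ∧ ∀ v, v ∉ K → ∃ w ∈ K, D.Adj v w

/-! ### A unit-cost random access machine

The memory consists of registers `0, 1, 2, …` and of arrays `0, 1, 2, …`, all of whose cells hold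
natural numbers; a program mentions finitely many registers and arrays. The arithmetic operations
are addition and (truncated) subtraction, array cells can be addressed indirectly, and comparisons
control conditionals and loops. Every operation, memory access, test and assignment costs one
step. -/

/-- The memory of the machine. -/
structure State where
  reg : ℕ → ℕ
  arr : ℕ → ℕ → ℕ

/-- Expressions: constants, registers, sums, truncated differences, and `get a e`, the content of
cell number `e` of array `a`. -/
inductive Expr where
  | const (c : ℕ)
  | reg (x : ℕ)
  | add (e f : Expr)
  | sub (e f : Expr)
  | get (a : ℕ) (e : Expr)

/-- The value of an expression. -/
def Expr.eval (s : State) : Expr → ℕ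
  | .const c => c
  | .reg x => s.reg x
  | .add e f => e.eval s + f.eval s
  | .sub e f => e.eval s - f.eval s
  | .get a e => s.arr a (e.eval s)

/-- The number of steps needed to evaluate an expression: one for each of its nodes. -/
def Expr.cost : Expr → ℕ
  | .const _ => 1
  | .reg _ => 1
  | .add e f => e.cost + f.cost + 1
  | .sub e f => e.cost + f.cost + 1
  | .get _ e => e.cost + 1

/-- Programs. -/
inductive Prog where
  | skip
  /-- `reg x := e` -/
  | set (x : ℕ) (e : Expr)
  /-- `arr a [e] := f` -/
  | put (a : ℕ) (e f : Expr)
  | seq (c d : Prog)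
  /-- if `e < f` then `c` else `d` -/
  | ite (e f : Expr) (c d : Prog)
  /-- as long as `e < f`, repeat `c` -/
  | loop (e f : Expr) (c : Prog)

/-- The state after `reg x := v`. -/
def State.setReg (s : State) (x v : ℕ) : State :=
  { s with reg := Function.update s.reg x v }

/-- The state after `arr a [i] := v`. -/
def State.setArr (s : State) (a i v : ℕ) : State :=
  { s with arr := Function.update s.arr a (Function.update (s.arr a) i v) }

/-- `Exec c s s' t`: started in the state `s`, the program `c` terminates, in the state `s'`, after
exactly `t` steps. -/
inductive Exec : Prog → State → State → ℕ → Prop where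
  | skip (s : State) : Exec .skip s s 1
  | set (s : State) (x : ℕ) (e : Expr) :
      Exec (.set x e) s (s.setReg x (e.eval s)) (e.cost + 1)
  | put (s : State) (a : ℕ) (e f : Expr) :
      Exec (.put a e f) s (s.setArr a (e.eval s) (f.eval s)) (e.cost + f.cost + 1)
  | seq {c d : Prog} {s s' s'' : State} {t t' : ℕ} :
      Exec c s s' t → Exec d s' s'' t' → Exec (.seq c d) s s'' (t + t')
  | iteTrue {e f : Expr} {c d : Prog} {s s' : State} {t : ℕ} :
      e.eval s < f.eval s → Exec c s s' t →
        Exec (.ite e f c d) s s' (e.cost + f.cost + 1 + t)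
  | iteFalse {e f : Expr} {c d : Prog} {s s' : State} {t : ℕ} :
      ¬ e.eval s < f.eval s → Exec d s s' t →
        Exec (.ite e f c d) s s' (e.cost + f.cost + 1 + t)
  | loopTrue {e f : Expr} {c : Prog} {s s' s'' : State} {t t' : ℕ} :
      e.eval s < f.eval s → Exec c s s' t → Exec (.loop e f c) s' s'' t' →
        Exec (.loop e f c) s s'' (e.cost + f.cost + 1 + t + t')
  | loopFalse {e f : Expr} {c : Prog} {s : State} :
      ¬ e.eval s < f.eval s → Exec (.loop e f c) s s (e.cost + f.cost + 1)

/-! ### Input and output -/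

open Classical in
/-- The initial state for a digraph with vertices `0, …, n - 1` and arc list `A`, a family of `p`
dipaths, and a relation `R` on it. Registers 0 and 1 hold `n` and `p`; arrays 0 and 1 hold the tails
and the heads of the arcs; array 2 holds the numbers of vertices of the dipaths; array 3 holds the
vertex sequences of the dipaths, one after the other; array 4 holds the 0/1 table of `R`, row by
row. Everything else is 0. -/
noncomputable def input {n p : ℕ} {T : Digraph (Fin n)} (A : List (Fin n × Fin n))
    (P : Fin p → Dipath T) (R : Fin p → Fin p → Prop) : State where
  reg x := [n, p].getD x 0
  arr a k :=
    ([A.map fun e => (e.1 : ℕ),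
      A.map fun e => (e.2 : ℕ),
      (List.finRange p).map fun i => (P i).verts.length,
      (List.finRange p).flatMap fun i => (P i).verts.map fun v => (v : ℕ),
      (List.finRange p).flatMap fun i => (List.finRange p).map fun j => if R i j then 1 else 0
      ].getD a []).getD k 0

/-- The set of dipaths that a final state describes: those `i` for which cell number `i` of
array 5 holds 1. -/
def output (p : ℕ) (s : State) : Set (Fin p) :=
  {i | s.arr 5 i = 1}

end DipathKernel

open DipathKernel

/-! ### Deferred acceptance at a star -/

namespace DipathKernel

section Star

/-! A dipath through a vertex `v` uses at most one arc entering `v` and at most one leaving it. At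
the star of `v` the dipaths therefore behave like the edges of a bipartite multigraph whose sides
are the in-arcs and the out-arcs, and `R` ranks the edges at each node. A stable matching is a
kernel of the star. Deferred acceptance finds one: each proposing arc offers its largest remaining
candidate, each accepting arc keeps its largest offer, and refused candidates are dropped
(`daResult_dominates`). The key `0` stands for a missing arc, at which there is no competition.

The star kernels are glued along the tree. Peeling off leaves orders the vertices so that a dipath
with arcs at a vertex and at a later one contains the arc from the former to its parent. At every
star the parent arc is put on the accepting side. The bottom-up pass runs deferred acceptance
without the candidates of the parent arc, and deletes those of them that the outcome beats at their
proposer. The top-down pass meets at most one dipath `x` on the parent arc, since the parent's star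
is already settled. Being alone at its acceptor, `x` is never rejected and causes no further
rejection (`iterate_insert_of_alone`). As it survived the bottom-up pass, nothing in the outcome
without it beats it at its proposer, so it belongs to the outcome with it (`mem_daResult_insert`).
Hence the choice made at the parent is confirmed and dominations found earlier persist. A dipath
deleted bottom-up stays dominated, because adding `x` can only improve what its proposer offers
(`daFinal_subset_daFinal_insert`). `Layout.down_invariant` assembles these facts.

For the running time, a round of deferred acceptance is linear in the number `p` of dipaths, and `p`
rounds suffice because every round that changes something rejects a candidate. With two steps at
each of the `n` vertices this gives order `n * p ^ 2`. The incidence tables and the peeling cost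
only order `n * p + n + p`. The programs are verified with the time-bounded triples `Tri`. -/

open Classical in
/-- The members of `M` that are the largest ones of `M` in their fibre of `key`; the fibre of `0`
imposes no condition. -/
noncomputable def best {ι : Type} (R : ι → ι → Prop) (key : ι → ℕ) (M : Finset ι) : Finset ι :=
  M.filter fun i => key i = 0 ∨ ∀ j ∈ M, key j = key i → R j i

open Classical in
/-- One round of deferred acceptance: the proposals `best R pr M` that are not the best ones at
their acceptor are rejected. -/
noncomputable def daStep {ι : Type} (R : ι → ι → Prop) (pr ac : ι → ℕ) (M : Finset ι) : Finset ι :=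
  M \ (best R pr M \ best R ac (best R pr M))

/-- The candidates that are never rejected. -/
noncomputable def daFinal {ι : Type} [Fintype ι] (R : ι → ι → Prop) (pr ac : ι → ℕ)
    (M : Finset ι) : Finset ι :=
  (daStep R pr ac)^[Fintype.card ι] M

/-- The outcome of deferred acceptance. -/
noncomputable def daResult {ι : Type} [Fintype ι] (R : ι → ι → Prop) (pr ac : ι → ℕ)
    (M : Finset ι) : Finset ι :=
  best R pr (daFinal R pr ac M)

/-- `R` is total and transitive on the fibres of `key` other than the fibre of `0`. -/
structure OrdersFibres {ι : Type} (R : ι → ι → Prop) (key : ι → ℕ) : Prop where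
  total : ∀ i j, key i ≠ 0 → key j = key i → R i j ∨ R j i
  trans : ∀ i j k, key i ≠ 0 → key j = key i → key k = key i → R i j → R j k → R i k

variable {ι : Type} {R : ι → ι → Prop} {key pr ac : ι → ℕ} {M M' : Finset ι}

lemma mem_best {i : ι} :
    i ∈ best R key M ↔ i ∈ M ∧ (key i = 0 ∨ ∀ j ∈ M, key j = key i → R j i) := by
  simp [best]

lemma best_subset : best R key M ⊆ M := fun _ h => (mem_best.1 h).1

lemma mem_best_of_subset (h : M ⊆ M') {i : ι} (hi : i ∈ M) (hb : i ∈ best R key M') :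
    i ∈ best R key M :=
  mem_best.2 ⟨hi, (mem_best.1 hb).2.imp id fun h' j hj => h' j (h hj)⟩

/-- A nonempty finite set that is totally preordered has a largest element. Reflexivity on a fibre
is totality applied to a single member. -/
lemma exists_best (hK : OrdersFibres R key) {i : ι} (hi : i ∈ M) (hk : key i ≠ 0) :
    ∃ j ∈ best R key M, key j = key i ∧ R i j := by
  classical
  have key_lemma : ∀ S : Finset ι, S ⊆ M → (∀ j ∈ S, key j = key i) → S.Nonempty →
      ∃ j ∈ S, ∀ k ∈ S, R k j := by
    intro S
    induction S using Finset.induction_on with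
    | empty => intro _ _ h; exact absurd h (by simp)
    | insert a S ha ih =>
      intro hS hkey _
      have hka : key a = key i := hkey a (by simp)
      have haa : R a a := by
        rcases hK.total a a (by rw [hka]; exact hk) rfl with h | h <;> exact h
      by_cases hne : S.Nonempty
      · obtain ⟨j, hj, hmax⟩ := ih (fun x hx => hS (by simp [hx])) (fun x hx => hkey x (by simp [hx])) hne
        have hkj : key j = key i := hkey j (by simp [hj])
        rcases hK.total a j (by rw [hka]; exact hk) (by rw [hka, hkj]) with h | h
        · refine ⟨j, by simp [hj], fun k hk => ?_⟩
          rcases Finset.mem_insert.1 hk with rfl | hk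
          · exact h
          · exact hmax k hk
        · refine ⟨a, by simp, fun k hk' => ?_⟩
          rcases Finset.mem_insert.1 hk' with rfl | hk'
          · exact haa
          · have hkk : key k = key i := hkey k (by simp [hk'])
            exact hK.trans k j a (by rw [hkk]; exact hk) (by rw [hkk, hkj]) (by rw [hkk, hka])
              (hmax k hk') h
      · rw [Finset.not_nonempty_iff_eq_empty] at hne
        subst hne
        exact ⟨a, by simp, by simpa using haa⟩
  obtain ⟨j, hj, hmax⟩ := key_lemma (M.filter fun j => key j = key i) (Finset.filter_subset _ _)
    (by simp) ⟨i, by simp [hi]⟩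
  rw [Finset.mem_filter] at hj
  refine ⟨j, mem_best.2 ⟨hj.1, Or.inr fun k hk hkk => hmax k ?_⟩, hj.2, hmax i (by simp [hi])⟩
  simp [hk, hkk, hj.2]

lemma eq_of_mem_best (hanti : ∀ i j, R i j → R j i → i = j) {i j : ι} (hi : i ∈ best R key M)
    (hj : j ∈ best R key M) (hk : key i ≠ 0) (h : key j = key i) : i = j := by
  rw [mem_best] at hi hj
  have h1 := hi.2.resolve_left hk j hj.1 h
  have h2 := hj.2.resolve_left (by rw [h]; exact hk) i hi.1 h.symm
  exact hanti _ _ h2 h1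

/-- A member that is not largest blocks nobody: if `x` stopped some `i` from being largest, totality
would put `i` below `x`, and transitivity would make `x` itself largest. -/
lemma best_insert_of_not_mem [DecidableEq ι] (hP : OrdersFibres R pr) {x : ι}
    (h : x ∉ best R pr (insert x M)) : best R pr (insert x M) = best R pr M := by
  ext i
  constructor
  · intro hi
    have hix : i ≠ x := fun h' => h (h' ▸ hi)
    exact mem_best_of_subset (Finset.subset_insert _ _)
      ((Finset.mem_insert.1 (best_subset hi)).resolve_left hix) hi
  · intro hi
    rw [mem_best] at hi
    refine mem_best.2 ⟨Finset.mem_insert_of_mem hi.1, hi.2.imp id fun hmax j hj hji => ?_⟩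
    rcases Finset.mem_insert.1 hj with rfl | hj
    · by_contra hR
      have h0 : pr j ≠ 0 := fun h0 => h (mem_best.2 ⟨by simp, Or.inl h0⟩)
      have hij : R i j := (hP.total j i h0 hji.symm).resolve_left hR
      refine h (mem_best.2 ⟨by simp, Or.inr fun k hk hkj => ?_⟩)
      rcases Finset.mem_insert.1 hk with rfl | hk
      · rcases hP.total k k h0 rfl with h' | h' <;> exact h'
      · exact hP.trans k i j (by rw [hkj]; exact h0) (by rw [hkj, hji]) hkj.symm
          (hmax k hk (hkj.trans hji)) hij
    · exact hmax j hj hji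

lemma mem_daStep {i : ι} : i ∈ daStep R pr ac M ↔
    i ∈ M ∧ (i ∈ best R pr M → i ∈ best R ac (best R pr M)) := by
  simp only [daStep, Finset.mem_sdiff]
  tauto

lemma daStep_subset : daStep R pr ac M ⊆ M := fun _ h => (mem_daStep.1 h).1

lemma iterate_daStep_subset (k : ℕ) : (daStep R pr ac)^[k] M ⊆ M := by
  induction k with
  | zero => simp
  | succ k ih =>
    rw [Function.iterate_succ_apply']
    exact daStep_subset.trans ih

variable [Fintype ι]

lemma daFinal_subset : daFinal R pr ac M ⊆ M := iterate_daStep_subset _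

lemma daResult_subset : daResult R pr ac M ⊆ M := best_subset.trans daFinal_subset

/-- Every round that is not stationary removes a candidate, so the rounds become stationary within
`Fintype.card ι` steps. -/
lemma daStep_daFinal : daStep R pr ac (daFinal R pr ac M) = daFinal R pr ac M := by
  have key_lemma : ∀ k, daStep R pr ac ((daStep R pr ac)^[k] M) = (daStep R pr ac)^[k] M ∨
      ((daStep R pr ac)^[k] M).card + k ≤ Fintype.card ι := by
    intro k
    induction k with
    | zero => right; simpa using Finset.card_le_univ M
    | succ k ih =>
      rw [Function.iterate_succ_apply']
      rcases ih with h | h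
      · left; rw [h, h]
      · by_cases he : daStep R pr ac ((daStep R pr ac)^[k] M) = (daStep R pr ac)^[k] M
        · left; rw [he, he]
        · right
          have := Finset.card_lt_card (lt_of_le_of_ne (daStep_subset (R := R) (pr := pr) (ac := ac)) he)
          omega
  rcases key_lemma (Fintype.card ι) with h | h
  · exact h
  · have h0 : daFinal R pr ac M = ∅ := by
      rw [← Finset.card_eq_zero]
      show ((daStep R pr ac)^[Fintype.card ι] M).card = 0
      omega
    rw [h0]
    exact Finset.subset_empty.1 daStep_subset

/-- At a fixed point of the rounds no offer is refused, so every offer is also the largest at its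
acceptor. -/
lemma mem_best_ac_of_mem_daResult {i : ι} (hi : i ∈ daResult R pr ac M) :
    i ∈ best R ac (daResult R pr ac M) := by
  have h : i ∈ daStep R pr ac (daFinal R pr ac M) := by
    rw [daStep_daFinal]; exact best_subset hi
  exact (mem_daStep.1 h).2 hi

lemma daResult_pr_injOn (hanti : ∀ i j, R i j → R j i → i = j) {i j : ι}
    (hi : i ∈ daResult R pr ac M) (hj : j ∈ daResult R pr ac M) (hk : pr i ≠ 0)
    (h : pr j = pr i) : i = j :=
  eq_of_mem_best hanti hi hj hk h

lemma daResult_ac_injOn (hanti : ∀ i j, R i j → R j i → i = j) {i j : ι}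
    (hi : i ∈ daResult R pr ac M) (hj : j ∈ daResult R pr ac M) (hk : ac i ≠ 0)
    (h : ac j = ac i) : i = j :=
  eq_of_mem_best hanti (mem_best_ac_of_mem_daResult hi) (mem_best_ac_of_mem_daResult hj) hk h

/-- Rejected candidates are dominated at their acceptor by the outcome. -/
lemma exists_daResult_of_rejected (hA : OrdersFibres R ac) {i : ι} (hi : i ∈ M)
    (hF : i ∉ daFinal R pr ac M) :
    ∃ j ∈ daResult R pr ac M, ac i ≠ 0 ∧ ac j = ac i ∧ R i j := by
  have key_lemma : ∀ k, i ∉ (daStep R pr ac)^[k] M →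
      ∃ j ∈ best R pr ((daStep R pr ac)^[k] M), ac i ≠ 0 ∧ ac j = ac i ∧ R i j := by
    intro k
    induction k with
    | zero => intro h; exact absurd hi h
    | succ k ih =>
      rw [Function.iterate_succ_apply']
      set F := (daStep R pr ac)^[k] M
      intro h
      -- Whether `i` is refused in this round or was refused before, its acceptor now holds an offer
      -- above it.
      have hdom : ∃ j ∈ best R ac (best R pr F), ac i ≠ 0 ∧ ac j = ac i ∧ R i j := by
        by_cases hiF : i ∈ F
        · rw [mem_daStep] at h
          push Not at h
          obtain ⟨h1, h2⟩ := h hiF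
          have hac : ac i ≠ 0 := fun h0 => h2 (mem_best.2 ⟨h1, Or.inl h0⟩)
          obtain ⟨j, hj, hj1, hj2⟩ := exists_best hA h1 hac
          exact ⟨j, hj, hac, hj1, hj2⟩
        · obtain ⟨j, hj, hac, hj1, hj2⟩ := ih hiF
          obtain ⟨j', hj', h1, h2⟩ := exists_best hA hj (by rw [hj1]; exact hac)
          exact ⟨j', hj', hac, h1.trans hj1, hA.trans i j j' hac hj1 (h1.trans hj1) hj2 h2⟩
      obtain ⟨j, hj, hj1⟩ := hdom
      have hjb := best_subset hj
      -- An offer that was kept remains the largest at its proposer when the candidates shrink, so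
      -- it is repeated in the next round.
      refine ⟨j, mem_best_of_subset daStep_subset ?_ hjb, hj1⟩
      exact mem_daStep.2 ⟨best_subset hjb, fun _ => hj⟩
  exact key_lemma _ hF

lemma exists_daResult_of_not_mem (hP : OrdersFibres R pr) {i : ι} (hi : i ∈ daFinal R pr ac M) :
    i ∈ daResult R pr ac M ∨ ∃ j ∈ daResult R pr ac M, pr i ≠ 0 ∧ pr j = pr i ∧ R i j := by
  by_cases h0 : pr i = 0
  · exact Or.inl (mem_best.2 ⟨hi, Or.inl h0⟩)
  · obtain ⟨j, hj, h1, h2⟩ := exists_best hP hi h0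
    exact Or.inr ⟨j, hj, h0, h1, h2⟩

/-- Candidates outside the outcome are dominated by the outcome. -/
lemma daResult_dominates (hP : OrdersFibres R pr) (hA : OrdersFibres R ac) {i : ι} (hi : i ∈ M)
    (hH : i ∉ daResult R pr ac M) :
    ∃ j ∈ daResult R pr ac M,
      ((pr i ≠ 0 ∧ pr j = pr i) ∨ (ac i ≠ 0 ∧ ac j = ac i)) ∧ R i j := by
  by_cases hF : i ∈ daFinal R pr ac M
  · obtain ⟨j, hj, h0, h1, h2⟩ := (exists_daResult_of_not_mem hP hF).resolve_left hH
    exact ⟨j, hj, Or.inl ⟨h0, h1⟩, h2⟩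
  · obtain ⟨j, hj, h0, h1, h2⟩ := exists_daResult_of_rejected hA hi hF
    exact ⟨j, hj, Or.inr ⟨h0, h1⟩, h2⟩

/-! ### Adding a candidate that is alone at its acceptor -/

/-- An additional candidate that is alone at its acceptor is never rejected, and does not cause any
additional rejection. -/
lemma iterate_insert_of_alone [DecidableEq ι] (hanti : ∀ i j, R i j → R j i → i = j)
    (hA : OrdersFibres R ac) {x : ι}
    (hx : ∀ i ∈ M, ac i ≠ ac x) (k : ℕ) :
    insert x (daFinal R pr ac M) ⊆ (daStep R pr ac)^[k] (insert x M) := by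
  induction k with
  | zero => exact Finset.insert_subset_insert _ daFinal_subset
  | succ k ih =>
    rw [Function.iterate_succ_apply']
    have hsub : (daStep R pr ac)^[k] (insert x M) ⊆ insert x M := iterate_daStep_subset k
    set F' := (daStep R pr ac)^[k] (insert x M)
    have hself : ∀ i, ac i ≠ 0 → R i i := fun i h => by
      rcases hA.total i i h rfl with h | h <;> exact h
    intro i hi
    refine mem_daStep.2 ⟨ih hi, fun hb => mem_best.2 ⟨hb, ?_⟩⟩
    by_cases h0 : ac i = 0
    · exact Or.inl h0
    refine Or.inr fun j hj hji => ?_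
    rcases Finset.mem_insert.1 hi with rfl | hiF
    · rcases Finset.mem_insert.1 (hsub (best_subset hj)) with rfl | hjM
      · exact hself _ h0
      · exact absurd hji (hx j hjM)
    -- An old candidate `i` that proposes here already belongs to the old outcome. A rival at its
    -- acceptor is either in the old outcome, hence equal to `i`, or was rejected in the old run,
    -- hence lies below the unique old winner there, which is `i`.
    · have hiH : i ∈ daResult R pr ac M :=
        mem_best_of_subset ((Finset.subset_insert _ _).trans ih) hiF hb
      rcases Finset.mem_insert.1 (hsub (best_subset hj)) with rfl | hjM
      · exact absurd hji.symm (hx i (daFinal_subset hiF))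
      · by_cases hjF : j ∈ daFinal R pr ac M
        · have hjH : j ∈ daResult R pr ac M :=
            mem_best_of_subset ((Finset.subset_insert _ _).trans ih) hjF hj
          rw [daResult_ac_injOn hanti hiH hjH h0 hji]
          exact hself _ (by rw [hji]; exact h0)
        · obtain ⟨j', hj', _, h1, h2⟩ := exists_daResult_of_rejected hA hjM hjF
          rw [daResult_ac_injOn hanti hiH hj' h0 (h1.trans hji)]
          exact h2

lemma daFinal_subset_daFinal_insert [DecidableEq ι] (hanti : ∀ i j, R i j → R j i → i = j)
    (hA : OrdersFibres R ac) {x : ι} (hx : ∀ i ∈ M, ac i ≠ ac x) :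
    daFinal R pr ac M ⊆ daFinal R pr ac (insert x M) :=
  (Finset.subset_insert _ _).trans (iterate_insert_of_alone hanti hA hx _)

/-- An additional candidate that is alone at its acceptor and not dominated at its proposer belongs
to the new outcome. -/
lemma mem_daResult_insert [DecidableEq ι] (hanti : ∀ i j, R i j → R j i → i = j)
    (hP : OrdersFibres R pr)
    (hA : OrdersFibres R ac) {x : ι} (hx : ∀ i ∈ M, ac i ≠ ac x)
    (hgood : ∀ h ∈ daResult R pr ac M, pr x ≠ 0 → pr h = pr x → ¬ R x h) :
    x ∈ daResult R pr ac (insert x M) := by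
  by_contra hcon
  have hin : ∀ k, x ∈ (daStep R pr ac)^[k] (insert x M) := fun k =>
    iterate_insert_of_alone hanti hA hx k (Finset.mem_insert_self _ _)
  have hxM : x ∉ M := fun h => hx x h rfl
  -- Since `x` is never rejected and remains largest in smaller sets, a single proposal by `x` would
  -- persist to the end. The number `d` counts the rounds left.
  have hnot : ∀ d k, k + d = Fintype.card ι →
      x ∉ best R pr ((daStep R pr ac)^[k] (insert x M)) := by
    intro d
    induction d with
    | zero => intro k hk; rw [show k = Fintype.card ι from hk]; exact hcon
    | succ d ih =>
      intro k hk hb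
      refine ih (k + 1) (by omega) (mem_best_of_subset ?_ (hin (k + 1)) hb)
      rw [Function.iterate_succ_apply']
      exact daStep_subset
  -- As `x` never proposes, it influences no round, and the runs with and without it differ only by
  -- `x`.
  have heq : ∀ k, k ≤ Fintype.card ι →
      (daStep R pr ac)^[k] (insert x M) = insert x ((daStep R pr ac)^[k] M) := by
    intro k
    induction k with
    | zero => intro _; rfl
    | succ k ih =>
      intro hk
      have hk' := ih (by omega)
      have hb := hnot (Fintype.card ι - k) k (by omega)
      rw [Function.iterate_succ_apply', Function.iterate_succ_apply', hk']
      rw [hk'] at hb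
      have hbe := best_insert_of_not_mem hP hb
      ext i
      rw [Finset.mem_insert, mem_daStep, mem_daStep, hbe, Finset.mem_insert]
      constructor
      · rintro ⟨rfl | h1, h2⟩
        · exact Or.inl rfl
        · exact Or.inr ⟨h1, h2⟩
      · rintro (rfl | ⟨h1, h2⟩)
        · refine ⟨Or.inl rfl, fun h => ?_⟩
          rw [hbe] at hb
          exact absurd h hb
        · exact ⟨Or.inr h1, h2⟩
  have hF : daFinal R pr ac (insert x M) = insert x (daFinal R pr ac M) := heq _ le_rfl
  have hxF : x ∈ daFinal R pr ac (insert x M) := hin _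
  obtain ⟨j, hj, h0, h1, h2⟩ := (exists_daResult_of_not_mem hP hxF).resolve_left hcon
  have hj' : j ∈ daResult R pr ac M := by
    rw [daResult, hF] at hj
    rw [daResult, hF] at hcon
    rwa [best_insert_of_not_mem hP hcon] at hj
  exact hgood j hj' h0 h1 h2

end Star

end DipathKernel

/-! ### The two passes over the vertices -/

namespace DipathKernel

section Passes

open Classical in
/-- Bottom-up step at a star with parent arc `q`: the members that contain the parent arc and are
dominated at their proposer by the outcome of deferred acceptance without the parent arc are
deleted. -/
noncomputable def bottomUp {ι : Type} [Fintype ι] (R : ι → ι → Prop) (pr ac : ι → ℕ) (q : ℕ)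
    (L : Finset ι) : Finset ι :=
  L.filter fun i => ¬ (ac i = q ∧
    ∃ h ∈ daResult R pr ac (L.filter fun i => (pr i ≠ 0 ∨ ac i ≠ 0) ∧ ac i ≠ q),
      pr i ≠ 0 ∧ pr h = pr i ∧ R i h)

open Classical in
/-- Top-down step at a star: of the members that have an arc of the star, only the outcome of
deferred acceptance is kept. -/
noncomputable def topDown {ι : Type} [Fintype ι] (R : ι → ι → Prop) (pr ac : ι → ℕ)
    (L : Finset ι) : Finset ι :=
  L.filter fun i => pr i ≠ 0 ∨ ac i ≠ 0 →
    i ∈ daResult R pr ac (L.filter fun i => pr i ≠ 0 ∨ ac i ≠ 0)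

open Classical in
/-- The arcs of a star that propose: those directed oppositely to the parent arc `q`. -/
noncomputable def proposer {ι : Type} (prv nxt : ι → ℕ) (q : ℕ) (i : ι) : ℕ :=
  if ∃ j, prv j = q then nxt i else prv i

open Classical in
/-- The arcs of a star that accept: those directed like the parent arc `q`. -/
noncomputable def acceptor {ι : Type} (prv nxt : ι → ℕ) (q : ℕ) (i : ι) : ℕ :=
  if ∃ j, prv j = q then prv i else nxt i

/-- The incidences between paths and vertices, `prv v i` and `nxt v i` being the successors of the
numbers of the vertices before and after `v` on path `i`, or `0` if there are none, together with an
enumeration `ord 0, …, ord (n - 1)` of the vertices and a parent code `par v` for each `v`. -/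
structure Layout {ι : Type} (R : ι → ι → Prop) (n : ℕ) (prv nxt : ℕ → ι → ℕ) (par ord : ℕ → ℕ) :
    Prop where
  anti : ∀ i j, R i j → R j i → i = j
  nxt_iff : ∀ u v i, nxt u i = v + 1 ↔ prv v i = u + 1
  oriented : ∀ v i j, nxt v i ≠ 0 → nxt v i ≠ prv v j
  prv_orders : ∀ v, OrdersFibres R (prv v)
  nxt_orders : ∀ v, OrdersFibres R (nxt v)
  passes_parent : ∀ i j k, j < k → k < n → (prv (ord j) i ≠ 0 ∨ nxt (ord j) i ≠ 0) →
    (prv (ord k) i ≠ 0 ∨ nxt (ord k) i ≠ 0) →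
    prv (ord j) i = par (ord j) ∨ nxt (ord j) i = par (ord j)
  parent_later : ∀ i j, j < n → (prv (ord j) i = par (ord j) ∨ nxt (ord j) i = par (ord j)) →
    ∃ k, j < k ∧ k < n ∧ par (ord j) = ord k + 1
  exists_ord : ∀ v i, prv v i ≠ 0 ∨ nxt v i ≠ 0 → ∃ k < n, v = ord k

/-- The paths that survive the bottom-up steps at the first `k` vertices. -/
noncomputable def upSeq {ι : Type} [Fintype ι] (R : ι → ι → Prop) (prv nxt : ℕ → ι → ℕ)
    (par ord : ℕ → ℕ) : ℕ → Finset ι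
  | 0 => Finset.univ
  | k + 1 => bottomUp R (proposer (prv (ord k)) (nxt (ord k)) (par (ord k)))
      (acceptor (prv (ord k)) (nxt (ord k)) (par (ord k))) (par (ord k))
      (upSeq R prv nxt par ord k)

/-- The paths that survive all bottom-up steps and the top-down steps at the last `k` vertices. -/
noncomputable def downSeq {ι : Type} [Fintype ι] (R : ι → ι → Prop) (n : ℕ) (prv nxt : ℕ → ι → ℕ)
    (par ord : ℕ → ℕ) : ℕ → Finset ι
  | 0 => upSeq R prv nxt par ord n
  | k + 1 =>
      topDown R
        (proposer (prv (ord (n - 1 - k))) (nxt (ord (n - 1 - k))) (par (ord (n - 1 - k))))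
        (acceptor (prv (ord (n - 1 - k))) (nxt (ord (n - 1 - k))) (par (ord (n - 1 - k))))
        (downSeq R n prv nxt par ord k)

/-- Two paths share an arc at a vertex. -/
def Meets {ι : Type} (prv nxt : ι → ℕ) (i j : ι) : Prop :=
  (prv i ≠ 0 ∧ prv j = prv i) ∨ (nxt i ≠ 0 ∧ nxt j = nxt i)

variable {ι : Type} {R : ι → ι → Prop}

/-- Meeting is symmetric in the two sides of the star, so it does not matter which side proposes.
The direction of the parent arc is read off from the paths using it; if none does, either choice of
sides serves. -/
lemma meets_iff {prv nxt : ι → ℕ} {q : ℕ} {i j : ι} :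
    (proposer prv nxt q i ≠ 0 ∧ proposer prv nxt q j = proposer prv nxt q i) ∨
      (acceptor prv nxt q i ≠ 0 ∧ acceptor prv nxt q j = acceptor prv nxt q i) ↔
      Meets prv nxt i j := by
  unfold proposer acceptor Meets
  split_ifs <;> tauto

lemma on_iff {prv nxt : ι → ℕ} {q : ℕ} {i : ι} :
    (proposer prv nxt q i ≠ 0 ∨ acceptor prv nxt q i ≠ 0) ↔ (prv i ≠ 0 ∨ nxt i ≠ 0) := by
  unfold proposer acceptor
  split_ifs <;> tauto

lemma proposer_pos {prv nxt : ι → ℕ} {q : ℕ} (h : ∃ j, prv j = q) :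
    proposer prv nxt q = nxt := funext fun _ => if_pos h

lemma proposer_neg {prv nxt : ι → ℕ} {q : ℕ} (h : ¬ ∃ j, prv j = q) :
    proposer prv nxt q = prv := funext fun _ => if_neg h

lemma acceptor_pos {prv nxt : ι → ℕ} {q : ℕ} (h : ∃ j, prv j = q) :
    acceptor prv nxt q = prv := funext fun _ => if_pos h

lemma acceptor_neg {prv nxt : ι → ℕ} {q : ℕ} (h : ¬ ∃ j, prv j = q) :
    acceptor prv nxt q = nxt := funext fun _ => if_neg h

lemma ordersFibres_star {prv nxt : ι → ℕ} (h1 : OrdersFibres R prv) (h2 : OrdersFibres R nxt)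
    (q : ℕ) :
    OrdersFibres R (proposer prv nxt q) ∧ OrdersFibres R (acceptor prv nxt q) := by
  by_cases h : ∃ j, prv j = q
  · rw [proposer_pos h, acceptor_pos h]
    exact ⟨h2, h1⟩
  · rw [proposer_neg h, acceptor_neg h]
    exact ⟨h1, h2⟩

variable [Fintype ι] {n : ℕ} {prv nxt : ℕ → ι → ℕ} {par ord : ℕ → ℕ}

/-- The candidates are described by membership, so that the set a program has stored can be
substituted for the filter in the definition. -/
lemma mem_bottomUp {pr ac : ι → ℕ} {q : ℕ} {L M : Finset ι}
    (hM : ∀ i, i ∈ M ↔ i ∈ L ∧ (pr i ≠ 0 ∨ ac i ≠ 0) ∧ ac i ≠ q) {i : ι} :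
    i ∈ bottomUp R pr ac q L ↔ i ∈ L ∧ ¬ (ac i = q ∧
      ∃ h ∈ daResult R pr ac M, pr i ≠ 0 ∧ pr h = pr i ∧ R i h) := by
  classical
  have : M = L.filter fun i => (pr i ≠ 0 ∨ ac i ≠ 0) ∧ ac i ≠ q := by
    ext i; rw [hM, Finset.mem_filter]
  subst this
  unfold bottomUp
  rw [Finset.mem_filter]

lemma mem_topDown {pr ac : ι → ℕ} {L M : Finset ι}
    (hM : ∀ i, i ∈ M ↔ i ∈ L ∧ (pr i ≠ 0 ∨ ac i ≠ 0)) {i : ι} :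
    i ∈ topDown R pr ac L ↔ i ∈ L ∧ (pr i ≠ 0 ∨ ac i ≠ 0 → i ∈ daResult R pr ac M) := by
  classical
  have : M = L.filter fun i => pr i ≠ 0 ∨ ac i ≠ 0 := by
    ext i; rw [hM, Finset.mem_filter]
  subst this
  unfold topDown
  rw [Finset.mem_filter]

lemma topDown_subset {pr ac : ι → ℕ} {L : Finset ι} : topDown R pr ac L ⊆ L := by
  classical exact Finset.filter_subset _ _

lemma bottomUp_subset {pr ac : ι → ℕ} {q : ℕ} {L : Finset ι} : bottomUp R pr ac q L ⊆ L := by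
  classical exact Finset.filter_subset _ _

lemma upSeq_antitone {j k : ℕ} (h : j ≤ k) :
    upSeq R prv nxt par ord k ⊆ upSeq R prv nxt par ord j := by
  induction k, h using Nat.le_induction with
  | base => exact subset_rfl
  | succ k _ ih => exact bottomUp_subset.trans ih

lemma downSeq_subset (k : ℕ) :
    downSeq R n prv nxt par ord k ⊆ upSeq R prv nxt par ord n := by
  induction k with
  | zero => exact subset_rfl
  | succ k ih => exact topDown_subset.trans ih

/-- A bottom-up step deletes only paths through the parent arc, so a deletion reveals a vertex whose
parent arc the path contains. -/
lemma deleted_up {j k : ℕ} (hjk : j ≤ k) {i : ι} (hi : i ∈ upSeq R prv nxt par ord j)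
    (hi' : i ∉ upSeq R prv nxt par ord k) :
    ∃ l, j ≤ l ∧ l < k ∧
      acceptor (prv (ord l)) (nxt (ord l)) (par (ord l)) i = par (ord l) := by
  induction k, hjk using Nat.le_induction with
  | base => exact absurd hi hi'
  | succ k hjk ih =>
    classical
    by_cases h : i ∈ upSeq R prv nxt par ord k
    · rw [upSeq, bottomUp, Finset.mem_filter] at hi'
      push Not at hi'
      exact ⟨k, hjk, by omega, (hi' h).1⟩
    · obtain ⟨l, h1, h2, h3⟩ := ih h
      exact ⟨l, h1, by omega, h3⟩

lemma deleted_down {k : ℕ} (hk : k ≤ n) {i : ι} (hi : i ∈ upSeq R prv nxt par ord n)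
    (hi' : i ∉ downSeq R n prv nxt par ord k) :
    ∃ l, n - k ≤ l ∧ l < n ∧ (prv (ord l) i ≠ 0 ∨ nxt (ord l) i ≠ 0) := by
  induction k with
  | zero => exact absurd hi hi'
  | succ k ih =>
    classical
    by_cases h : i ∈ downSeq R n prv nxt par ord k
    · rw [downSeq, topDown, Finset.mem_filter] at hi'
      push Not at hi'
      exact ⟨n - 1 - k, by omega, by omega, on_iff.1 (hi' h).1⟩
    · obtain ⟨l, h1, h2, h3⟩ := ih (by omega) h
      exact ⟨l, by omega, h2, h3⟩

/-! ### Correctness of the two passes -/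

namespace Layout

variable (hL : Layout R n prv nxt par ord)
include hL

/-- The path contains the parent arc by `passes_parent`. That this arc lies on the accepting side
follows from `oriented`: no other path can traverse it in the opposite direction. -/
lemma acceptor_eq_parent {i : ι} {j k : ℕ} (hjk : j < k) (hk : k < n)
    (hj : prv (ord j) i ≠ 0 ∨ nxt (ord j) i ≠ 0) (h : prv (ord k) i ≠ 0 ∨ nxt (ord k) i ≠ 0) :
    acceptor (prv (ord j)) (nxt (ord j)) (par (ord j)) i = par (ord j) := by
  have h1 := hL.passes_parent i j k hjk hk hj h
  obtain ⟨k', _, _, hk'⟩ := hL.parent_later i j (hjk.trans hk) h1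
  unfold acceptor
  split_ifs with hd
  · rcases h1 with h1 | h1
    · exact h1
    · obtain ⟨j', hj'⟩ := hd
      exact absurd (h1.trans hj'.symm) (hL.oriented _ _ _ (by rw [h1, hk']; simp))
  · rcases h1 with h1 | h1
    · exact absurd ⟨i, h1⟩ hd
    · exact h1

lemma parent_spec {i : ι} {j : ℕ} (hj : j < n)
    (h : acceptor (prv (ord j)) (nxt (ord j)) (par (ord j)) i = par (ord j)) :
    ∃ k, j < k ∧ k < n ∧ par (ord j) = ord k + 1 := by
  apply hL.parent_later i j hj
  unfold acceptor at h
  split_ifs at h <;> tauto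

/-- Two paths that contain the parent arc share an arc at the parent. -/
lemma meets_parent {i i' : ι} {j k : ℕ} (hk : par (ord j) = ord k + 1)
    (h : acceptor (prv (ord j)) (nxt (ord j)) (par (ord j)) i = par (ord j))
    (h' : acceptor (prv (ord j)) (nxt (ord j)) (par (ord j)) i' = par (ord j)) :
    Meets (prv (ord k)) (nxt (ord k)) i i' := by
  unfold acceptor at h h'
  split_ifs at h h'
  · rw [hk] at h h'
    rw [← hL.nxt_iff] at h h'
    exact Or.inr ⟨by omega, by omega⟩
  · rw [hk] at h h'
    rw [hL.nxt_iff] at h h'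
    exact Or.inl ⟨by omega, by omega⟩

lemma on_of_acceptor {i : ι} {j : ℕ} (hj : j < n)
    (h : acceptor (prv (ord j)) (nxt (ord j)) (par (ord j)) i = par (ord j)) :
    prv (ord j) i ≠ 0 ∨ nxt (ord j) i ≠ 0 := by
  obtain ⟨k, _, _, hk⟩ := hL.parent_spec hj h
  exact on_iff.1 (Or.inr (by rw [h, hk]; simp))

/-- A path that is deleted between the two steps at a vertex whose star it meets contains the parent
arc. -/
lemma mem_down_of_mem_up {i : ι} {j : ℕ} (hj : j < n) (hi : i ∈ upSeq R prv nxt par ord j)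
    (hon : prv (ord j) i ≠ 0 ∨ nxt (ord j) i ≠ 0)
    (hq : acceptor (prv (ord j)) (nxt (ord j)) (par (ord j)) i ≠ par (ord j)) :
    i ∈ downSeq R n prv nxt par ord (n - 1 - j) := by
  by_contra hcon
  -- Both kinds of deletion between the two steps occur at a later vertex where the path has an arc.
  -- The bottom-up deletion at `ord j` itself is excluded, as the path avoids the parent arc.
  have : ∃ l, j < l ∧ l < n ∧ (prv (ord l) i ≠ 0 ∨ nxt (ord l) i ≠ 0) := by
    by_cases h : i ∈ upSeq R prv nxt par ord n
    · obtain ⟨l, h1, h2, h3⟩ := deleted_down (by omega) h hcon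
      exact ⟨l, by omega, h2, h3⟩
    · obtain ⟨l, h1, h2, h3⟩ := deleted_up hj.le hi h
      rcases eq_or_lt_of_le h1 with rfl | h1
      · exact absurd h3 hq
      · exact ⟨l, h1, h2, hL.on_of_acceptor h2 h3⟩
  obtain ⟨l, h1, h2, h3⟩ := this
  exact hq (hL.acceptor_eq_parent h1 h2 hon h3)

/-- The invariant of the top-down pass. -/
lemma down_invariant (k : ℕ) (hk : k ≤ n) :
    (∀ l, n - k ≤ l → l < n → ∀ i ∈ downSeq R n prv nxt par ord k,
      ∀ j ∈ downSeq R n prv nxt par ord k, Meets (prv (ord l)) (nxt (ord l)) i j → i = j) ∧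
    ∀ i ∈ upSeq R prv nxt par ord (n - k), i ∉ downSeq R n prv nxt par ord k →
      ∃ h ∈ downSeq R n prv nxt par ord k, ∃ l, n - k ≤ l ∧ l < n ∧
        Meets (prv (ord l)) (nxt (ord l)) i h ∧ R i h := by
  classical
  induction k with
  | zero => exact ⟨fun l h1 h2 => by omega, fun i hi hi' => absurd hi hi'⟩
  | succ k ih =>
    obtain ⟨ih1, ih2⟩ := ih (by omega)
    -- Passing from `k` to `k + 1` performs the top-down step at `ord j` and takes back the
    -- bottom-up step there, so the paths deleted by either one must be shown to be dominated.
    obtain ⟨j, hj⟩ : ∃ j, j = n - 1 - k := ⟨_, rfl⟩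
    have hjn : j < n := by omega
    have e1 : n - (k + 1) = j := by omega
    have e2 : n - k = j + 1 := by omega
    have e3 : k = n - 1 - j := by omega
    rw [e1]
    rw [e2] at ih1 ih2
    have hC : downSeq R n prv nxt par ord (k + 1) =
        topDown R (proposer (prv (ord j)) (nxt (ord j)) (par (ord j)))
          (acceptor (prv (ord j)) (nxt (ord j)) (par (ord j)))
          (downSeq R n prv nxt par ord k) := by
      rw [hj]; rfl
    have hA : upSeq R prv nxt par ord (j + 1) =
        bottomUp R (proposer (prv (ord j)) (nxt (ord j)) (par (ord j)))
          (acceptor (prv (ord j)) (nxt (ord j)) (par (ord j))) (par (ord j))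
          (upSeq R prv nxt par ord j) := rfl
    have hmem := fun i => hL.mem_down_of_mem_up (i := i) hjn
    rw [← e3] at hmem
    have hLA : downSeq R n prv nxt par ord k ⊆ upSeq R prv nxt par ord (j + 1) :=
      (downSeq_subset k).trans (upSeq_antitone (by omega))
    have hAA : upSeq R prv nxt par ord (j + 1) ⊆ upSeq R prv nxt par ord j :=
      upSeq_antitone (by omega)
    set L := downSeq R n prv nxt par ord k
    set pr := proposer (prv (ord j)) (nxt (ord j)) (par (ord j)) with hpr
    set ac := acceptor (prv (ord j)) (nxt (ord j)) (par (ord j)) with hac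
    set q := par (ord j)
    obtain ⟨hP, hAc⟩ := ordersFibres_star (hL.prv_orders (ord j)) (hL.nxt_orders (ord j)) q
    rw [← hpr] at hP
    rw [← hac] at hAc
    set M := (upSeq R prv nxt par ord j).filter fun i => (pr i ≠ 0 ∨ ac i ≠ 0) ∧ ac i ≠ q with hM
    set M' := L.filter fun i => pr i ≠ 0 ∨ ac i ≠ 0 with hM'
    -- Candidates without the parent arc cannot disappear between the two steps at this vertex.
    have hMM' : M ⊆ M' := by
      intro i hi
      rw [hM, Finset.mem_filter] at hi
      exact Finset.mem_filter.2 ⟨hmem i hi.1 (on_iff.1 hi.2.1) hi.2.2, hi.2.1⟩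
    have hM'M : ∀ i ∈ M', ac i ≠ q → i ∈ M := fun i hi hq => by
      rw [hM', Finset.mem_filter] at hi
      exact Finset.mem_filter.2 ⟨hAA (hLA hi.1), hi.2, hq⟩
    -- Paths through the parent arc share an arc at the parent, where the survivors are already
    -- disjoint.
    have huniq : ∀ i ∈ M', ∀ i' ∈ M', ac i = q → ac i' = q → i = i' := by
      intro i hi i' hi' h h'
      obtain ⟨k', h1, h2, h3⟩ := hL.parent_spec hjn h
      exact ih1 k' (by omega) h2 i (Finset.mem_filter.1 hi).1 i' (Finset.mem_filter.1 hi').1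
        (hL.meets_parent h3 h h')
    -- the parent's choice is confirmed
    have hconf : (∀ x ∈ M', ac x = q → x ∈ daResult R pr ac M') ∧
        daFinal R pr ac M ⊆ daFinal R pr ac M' := by
      by_cases hx : ∃ x ∈ M', ac x = q
      · obtain ⟨x, hx, hxq⟩ := hx
        have hins : M' = insert x M := by
          ext i
          rw [Finset.mem_insert]
          refine ⟨fun hi => ?_, ?_⟩
          · by_cases hq : ac i = q
            · exact Or.inl (huniq i hi x hx hq hxq)
            · exact Or.inr (hM'M i hi hq)
          · rintro (rfl | hi)
            · exact hx
            · exact hMM' hi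
        have halone : ∀ i ∈ M, ac i ≠ ac x := fun i hi => by
          rw [hxq]; exact (Finset.mem_filter.1 hi).2.2
        rw [hins]
        refine ⟨fun y hy hyq => ?_, daFinal_subset_daFinal_insert hL.anti hAc halone⟩
        have hyx : y = x := huniq y (hins ▸ hy) x hx hyq hxq
        subst hyx
        refine mem_daResult_insert hL.anti hP hAc halone fun h hh h0 h1 h2 => ?_
        -- Surviving the bottom-up step says precisely that no member of the outcome without the
        -- parent arc beats `y` at its proposer.
        have := hLA (Finset.mem_filter.1 hx).1
        rw [hA, bottomUp, Finset.mem_filter] at this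
        exact this.2 ⟨hxq, h, hh, h0, h1, h2⟩
      · push Not at hx
        refine ⟨fun x hx' hq => absurd hq (hx x hx'), ?_⟩
        have : M = M' := Finset.Subset.antisymm hMM' fun i hi => hM'M i hi (hx i hi)
        rw [this]
    have hCmem : ∀ i, i ∈ downSeq R n prv nxt par ord (k + 1) ↔
        i ∈ L ∧ (pr i ≠ 0 ∨ ac i ≠ 0 → i ∈ daResult R pr ac M') := fun i => by
      rw [hC, topDown, Finset.mem_filter]
    have hHC : ∀ i ∈ daResult R pr ac M', i ∈ downSeq R n prv nxt par ord (k + 1) := fun i hi =>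
      (hCmem i).2 ⟨(Finset.mem_filter.1 (daResult_subset hi)).1, fun _ => hi⟩
    refine ⟨fun l hl1 hl2 i hi i' hi' hmeet => ?_, fun i hi hiC => ?_⟩
    · rw [hCmem] at hi hi'
      rcases eq_or_lt_of_le hl1 with rfl | hl1
      · have hmeet' : Meets (prv (ord j)) (nxt (ord j)) i' i := by
          unfold Meets at hmeet ⊢
          rcases hmeet with ⟨h1, h2⟩ | ⟨h1, h2⟩
          · exact Or.inl ⟨by rwa [h2], h2.symm⟩
          · exact Or.inr ⟨by rwa [h2], h2.symm⟩
        rw [← meets_iff (q := q)] at hmeet hmeet'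
        have hi1 := hi.2 (hmeet.imp And.left And.left)
        have hi1' := hi'.2 (hmeet'.imp And.left And.left)
        rcases hmeet with h | h
        · exact daResult_pr_injOn hL.anti hi1 hi1' h.1 h.2
        · exact daResult_ac_injOn hL.anti hi1 hi1' h.1 h.2
      · exact ih1 l hl1 hl2 i hi.1 i' hi'.1 hmeet
    · by_cases hup : i ∈ upSeq R prv nxt par ord (j + 1)
      · by_cases hiL : i ∈ L
        · rw [hCmem] at hiC
          push Not at hiC
          obtain ⟨hon, hiH⟩ := hiC hiL
          obtain ⟨h, hh, h1, h2⟩ := daResult_dominates hP hAc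
            (Finset.mem_filter.2 ⟨hiL, hon⟩) hiH
          exact ⟨h, hHC h hh, j, le_rfl, hjn, meets_iff.1 h1, h2⟩
        · obtain ⟨h, hh, l, hl1, hl2, hm, hR⟩ := ih2 i hup hiL
          -- The old dominator `h` has an arc at a later vertex. If it also has one here, it
          -- contains the parent arc and is the confirmed choice, so it survives this step.
          refine ⟨h, (hCmem h).2 ⟨hh, fun hon => ?_⟩, l, by omega, hl2, hm, hR⟩
          refine hconf.1 h (Finset.mem_filter.2 ⟨hh, hon⟩) ?_
          refine hL.acceptor_eq_parent (k := l) (by omega) hl2 (on_iff.1 hon) ?_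
          rcases hm with ⟨h1, h2⟩ | ⟨h1, h2⟩
          · exact Or.inl (by rwa [h2])
          · exact Or.inr (by rwa [h2])
      · rw [hA, bottomUp, Finset.mem_filter] at hup
        push Not at hup
        obtain ⟨hq, h, hh, h0, h1, h2⟩ := hup hi
        -- The path `h` that caused the deletion need not be in the new outcome, but it is still not
        -- rejected. The winner at its proposer is above `h`, hence above `i`.
        have hhF : h ∈ daFinal R pr ac M' := hconf.2 (best_subset hh)
        obtain ⟨h', hh', h1', h2'⟩ := exists_best hP hhF (by rw [h1]; exact h0)
        exact ⟨h', hHC h' hh', j, le_rfl, hjn, meets_iff.1 (Or.inl ⟨h0, h1'.trans h1⟩),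
          hP.trans i h h' h0 h1 (h1'.trans h1) h2 h2'⟩

/-- The result of the two passes is stable and dominates all other paths. -/
theorem downSeq_kernel :
    (∀ i ∈ downSeq R n prv nxt par ord n, ∀ j ∈ downSeq R n prv nxt par ord n,
      ∀ v, Meets (prv v) (nxt v) i j → i = j) ∧
    ∀ i, i ∉ downSeq R n prv nxt par ord n →
      ∃ h ∈ downSeq R n prv nxt par ord n, ∃ v, Meets (prv v) (nxt v) i h ∧ R i h := by
  obtain ⟨h1, h2⟩ := hL.down_invariant n le_rfl
  rw [Nat.sub_self] at h1 h2
  refine ⟨fun i hi j hj v hm => ?_, fun i hi => ?_⟩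
  · obtain ⟨k, hk, rfl⟩ := hL.exists_ord v i (hm.imp And.left And.left)
    exact h1 k (by omega) hk i hi j hj hm
  · obtain ⟨h, hh, l, _, _, hm, hR⟩ := h2 i (Finset.mem_univ i) hi
    exact ⟨h, hh, ord l, hm, hR⟩

end Layout

end Passes

end DipathKernel

/-! ### Reasoning about programs -/

namespace DipathKernel

namespace Prog

/-- The registers that a program may change. -/
def regs : Prog → List ℕ
  | skip => []
  | set x _ => [x]
  | put _ _ _ => []
  | seq c d => c.regs ++ d.regs
  | ite _ _ c d => c.regs ++ d.regs
  | loop _ _ c => c.regs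

/-- The arrays that a program may change. -/
def arrs : Prog → List ℕ
  | skip => []
  | set _ _ => []
  | put a _ _ => [a]
  | seq c d => c.arrs ++ d.arrs
  | ite _ _ c d => c.arrs ++ d.arrs
  | loop _ _ c => c.arrs

/-- Programs without loops. -/
def loopFree : Prog → Bool
  | skip => true
  | set _ _ => true
  | put _ _ _ => true
  | seq c d => c.loopFree && d.loopFree
  | ite _ _ c d => c.loopFree && d.loopFree
  | loop _ _ _ => false

/-- The result of a program without loops. -/
def run : Prog → State → State
  | skip, s => s
  | set x e, s => s.setReg x (e.eval s)
  | put a e f, s => s.setArr a (e.eval s) (f.eval s)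
  | seq c d, s => d.run (c.run s)
  | ite e f c d, s => if e.eval s < f.eval s then c.run s else d.run s
  | loop _ _ _, s => s

/-- A bound on the number of steps of a program without loops. -/
def cost : Prog → ℕ
  | skip => 1
  | set _ e => e.cost + 1
  | put _ e f => e.cost + f.cost + 1
  | seq c d => c.cost + d.cost
  | ite e f c d => e.cost + f.cost + 1 + max c.cost d.cost
  | loop _ _ _ => 0

end Prog

/-! ### Frames, time-bounded triples and the loop rule -/

/-- Two states agree outside the given registers and arrays. -/
structure Frame (xs as : List ℕ) (s s' : State) : Prop where
  reg : ∀ x, x ∉ xs → s'.reg x = s.reg x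
  arr : ∀ a, a ∉ as → s'.arr a = s.arr a

lemma Frame.refl (xs as : List ℕ) (s : State) : Frame xs as s s := ⟨fun _ _ => rfl, fun _ _ => rfl⟩

lemma Frame.trans {xs as : List ℕ} {s s' s'' : State} (h : Frame xs as s s')
    (h' : Frame xs as s' s'') : Frame xs as s s'' :=
  ⟨fun x hx => (h'.reg x hx).trans (h.reg x hx), fun a ha => (h'.arr a ha).trans (h.arr a ha)⟩

lemma Frame.mono {xs as ys bs : List ℕ} {s s' : State} (h : Frame xs as s s') (h1 : xs ⊆ ys)
    (h2 : as ⊆ bs) : Frame ys bs s s' :=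
  ⟨fun x hx => h.reg x fun h' => hx (h1 h'), fun a ha => h.arr a fun h' => ha (h2 h')⟩

lemma Frame.setReg {xs as : List ℕ} {s s' : State} (h : Frame xs as s s') {x : ℕ} (hx : x ∈ xs)
    (v : ℕ) : Frame xs as s (s'.setReg x v) :=
  ⟨fun y hy => by
    have : y ≠ x := fun e => hy (e ▸ hx)
    simp [State.setReg, this, h.reg y hy], h.arr⟩

/-- What a program may write is computed from its text, so preservation of unrelated memory reduces
to membership in concrete lists, mostly settled by `decide`. -/
lemma Exec.frame {c : Prog} {s s' : State} {t : ℕ} (h : Exec c s s' t) :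
    Frame c.regs c.arrs s s' := by
  induction h with
  | skip s => exact Frame.refl _ _ _
  | set s x e => exact (Frame.refl _ _ _).setReg (by simp [Prog.regs]) _
  | put s a e f =>
    refine ⟨fun _ _ => rfl, fun b hb => ?_⟩
    have : b ≠ a := by simpa [Prog.arrs] using hb
    simp [State.setArr, this]
  | seq _ _ ih1 ih2 =>
    exact (ih1.mono (by simp [Prog.regs]) (by simp [Prog.arrs])).trans
      (ih2.mono (by simp [Prog.regs]) (by simp [Prog.arrs]))
  | iteTrue _ _ ih => exact ih.mono (by simp [Prog.regs]) (by simp [Prog.arrs])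
  | iteFalse _ _ ih => exact ih.mono (by simp [Prog.regs]) (by simp [Prog.arrs])
  | loopTrue _ _ _ ih1 ih2 => exact ih1.trans ih2
  | loopFalse _ => exact Frame.refl _ _ _

/-- From the state `s`, the program `c` terminates within `T` steps in a state satisfying `Q`. -/
def Tri (c : Prog) (s : State) (T : ℕ) (Q : State → Prop) : Prop :=
  ∃ s' t, Exec c s s' t ∧ t ≤ T ∧ Q s'

namespace Tri

variable {c d : Prog} {s : State} {T T' : ℕ} {Q Q' : State → Prop}

lemma mono (h : Tri c s T Q) (hT : T ≤ T') (hQ : ∀ s', Frame c.regs c.arrs s s' → Q s' → Q' s') :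
    Tri c s T' Q' := by
  obtain ⟨s', t, h1, h2, h3⟩ := h
  exact ⟨s', t, h1, h2.trans hT, hQ s' h1.frame h3⟩

lemma seq (h : Tri c s T Q) (h' : ∀ s', Frame c.regs c.arrs s s' → Q s' → Tri d s' T' Q') :
    Tri (.seq c d) s (T + T') Q' := by
  obtain ⟨s', t, h1, h2, h3⟩ := h
  obtain ⟨s'', t', h1', h2', h3'⟩ := h' s' h1.frame h3
  exact ⟨s'', t + t', .seq h1 h1', by omega, h3'⟩

lemma seq_le {T₁ T₂ : ℕ} (h : Tri c s T₁ Q)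
    (h' : ∀ s', Frame c.regs c.arrs s s' → Q s' → Tri d s' T₂ Q') (hT : T₁ + T₂ ≤ T) :
    Tri (.seq c d) s T Q' :=
  (h.seq h').mono hT fun _ _ h => h

/-- Without loops, execution is the function `run` and the costlier branch bounds the time. Loop
bodies can thus be verified by simplification. -/
lemma of_run (hc : c.loopFree = true) (hT : c.cost ≤ T) (hQ : Q (c.run s)) : Tri c s T Q := by
  suffices h : ∃ t, Exec c s (c.run s) t ∧ t ≤ c.cost by
    obtain ⟨t, h1, h2⟩ := h
    exact ⟨_, t, h1, h2.trans hT, hQ⟩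
  clear hQ hT
  induction c generalizing s with
  | skip => exact ⟨_, .skip s, le_rfl⟩
  | set x e => exact ⟨_, .set s x e, le_rfl⟩
  | put a e f => exact ⟨_, .put s a e f, le_rfl⟩
  | seq c d ih1 ih2 =>
    simp only [Prog.loopFree, Bool.and_eq_true] at hc
    obtain ⟨t, h1, h2⟩ := ih1 (s := s) hc.1
    obtain ⟨t', h1', h2'⟩ := ih2 (s := c.run s) hc.2
    exact ⟨_, .seq h1 h1', by simp only [Prog.cost]; omega⟩
  | ite e f c d ih1 ih2 =>
    simp only [Prog.loopFree, Bool.and_eq_true] at hc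
    by_cases h : e.eval s < f.eval s
    · obtain ⟨t, h1, h2⟩ := ih1 (s := s) hc.1
      simp only [Prog.run, if_pos h]
      exact ⟨_, .iteTrue h h1, by simp only [Prog.cost]; omega⟩
    · obtain ⟨t, h1, h2⟩ := ih2 (s := s) hc.2
      simp only [Prog.run, if_neg h]
      exact ⟨_, .iteFalse h h1, by simp only [Prog.cost]; omega⟩
  | loop e f c => simp [Prog.loopFree] at hc

end Tri

/-- Run `c` with register `x` set to `0, 1, …` in turn, as long as it is below register `y`. -/
def forLoop (x y : ℕ) (c : Prog) : Prog :=
  .seq (.set x (.const 0))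
    (.loop (.reg x) (.reg y) (.seq c (.set x (.add (.reg x) (.const 1)))))

/-- An iteration adds 3 steps for the test and 4 for the increment to the body. The 5 extra steps
are the initial assignment and the last test. The body must leave the counter and the bound alone.
-/
lemma Tri.forLoop {x y : ℕ} {c : Prog} {s : State} {N T : ℕ} (I : ℕ → State → Prop)
    (hN : s.reg y = N) (hyc : y ∉ x :: c.regs) (hxc : x ∉ c.regs)
    (h0 : I 0 (s.setReg x 0))
    (hstep : ∀ k s', k < N → s'.reg x = k → Frame (x :: c.regs) c.arrs s s' → I k s' →
      Tri c s' T fun s'' => I (k + 1) (s''.setReg x (k + 1))) :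
    Tri (forLoop x y c) s (N * (T + 7) + 5) (I N) := by
  have key_lemma : ∀ d k s', k + d = N → s'.reg x = k → Frame (x :: c.regs) c.arrs s s' → I k s' →
      Tri (.loop (.reg x) (.reg y) (.seq c (.set x (.add (.reg x) (.const 1))))) s'
        (d * (T + 7) + 3) (I N) := by
    intro d
    induction d with
    | zero =>
      intro k s' hk hx hF hI
      refine ⟨s', _, .loopFalse ?_, by simp [Expr.cost], by rwa [← hk]⟩
      simp only [Expr.eval, hx, hF.reg y hyc, hN]
      omega
    | succ d ih =>
      intro k s' hk hx hF hI
      obtain ⟨s1, t1, h1, h2, h3⟩ := hstep k s' (by omega) hx hF hI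
      have hx1 : s1.reg x = k := (h1.frame.reg x hxc).trans hx
      have hF1 : Frame (x :: c.regs) c.arrs s (s1.setReg x (k + 1)) :=
        (hF.trans (h1.frame.mono (by simp) (List.Subset.refl _))).setReg (by simp) _
      obtain ⟨s2, t2, g1, g2, g3⟩ := ih (k + 1) (s1.setReg x (k + 1)) (by omega)
        (by simp [State.setReg]) hF1 h3
      have hset : Exec (.set x (.add (.reg x) (.const 1))) s1 (s1.setReg x (k + 1)) 4 := by
        have := Exec.set s1 x (.add (.reg x) (.const 1))
        simpa [Expr.eval, Expr.cost, hx1] using this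
      refine ⟨s2, _, .loopTrue ?_ (.seq h1 hset) g1, ?_, g3⟩
      · simp only [Expr.eval, hx, hF.reg y hyc, hN]
        omega
      · simp only [Expr.cost]
        have : (d + 1) * (T + 7) = d * (T + 7) + (T + 7) := by ring
        omega
  obtain ⟨s1, t1, h1, h2, h3⟩ := key_lemma N 0 (s.setReg x 0) (by omega) (by simp [State.setReg])
    ((Frame.refl _ _ _).setReg (by simp) _) h0
  refine ⟨s1, _, .seq (.set s x (.const 0)) h1, ?_, h3⟩
  simp only [Expr.cost]
  omega

@[simp] lemma State.reg_setReg (s : State) (x v y : ℕ) :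
    (s.setReg x v).reg y = if y = x then v else s.reg y := by
  simp [State.setReg, Function.update_apply]

@[simp] lemma State.arr_setReg (s : State) (x v : ℕ) : (s.setReg x v).arr = s.arr := rfl

@[simp] lemma State.reg_setArr (s : State) (a i v : ℕ) : (s.setArr a i v).reg = s.reg := rfl

@[simp] lemma State.arr_setArr (s : State) (a i v b k : ℕ) :
    (s.setArr a i v).arr b k = if b = a then (if k = i then v else s.arr a k) else s.arr b k := by
  by_cases h : b = a
  · subst h; simp [State.setArr, Function.update_apply]
  · simp [State.setArr, h]

end DipathKernel

/-! ### Deferred acceptance on the machine -/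

namespace DipathKernel

/-- What the programs presuppose about the memory: register 1 holds `p`, array 6 the multiples of
`p`, and array 4 the table of `R`. -/
structure HasTable {p : ℕ} (R : Fin p → Fin p → Prop) (s : State) : Prop where
  reg_one : s.reg 1 = p
  row : ∀ j < p, s.arr 6 j = j * p
  rel : ∀ i j : Fin p, 0 < s.arr 4 (i * p + j) ↔ R i j

lemma HasTable.frame {p : ℕ} {R : Fin p → Fin p → Prop} {s s' : State} (h : HasTable R s)
    {xs as : List ℕ} (hF : Frame xs as s s') (hx : 1 ∉ xs) (h4 : 4 ∉ as) (h6 : 6 ∉ as) :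
    HasTable R s' :=
  ⟨(hF.reg _ hx).trans h.reg_one, fun j hj => by rw [hF.arr _ h6, h.row j hj],
    fun i j => by rw [hF.arr _ h4, h.rel]⟩

/-- The set of indices whose cells in an array are positive. -/
def members (p : ℕ) (f : ℕ → ℕ) : Finset (Fin p) := Finset.univ.filter fun i => 0 < f i

@[simp] lemma mem_members {p : ℕ} {f : ℕ → ℕ} {i : Fin p} : i ∈ members p f ↔ 0 < f i := by
  simp [members]

/-- Clear the cells of array 13 at the keys. -/
def clearProg (k : ℕ) : Prog := forLoop 20 1 (.put 13 (.get k (.reg 20)) (.const 0))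

/-- Store in array 13, for each key, the number plus one of the largest member of `m`. -/
def largestProg (k m : ℕ) : Prog :=
  forLoop 20 1 (.ite (.const 0) (.get m (.reg 20))
    (.seq (.set 21 (.get 13 (.get k (.reg 20))))
      (.ite (.const 0) (.reg 21)
        (.ite (.const 0)
          (.get 4 (.add (.get 6 (.sub (.reg 21) (.const 1))) (.reg 20)))
          (.put 13 (.get k (.reg 20)) (.add (.reg 20) (.const 1))) .skip)
        (.put 13 (.get k (.reg 20)) (.add (.reg 20) (.const 1))))) .skip)

/-- Mark in array `o` the members of `m` with key `0` and those stored in array 13. -/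
def markProg (k m o : ℕ) : Prog :=
  forLoop 20 1 (.ite (.const 0) (.get m (.reg 20))
    (.ite (.get k (.reg 20)) (.const 1) (.put o (.reg 20) (.const 1))
      (.ite (.get 13 (.get k (.reg 20))) (.add (.reg 20) (.const 1)) (.put o (.reg 20) (.const 0))
        (.ite (.add (.reg 20) (.const 1)) (.get 13 (.get k (.reg 20)))
          (.put o (.reg 20) (.const 0)) (.put o (.reg 20) (.const 1)))))
    (.put o (.reg 20) (.const 0)))

/-- Compute in array `o` the best members of array `m` for the keys in array `k`. -/
def bestProg (k m o : ℕ) : Prog := .seq (clearProg k) (.seq (largestProg k m) (markProg k m o))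

/-- Array 13 holds, for each key, the number plus one of the largest member of `M`. -/
def IsLargest {p : ℕ} (R : Fin p → Fin p → Prop) (key : Fin p → ℕ) (M : Finset (Fin p))
    (f : ℕ → ℕ) : Prop :=
  ∀ i, key i ≠ 0 → (f (key i) = 0 ∧ ∀ j ∈ M, key j ≠ key i) ∨
    ∃ j ∈ M, key j = key i ∧ f (key i) = j + 1 ∧ ∀ j' ∈ M, key j' = key i → R j' j

section

variable {p : ℕ} {R : Fin p → Fin p → Prop} {s : State}

/-- Only the cells addressed by the `p` keys are cleared. Clearing one cell per vertex in each round
would cost `n` and spoil the time bound. -/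
lemma clearProg_spec {k : ℕ} (hs : s.reg 1 = p) (hk : k ≠ 13) :
    Tri (clearProg k) s (p * 11 + 5) fun s' => ∀ i : Fin p, s'.arr 13 (s.arr k i) = 0 := by
  refine Tri.mono (Tri.forLoop (N := p) (T := 4)
    (fun l s' => ∀ i : Fin p, (i : ℕ) < l → s'.arr 13 (s.arr k i) = 0) hs
    (by simp [Prog.regs]) (by simp [Prog.regs])
    (fun i hi => absurd hi (by omega)) ?_) le_rfl fun s' _ h i => h i i.2
  intro l s' hl hx hF hI
  have hk' : s'.arr k = s.arr k := hF.arr k (by simpa [Prog.arrs] using hk)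
  refine Tri.of_run rfl (by simp [Prog.cost, Expr.cost]) fun i hi => ?_
  simp only [Prog.run, Expr.eval, hx, hk', State.arr_setReg, State.arr_setArr]
  rcases Nat.lt_succ_iff_lt_or_eq.1 hi with hi | hi
  · simp [hI i hi]
  · simp [hi]

/-- This is a running maximum for all fibres at once. The champion `j` of a key is replaced by the
current path when the table says it is smaller; the start of row `j` is looked up in array 6, as the
machine cannot multiply. The cell of key `0` is written too, but no claim is made about it. -/
lemma largestProg_spec (hT : HasTable R s) {k m : ℕ} (hk : k ≠ 13) (hm : m ≠ 13)
    (hO : OrdersFibres R fun i : Fin p => s.arr k i)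
    (h0 : ∀ i : Fin p, s.arr 13 (s.arr k i) = 0) :
    Tri (largestProg k m) s (p * 43 + 5) fun s' =>
      IsLargest R (fun i : Fin p => s.arr k i) (members p (s.arr m)) (s'.arr 13) := by
  have hself : ∀ i : Fin p, s.arr k i ≠ 0 → R i i := fun i h => by
    rcases hO.total i i h rfl with h | h <;> exact h
  refine Tri.mono (Tri.forLoop (N := p) (T := 36)
    (fun l s' => ∀ i : Fin p, s.arr k i ≠ 0 →
      (s'.arr 13 (s.arr k i) = 0 ∧
        ∀ j : Fin p, (j : ℕ) < l → 0 < s.arr m j → s.arr k j ≠ s.arr k i) ∨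
      ∃ j : Fin p, 0 < s.arr m j ∧ s.arr k j = s.arr k i ∧
        s'.arr 13 (s.arr k i) = j + 1 ∧ (∀ j' : Fin p, (j' : ℕ) < l → 0 < s.arr m j' →
          s.arr k j' = s.arr k i → R j' j))
    hT.reg_one (by simp [Prog.regs]) (by simp [Prog.regs])
    (fun i hi => Or.inl ⟨h0 i, fun j hj => absurd hj (by omega)⟩) ?_) le_rfl fun s' _ h i hi => ?_
  · intro l s' hl hx hF hI
    have hk' : s'.arr k = s.arr k := hF.arr k (by simpa [Prog.arrs] using hk)
    have hm' : s'.arr m = s.arr m := hF.arr m (by simpa [Prog.arrs] using hm)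
    have hT' : HasTable R s' :=
      hT.frame hF (by simp [Prog.regs]) (by simp [Prog.arrs]) (by simp [Prog.arrs])
    refine Tri.of_run rfl (by simp [Prog.cost, Expr.cost]) fun i hi => ?_
    have hlt : ∀ j : Fin p, (j : ℕ) < l + 1 → (j : ℕ) < l ∨ j = ⟨l, hl⟩ := fun j hj => by
      rcases Nat.lt_succ_iff_lt_or_eq.1 hj with h | h
      · exact Or.inl h
      · exact Or.inr (Fin.ext h)
    specialize hI i hi
    by_cases hml : 0 < s.arr m l
    swap
    · simp only [Prog.run, Expr.eval, hx, hm', hml, if_false, State.arr_setReg]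
      refine hI.imp (fun h => ⟨h.1, fun j hj hmj => ?_⟩) fun ⟨j, h1, h2, h3, h4⟩ =>
        ⟨j, h1, h2, h3, fun j' hj hmj => ?_⟩
      · rcases hlt j hj with hj | rfl
        · exact h.2 j hj hmj
        · exact absurd hmj hml
      · rcases hlt j' hj with hj | rfl
        · exact h4 j' hj hmj
        · exact absurd hmj hml
    simp only [Prog.run, Expr.eval, hx, hm', hml, if_true, State.arr_setReg, State.reg_setReg, hk',
      show (20 : ℕ) ≠ 21 by decide, if_false]
    by_cases hki : s.arr k l = s.arr k i
    swap
    -- The iteration writes at most the cell of its own key, so the champions of other keys stay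
    -- valid.
    · have hval : ∀ s1 : State, s1.arr 13 (s.arr k i) = s'.arr 13 (s.arr k i) →
          ((s1.arr 13 (s.arr k i) = 0 ∧
          ∀ j : Fin p, (j : ℕ) < l + 1 → 0 < s.arr m j → s.arr k j ≠ s.arr k i) ∨
          ∃ j : Fin p, 0 < s.arr m j ∧ s.arr k j = s.arr k i ∧
          s1.arr 13 (s.arr k i) = j + 1 ∧ (∀ j' : Fin p, (j' : ℕ) < l + 1 → 0 < s.arr m j' →
          s.arr k j' = s.arr k i → R j' j)) := fun s1 hs1 => by
        rw [hs1]
        refine hI.imp (fun h => ⟨h.1, fun j hj hmj => ?_⟩) fun ⟨j, h1, h2, h3, h4⟩ =>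
          ⟨j, h1, h2, h3, fun j' hj hmj hkj => ?_⟩
        · rcases hlt j hj with hj | rfl
          · exact h.2 j hj hmj
          · exact hki
        · rcases hlt j' hj with hj | rfl
          · exact h4 j' hj hmj hkj
          · exact absurd hkj hki
      apply hval
      have hki' : s.arr k i ≠ s.arr k l := Ne.symm hki
      split_ifs <;> simp [hki']
    · rcases hI with ⟨h1, h2⟩ | ⟨j, h1, h2, h3, h4⟩
      · rw [hki, h1]
        refine Or.inr ⟨⟨l, hl⟩, hml, hki, by simp, fun j' hj hmj hkj => ?_⟩
        rcases hlt j' hj with hj | rfl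
        · exact absurd hkj (h2 j' hj hmj)
        · exact hself _ (by simpa [hki] using hi)
      · have hrow : s'.arr 6 j = j * p := hT'.row j j.2
        have hrel := hT'.rel j ⟨l, hl⟩
        simp only at hrel
        rw [hki, h3]
        simp only [if_true, Nat.zero_lt_succ]
        by_cases hR : R j ⟨l, hl⟩
        · refine Or.inr ⟨⟨l, hl⟩, hml, hki, by simp [hrow, hrel, hR], fun j' hj hmj hkj => ?_⟩
          rcases hlt j' hj with hj | rfl
          · exact hO.trans j' j ⟨l, hl⟩ (by rw [hkj]; exact hi) (h2.trans hkj.symm)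
              (hki.trans hkj.symm) (h4 j' hj hmj hkj) hR
          · exact hself _ (by simpa [hki] using hi)
        · refine Or.inr ⟨j, h1, h2, by simp [hrow, hrel, hR, h3], fun j' hj hmj hkj => ?_⟩
          rcases hlt j' hj with hj | rfl
          · exact h4 j' hj hmj hkj
          · exact (hO.total ⟨l, hl⟩ j (by simpa [hki] using hi) (h2.trans hki.symm)).resolve_right hR
  · rcases h i hi with ⟨h1, h2⟩ | ⟨j, h1, h2, h3, h4⟩
    · exact Or.inl ⟨h1, fun j hj => h2 j j.2 (mem_members.1 hj)⟩
    · exact Or.inr ⟨j, mem_members.2 h1, h2, h3, fun j' hj => h4 j' j'.2 (mem_members.1 hj)⟩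

/-- By antisymmetry a fibre has only one largest member, so being largest amounts to being the
stored champion. Equality is tested by two comparisons. -/
lemma markProg_spec (hT : HasTable R s) {k m o : ℕ} (hk : k ≠ o) (hm : m ≠ o) (ho : o ≠ 13)
    (hanti : ∀ i j, R i j → R j i → i = j)
    (h0 : IsLargest R (fun i : Fin p => s.arr k i) (members p (s.arr m)) (s.arr 13)) :
    Tri (markProg k m o) s (p * 40 + 5) fun s' =>
      members p (s'.arr o) = best R (fun i : Fin p => s.arr k i) (members p (s.arr m)) := by
  refine Tri.mono (Tri.forLoop (N := p) (T := 33)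
    (fun l s' => ∀ i : Fin p, (i : ℕ) < l → (0 < s'.arr o i ↔
      0 < s.arr m i ∧ (s.arr k i = 0 ∨ s.arr 13 (s.arr k i) = i + 1)))
    hT.reg_one (by simp [Prog.regs]) (by simp [Prog.regs])
    (fun i hi => absurd hi (by omega)) ?_) le_rfl fun s' _ h => ?_
  · intro l s' hl hx hF hI
    have hk' : s'.arr k = s.arr k := hF.arr k (by simpa [Prog.arrs] using hk)
    have hm' : s'.arr m = s.arr m := hF.arr m (by simpa [Prog.arrs] using hm)
    have hb' : s'.arr 13 = s.arr 13 := hF.arr 13 (by simpa [Prog.arrs] using ho.symm)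
    refine Tri.of_run rfl (by simp [Prog.cost, Expr.cost]) fun i hi => ?_
    simp only [Prog.run, Expr.eval, hx, hk', hm', hb', State.arr_setReg]
    rcases Nat.lt_succ_iff_lt_or_eq.1 hi with hi | hi
    · rw [← hI i hi]
      have hil : (i : ℕ) ≠ l := by omega
      split_ifs <;> simp [hil]
    · subst hi
      split_ifs <;> simp <;> omega
  · ext i
    rw [mem_members, h i i.2, mem_best, mem_members]
    refine and_congr_right fun hi => ?_
    by_cases hk0 : s.arr k i = 0
    · simp [hk0]
    simp only [hk0, false_or]
    rcases h0 i hk0 with ⟨_, h2⟩ | ⟨j, h1, h2, h3, h4⟩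
    · exact absurd rfl (h2 i (mem_members.2 hi))
    · simp only at h2 h3 h4
      rw [h3]
      constructor
      · intro hji
        rw [← Fin.ext (by omega : (j : ℕ) = i)]
        exact fun j' hj' hk' => h4 j' hj' (hk'.trans h2)
      · intro hmax
        rw [hanti _ _ (hmax j h1 h2) (h4 i (mem_members.2 hi) rfl)]

/-- The statement about array 13 is kept because `deleteUpProg` later reads the proposers' choices
from it. -/
lemma bestProg_spec (hT : HasTable R s) {k m o : ℕ} (hk : k ∉ [13, o]) (hm : m ∉ [13, o])
    (ho : o ≠ 13) (hanti : ∀ i j, R i j → R j i → i = j)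
    (hO : OrdersFibres R fun i : Fin p => s.arr k i) :
    Tri (bestProg k m o) s (p * 94 + 15) fun s' =>
      members p (s'.arr o) = best R (fun i : Fin p => s.arr k i) (members p (s.arr m)) ∧
      IsLargest R (fun i : Fin p => s.arr k i) (members p (s.arr m)) (s'.arr 13) := by
  simp only [List.mem_cons, List.not_mem_nil, or_false, not_or] at hk hm
  refine Tri.mono (Tri.seq (T' := (p * 43 + 5) + (p * 40 + 5))
    (clearProg_spec hT.reg_one hk.1) fun s1 hF1 h1 => ?_) (by omega) (fun _ _ h => h)
  · have hk1 : s1.arr k = s.arr k := hF1.arr k (by simpa [clearProg, forLoop, Prog.arrs] using hk.1)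
    have hm1 : s1.arr m = s.arr m := hF1.arr m (by simpa [clearProg, forLoop, Prog.arrs] using hm.1)
    have hT1 : HasTable R s1 := hT.frame hF1 (by simp [clearProg, forLoop, Prog.regs])
      (by simp [clearProg, forLoop, Prog.arrs]) (by simp [clearProg, forLoop, Prog.arrs])
    refine Tri.seq (largestProg_spec hT1 hk.1 hm.1 (by rw [hk1]; exact hO)
      (by rw [hk1]; exact h1)) fun s2 hF2 h2 => ?_
    have hk2 : s2.arr k = s.arr k :=
      (hF2.arr k (by simpa [largestProg, forLoop, Prog.arrs] using hk.1)).trans hk1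
    have hm2 : s2.arr m = s.arr m :=
      (hF2.arr m (by simpa [largestProg, forLoop, Prog.arrs] using hm.1)).trans hm1
    have hT2 : HasTable R s2 := hT1.frame hF2 (by simp [largestProg, forLoop, Prog.regs])
      (by simp [largestProg, forLoop, Prog.arrs]) (by simp [largestProg, forLoop, Prog.arrs])
    rw [hk1, hm1] at h2
    refine Tri.mono (markProg_spec hT2 hk.2 hm.2 ho hanti
      (by rw [hk2, hm2]; exact h2)) le_rfl fun s3 hF3 h3 => ?_
    have hb : s3.arr 13 = s2.arr 13 :=
      hF3.arr 13 (by simpa [markProg, forLoop, Prog.arrs] using ho.symm)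
    rw [hk2, hm2] at h3
    exact ⟨h3, by rw [hb]; exact h2⟩

/-- One round of deferred acceptance; arrays 15, 16 and 17 hold the candidates, the proposers and
the acceptors. -/
def roundProg : Prog :=
  .seq (bestProg 16 15 19) (.seq (bestProg 17 19 14)
    (forLoop 20 1 (.ite (.const 0) (.get 19 (.reg 20))
      (.ite (.const 0) (.get 14 (.reg 20)) .skip (.put 15 (.reg 20) (.const 0))) .skip)))

/-- Deferred acceptance; the outcome is stored in array 19, and the proposers' choices in
array 13. -/
def daProg : Prog := .seq (forLoop 22 1 roundProg) (bestProg 16 15 19)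

/-- The bound adds two computations of best members, `p * 94 + 15` each, and the rejection loop, `p
* 18 + 5`. -/
lemma roundProg_spec (hT : HasTable R s) (hanti : ∀ i j, R i j → R j i → i = j)
    (hP : OrdersFibres R fun i : Fin p => s.arr 16 i)
    (hA : OrdersFibres R fun i : Fin p => s.arr 17 i) :
    Tri roundProg s (p * 206 + 35) fun s' => members p (s'.arr 15) =
      daStep R (fun i : Fin p => s.arr 16 i) (fun i : Fin p => s.arr 17 i)
        (members p (s.arr 15)) := by
  refine Tri.mono (Tri.seq (T' := (p * 94 + 15) + (p * 18 + 5))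
    (bestProg_spec hT (by decide) (by decide) (by decide) hanti hP) fun s1 hF1 h1 =>
      Tri.seq (T := p * 94 + 15) (T' := p * 18 + 5)
      (Tri.mono (bestProg_spec (k := 17) (m := 19) (o := 14) (R := R) ?_ ?_ ?_ ?_ hanti ?_) le_rfl
        (Q' := fun s2 => members p (s2.arr 14) = best R (fun i : Fin p => s.arr 17 i)
          (best R (fun i : Fin p => s.arr 16 i) (members p (s.arr 15)))) ?_)
      fun s2 hF2 h2 => ?_) (by omega) (fun _ _ h => h)
  · exact hT.frame hF1 (by decide) (by decide) (by decide)
  · decide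
  · decide
  · decide
  · rw [hF1.arr 17 (by decide)]; exact hA
  · intro s2 hF2 h2
    rw [hF1.arr 17 (by decide)] at h2
    rw [h2.1, h1.1]
  · have hT2 : s2.reg 1 = p := (hF2.reg 1 (by decide)).trans
      ((hF1.reg 1 (by decide)).trans hT.reg_one)
    have h15 : s2.arr 15 = s.arr 15 := (hF2.arr 15 (by decide)).trans (hF1.arr 15 (by decide))
    have h19 : members p (s2.arr 19) = best R (fun i : Fin p => s.arr 16 i)
        (members p (s.arr 15)) := by
      rw [hF2.arr 19 (by decide)]; exact h1.1
    refine Tri.mono (Tri.forLoop (N := p) (T := 11)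
      (fun l s' => ∀ i : Fin p, (l ≤ i → s'.arr 15 i = s2.arr 15 i) ∧ ((i : ℕ) < l →
        (0 < s'.arr 15 i ↔ 0 < s2.arr 15 i ∧ (0 < s2.arr 19 i → 0 < s2.arr 14 i))))
      hT2 (by decide) (by decide)
      (fun i => ⟨fun _ => rfl, fun hi => absurd hi (by omega)⟩) ?_) le_rfl fun s' _ h => ?_
    · intro l s' hl hx hF hI
      have e1 : s'.arr 19 = s2.arr 19 := hF.arr 19 (by decide)
      have e2 : s'.arr 14 = s2.arr 14 := hF.arr 14 (by decide)
      refine Tri.of_run rfl (by decide) fun i => ?_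
      obtain ⟨h1, h2⟩ := hI i
      simp only [Prog.run, Expr.eval, hx, e1, e2, State.arr_setReg]
      by_cases hil : (i : ℕ) = l
      · have h3 := h1 hil.ge
        rw [← hil]
        refine ⟨fun h => by omega, fun _ => ?_⟩
        split_ifs <;> simp [h3] <;> omega
      · refine ⟨fun h => ?_, fun h => ?_⟩
        · rw [← h1 (by omega)]
          split_ifs <;> simp [hil]
        · rw [← h2 (by omega)]
          split_ifs <;> simp [hil]
    · ext i
      rw [mem_members, (h i).2 i.2, mem_daStep, ← h2, ← h19, ← h15]
      simp only [mem_members]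

/-- The `p` rounds are exactly the `Fintype.card (Fin p)` iterations of `daFinal`. This is the only
quadratic part of the work at a star. -/
lemma daProg_spec (hT : HasTable R s) (hanti : ∀ i j, R i j → R j i → i = j)
    (hP : OrdersFibres R fun i : Fin p => s.arr 16 i)
    (hA : OrdersFibres R fun i : Fin p => s.arr 17 i) :
    Tri daProg s (p * (p * 206 + 42) + p * 94 + 20) fun s' => members p (s'.arr 19) =
      daResult R (fun i : Fin p => s.arr 16 i) (fun i : Fin p => s.arr 17 i)
        (members p (s.arr 15)) ∧
      IsLargest R (fun i : Fin p => s.arr 16 i)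
        (daFinal R (fun i : Fin p => s.arr 16 i) (fun i : Fin p => s.arr 17 i)
          (members p (s.arr 15))) (s'.arr 13) := by
  refine Tri.mono (Tri.seq (Tri.forLoop (N := p) (T := p * 206 + 35)
      (fun l s' => members p (s'.arr 15) =
        (daStep R (fun i : Fin p => s.arr 16 i) (fun i : Fin p => s.arr 17 i))^[l]
          (members p (s.arr 15)))
      hT.reg_one (by decide) (by decide) rfl ?_) fun s1 hF1 h1 =>
    Tri.mono (bestProg_spec (R := R) (s := s1) ?_ (by decide) (by decide) (by decide) hanti ?_)
      le_rfl (fun s2 hF2 h2 => ?_)) (show _ + (p * 94 + 15) ≤ _ by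
        rw [show p * 206 + 42 = p * 206 + 35 + 7 from rfl]; omega) (fun _ _ h => h)
  · intro l s' hl hx hF hI
    have hT' : HasTable R s' := hT.frame hF (by decide) (by decide) (by decide)
    have e1 : s'.arr 16 = s.arr 16 := hF.arr 16 (by decide)
    have e2 : s'.arr 17 = s.arr 17 := hF.arr 17 (by decide)
    refine Tri.mono (roundProg_spec hT' hanti (by rw [e1]; exact hP) (by rw [e2]; exact hA)) le_rfl
      fun s2 _ h2 => ?_
    rw [Function.iterate_succ_apply', ← hI, State.arr_setReg, h2, e1, e2]
  · exact hT.frame hF1 (by decide) (by decide) (by decide)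
  · rw [hF1.arr 16 (by decide)]; exact hP
  · rw [hF1.arr 16 (by decide), h1] at h2
    simpa only [daResult, daFinal, Fintype.card_fin] using h2

end

end DipathKernel

/-! ### The steps at a vertex -/

namespace DipathKernel

/-- A loop that writes one cell of the array `a` in each iteration. -/
lemma Tri.forCells {x y a : ℕ} {c : Prog} {s : State} {N T : ℕ} (V : ℕ → ℕ → Prop)
    (hN : s.reg y = N) (hyc : y ∉ x :: c.regs) (hxc : x ∉ c.regs) (hc : c.loopFree = true)
    (hT : c.cost ≤ T)
    (hstep : ∀ k s', k < N → s'.reg x = k → Frame (x :: c.regs) c.arrs s s' →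
      s'.arr a k = s.arr a k →
      (∀ j, j ≠ k → (c.run s').arr a j = s'.arr a j) ∧ V k ((c.run s').arr a k)) :
    Tri (DipathKernel.forLoop x y c) s (N * (T + 7) + 5) fun s' => ∀ k < N, V k (s'.arr a k) := by
  refine Tri.mono (Tri.forLoop (N := N) (T := T)
    (fun l s' => (∀ k, l ≤ k → s'.arr a k = s.arr a k) ∧ ∀ k < l, V k (s'.arr a k)) hN hyc hxc
    ⟨fun _ _ => rfl, fun k hk => absurd hk (by omega)⟩ ?_) le_rfl fun s' _ h k hk => h.2 k hk
  rintro l s' hl hx hF ⟨h1, h2⟩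
  obtain ⟨h3, h4⟩ := hstep l s' hl hx hF (h1 l le_rfl)
  refine Tri.of_run hc hT ⟨fun k hk => ?_, fun k hk => ?_⟩
  · rw [State.arr_setReg, h3 k (by omega), h1 k (by omega)]
  · rw [State.arr_setReg]
    rcases Nat.lt_succ_iff_lt_or_eq.1 hk with hk | rfl
    · rw [h3 k (by omega)]; exact h2 k hk
    · exact h4

/-- Set register 5 to 1 if array 7 contains the number in register 4 in the row that starts at the
position in register 3. -/
def directionProg : Prog :=
  forLoop 20 1 (.ite (.get 7 (.add (.reg 3) (.reg 20))) (.reg 4) .skip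
    (.ite (.reg 4) (.get 7 (.add (.reg 3) (.reg 20))) .skip (.set 5 (.const 1))))

/-- Copy to array `o` the row that starts at the position in register 3, of array `b` if register 5
is positive, and of array `a` otherwise. -/
def copyProg (o a b : ℕ) : Prog :=
  forLoop 20 1 (.ite (.const 0) (.reg 5)
    (.put o (.reg 20) (.get b (.add (.reg 3) (.reg 20))))
    (.put o (.reg 20) (.get a (.add (.reg 3) (.reg 20)))))

/-- Load the star of the vertex in register 2: register 4 gets the code of the parent, arrays 16 and
17 the proposers and the acceptors. -/
def starProg : Prog :=
  .seq (.seq (.set 3 (.get 6 (.reg 2))) (.seq (.set 4 (.get 12 (.reg 2))) (.set 5 (.const 0))))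
    (.seq directionProg (.seq (copyProg 16 7 8) (copyProg 17 8 7)))

/-- The candidates of the bottom-up step. -/
def candUpProg : Prog :=
  forLoop 20 1 (.ite (.const 0) (.get 18 (.reg 20))
    (.ite (.const 0) (.add (.get 16 (.reg 20)) (.get 17 (.reg 20)))
      (.ite (.get 17 (.reg 20)) (.reg 4) (.put 15 (.reg 20) (.const 1))
        (.ite (.reg 4) (.get 17 (.reg 20)) (.put 15 (.reg 20) (.const 1))
          (.put 15 (.reg 20) (.const 0))))
      (.put 15 (.reg 20) (.const 0)))
    (.put 15 (.reg 20) (.const 0)))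

/-- The candidates of the top-down step. -/
def candDownProg : Prog :=
  forLoop 20 1 (.ite (.const 0) (.get 18 (.reg 20))
    (.ite (.const 0) (.add (.get 16 (.reg 20)) (.get 17 (.reg 20)))
      (.put 15 (.reg 20) (.const 1)) (.put 15 (.reg 20) (.const 0)))
    (.put 15 (.reg 20) (.const 0)))

/-- The deletions of the bottom-up step. -/
def deleteUpProg : Prog :=
  forLoop 20 1 (.ite (.get 17 (.reg 20)) (.reg 4) .skip
    (.ite (.reg 4) (.get 17 (.reg 20)) .skip
      (.ite (.const 0) (.get 16 (.reg 20))
        (.ite (.const 0) (.get 13 (.get 16 (.reg 20)))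
          (.ite (.const 0) (.get 4 (.add (.get 6 (.reg 20))
              (.sub (.get 13 (.get 16 (.reg 20))) (.const 1))))
            (.put 18 (.reg 20) (.const 0)) .skip) .skip) .skip)))

/-- The deletions of the top-down step. -/
def deleteDownProg : Prog :=
  forLoop 20 1 (.ite (.const 0) (.add (.get 16 (.reg 20)) (.get 17 (.reg 20)))
    (.ite (.const 0) (.get 19 (.reg 20)) .skip (.put 18 (.reg 20) (.const 0))) .skip)

/-- The bottom-up step at the vertex in register 2. -/
def upProg : Prog := .seq starProg (.seq candUpProg (.seq daProg deleteUpProg))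

/-- The top-down step at the vertex in register 2. -/
def downProg : Prog := .seq starProg (.seq candDownProg (.seq daProg deleteDownProg))

/-- Row `v` of a table with rows of length `p`. -/
def row (p : ℕ) (f : ℕ → ℕ) (v : ℕ) (i : Fin p) : ℕ := f (v * p + i)

section

variable {p : ℕ} {R : Fin p → Fin p → Prop} {s : State}

lemma directionProg_spec {v q : ℕ} (h1 : s.reg 1 = p) (h3 : s.reg 3 = v * p) (h4 : s.reg 4 = q)
    (h5 : s.reg 5 = 0) :
    Tri directionProg s (p * 25 + 5) fun s' => 0 < s'.reg 5 ↔ ∃ j, row p (s.arr 7) v j = q := by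
  refine Tri.mono (Tri.forLoop (N := p) (T := 18)
    (fun l s' => 0 < s'.reg 5 ↔ ∃ j : Fin p, (j : ℕ) < l ∧ row p (s.arr 7) v j = q)
    h1 (by decide) (by decide) (by simp [h5]) ?_) le_rfl fun s' _ h => ?_
  · intro l s' hl hx hF hI
    have e7' : s'.arr 7 = s.arr 7 := hF.arr 7 (by decide)
    have e3' : s'.reg 3 = v * p := (hF.reg 3 (by decide)).trans h3
    have e4' : s'.reg 4 = q := (hF.reg 4 (by decide)).trans h4
    have hsplit : (∃ j : Fin p, (j : ℕ) < l + 1 ∧ row p (s.arr 7) v j = q) ↔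
        s.arr 7 (v * p + l) = q ∨ ∃ j : Fin p, (j : ℕ) < l ∧ row p (s.arr 7) v j = q := by
      constructor
      · rintro ⟨j, hj, hj'⟩
        rcases Nat.lt_succ_iff_lt_or_eq.1 hj with hj | hj
        · exact Or.inr ⟨j, hj, hj'⟩
        · left; rw [← hj, ← hj']; rfl
      · rintro (h | ⟨j, hj, hj'⟩)
        · exact ⟨⟨l, hl⟩, by simp, h⟩
        · exact ⟨j, by omega, hj'⟩
    refine Tri.of_run rfl (by decide) ?_
    rw [hsplit]
    simp only [Prog.run, Expr.eval, hx, e7', e3', e4', State.reg_setReg]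
    rw [if_neg (by decide)]
    split_ifs with c1 c2
    · rw [hI]
      exact (or_iff_right (by omega)).symm
    · rw [hI]
      exact (or_iff_right (by omega)).symm
    · exact iff_of_true (by simp) (Or.inl (by omega))
  · rw [h]
    exact ⟨fun ⟨j, _, hj⟩ => ⟨j, hj⟩, fun ⟨j, hj⟩ => ⟨j, j.2, hj⟩⟩

lemma copyProg_spec {v o a b : ℕ} (h1 : s.reg 1 = p) (h3 : s.reg 3 = v * p) (ha : a ≠ o)
    (hb : b ≠ o) :
    Tri (copyProg o a b) s (p * 19 + 5) fun s' => ∀ i < p, s'.arr o i =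
      if 0 < s.reg 5 then s.arr b (v * p + i) else s.arr a (v * p + i) := by
  refine Tri.forCells (T := 12) (fun k x => x =
    if 0 < s.reg 5 then s.arr b (v * p + k) else s.arr a (v * p + k))
    h1 (by simp [Prog.regs]) (by simp [Prog.regs]) rfl (by simp [Prog.cost, Expr.cost]) ?_
  intro k s' hk hx hF _
  have ea : s'.arr a = s.arr a := hF.arr a (by simpa [Prog.arrs] using ha)
  have eb : s'.arr b = s.arr b := hF.arr b (by simpa [Prog.arrs] using hb)
  have e3 : s'.reg 3 = v * p := (hF.reg 3 (by simp [Prog.regs])).trans h3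
  have e5 : s'.reg 5 = s.reg 5 := hF.reg 5 (by simp [Prog.regs])
  simp only [Prog.run, Expr.eval, hx, e3, e5, ea, eb]
  refine ⟨fun j hj => ?_, ?_⟩
  · split_ifs <;> simp [hj]
  · split_ifs <;> simp

/-- Register 5 records whether some path enters along the parent arc, which decides whether the row
of predecessors or that of successors accepts. -/
lemma starProg_spec {v : ℕ} (h1 : s.reg 1 = p) (h2 : s.reg 2 = v) (h6 : s.arr 6 v = v * p) :
    Tri starProg s (p * 63 + 30) fun s' => s'.reg 4 = s.arr 12 v ∧
      (fun i : Fin p => s'.arr 16 i) =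
        proposer (row p (s.arr 7) v) (row p (s.arr 8) v) (s.arr 12 v) ∧
      (fun i : Fin p => s'.arr 17 i) =
        acceptor (row p (s.arr 7) v) (row p (s.arr 8) v) (s.arr 12 v) := by
  refine Tri.seq_le (T₁ := 8) (T₂ := p * 63 + 15)
    (Q := fun s' => s'.reg 3 = v * p ∧ s'.reg 4 = s.arr 12 v ∧ s'.reg 5 = 0)
    (Tri.of_run rfl (by decide) (by simp [Prog.run, Expr.eval, h2, h6])) (fun s1 hF1 h1' => ?_)
    (by omega)
  obtain ⟨h3, h4, h5⟩ := h1'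
  refine Tri.seq_le (T₂ := p * 38 + 10)
    (directionProg_spec ((hF1.reg 1 (by decide)).trans h1) h3 h4 h5) (fun s2 hF2 h2' => ?_)
    (by omega)
  have hF12 : Frame [3, 4, 5, 20] [] s s2 :=
    (hF1.mono (by decide) (by decide)).trans (hF2.mono (by decide) (by decide))
  have h32 : s2.reg 3 = v * p := (hF2.reg 3 (by decide)).trans h3
  refine Tri.seq_le (T₂ := p * 19 + 5) (copyProg_spec (v := v) ((hF12.reg 1 (by decide)).trans h1)
    h32 (by decide) (by decide)) (fun s3 hF3 h3' => ?_) (by omega)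
  have h33 : s3.reg 3 = v * p := (hF3.reg 3 (by decide)).trans h32
  have hF13 : Frame [3, 4, 5, 20] [16] s s3 :=
    (hF12.mono (by decide) (by decide)).trans (hF3.mono (by decide) (by decide))
  refine Tri.mono (copyProg_spec (v := v) ((hF13.reg 1 (by decide)).trans h1) h33 (by decide)
    (by decide)) le_rfl fun s4 hF4 h4' => ⟨?_, funext fun i => ?_, funext fun i => ?_⟩
  · rw [hF4.reg 4 (by decide), hF3.reg 4 (by decide), hF2.reg 4 (by decide), h4]
  · rw [hF4.arr 16 (by decide), h3' i i.2, hF12.arr 7 (by decide), hF12.arr 8 (by decide)]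
    rw [hF1.arr 7 (by decide)] at h2'
    by_cases h : ∃ j, row p (s.arr 7) v j = s.arr 12 v
    · rw [if_pos (h2'.2 h), proposer_pos h]; rfl
    · rw [if_neg (mt h2'.1 h), proposer_neg h]; rfl
  · rw [h4' i i.2, hF13.arr 7 (by decide), hF13.arr 8 (by decide), hF3.reg 5 (by decide)]
    rw [hF1.arr 7 (by decide)] at h2'
    by_cases h : ∃ j, row p (s.arr 7) v j = s.arr 12 v
    · rw [if_pos (h2'.2 h), acceptor_pos h]; rfl
    · rw [if_neg (mt h2'.1 h), acceptor_neg h]; rfl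

lemma candUpProg_spec (h1 : s.reg 1 = p) :
    Tri candUpProg s (p * 29 + 5) fun s' => ∀ i : Fin p, i ∈ members p (s'.arr 15) ↔
      i ∈ members p (s.arr 18) ∧ (s.arr 16 i ≠ 0 ∨ s.arr 17 i ≠ 0) ∧ s.arr 17 i ≠ s.reg 4 := by
  refine Tri.mono (Tri.forCells (T := 22) (a := 15) (fun k x => 0 < x ↔ 0 < s.arr 18 k ∧
    (s.arr 16 k ≠ 0 ∨ s.arr 17 k ≠ 0) ∧ s.arr 17 k ≠ s.reg 4)
    h1 (by decide) (by decide) rfl (by decide) ?_) le_rfl fun s' _ h i => ?_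
  · intro k s' hk hx hF _
    simp only [Prog.run, Expr.eval, hx, hF.reg 4 (by decide), hF.arr 16 (by decide),
      hF.arr 17 (by decide), hF.arr 18 (by decide)]
    refine ⟨fun j hj => ?_, ?_⟩
    · split_ifs <;> simp [hj]
    · split_ifs <;> simp <;> omega
  · rw [mem_members, h i i.2, mem_members]

lemma candDownProg_spec (h1 : s.reg 1 = p) :
    Tri candDownProg s (p * 27 + 5) fun s' => ∀ i : Fin p, i ∈ members p (s'.arr 15) ↔
      i ∈ members p (s.arr 18) ∧ (s.arr 16 i ≠ 0 ∨ s.arr 17 i ≠ 0) := by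
  refine Tri.mono (Tri.forCells (T := 20) (a := 15) (fun k x => 0 < x ↔ 0 < s.arr 18 k ∧
    (s.arr 16 k ≠ 0 ∨ s.arr 17 k ≠ 0))
    h1 (by decide) (by decide) rfl (by decide) ?_) le_rfl fun s' _ h i => ?_
  · intro k s' hk hx hF _
    simp only [Prog.run, Expr.eval, hx, hF.arr 16 (by decide),
      hF.arr 17 (by decide), hF.arr 18 (by decide)]
    refine ⟨fun j hj => ?_, ?_⟩
    · split_ifs <;> simp [hj]
    · split_ifs <;> simp <;> omega
  · rw [mem_members, h i i.2, mem_members]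

/-- The only possible member of the outcome with the proposer of `i` is the champion stored in array
13, so one lookup and one table access replace a search. -/
lemma deleteUpProg_spec (hT : HasTable R s) {M : Finset (Fin p)}
    (hanti : ∀ i j, R i j → R j i → i = j)
    (h0 : IsLargest R (fun i : Fin p => s.arr 16 i) M (s.arr 13)) :
    Tri deleteUpProg s (p * 47 + 5) fun s' => ∀ i : Fin p, i ∈ members p (s'.arr 18) ↔
      i ∈ members p (s.arr 18) ∧ ¬ (s.arr 17 i = s.reg 4 ∧
        ∃ h ∈ best R (fun i : Fin p => s.arr 16 i) M,
          s.arr 16 i ≠ 0 ∧ s.arr 16 h = s.arr 16 i ∧ R i h) := by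
  refine Tri.mono (Tri.forCells (T := 40) (a := 18) (fun k x => 0 < x ↔ 0 < s.arr 18 k ∧
    ¬ (s.arr 17 k = s.reg 4 ∧ 0 < s.arr 16 k ∧ 0 < s.arr 13 (s.arr 16 k) ∧
      0 < s.arr 4 (k * p + (s.arr 13 (s.arr 16 k) - 1))))
    hT.reg_one (by decide) (by decide) rfl (by decide) ?_) le_rfl fun s' _ h i => ?_
  · intro k s' hk hx hF h18
    simp only [Prog.run, Expr.eval, hx, hF.reg 4 (by decide), hF.arr 16 (by decide),
      hF.arr 17 (by decide), hF.arr 13 (by decide), hF.arr 4 (by decide), hF.arr 6 (by decide),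
      hT.row k hk]
    refine ⟨fun j hj => ?_, ?_⟩
    · split_ifs <;> simp [hj]
    · split_ifs <;> simp [h18] <;> omega
  · rw [mem_members, h i i.2, mem_members]
    refine and_congr_right fun _ => not_congr (and_congr_right fun _ => ?_)
    by_cases h16 : s.arr 16 i = 0
    · simp [h16]
    rcases h0 i h16 with ⟨h2, h3⟩ | ⟨j, h2, h3, h4, h5⟩
    · simp only at h2 h3
      rw [h2]
      refine iff_of_false (by simp) ?_
      rintro ⟨j, hj, -, hj', -⟩
      exact h3 j (best_subset hj) hj'
    · simp only at h3 h4 h5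
      rw [h4, Nat.add_sub_cancel, hT.rel]
      have hj : j ∈ best R (fun i : Fin p => s.arr 16 i) M :=
        mem_best.2 ⟨h2, Or.inr fun k hk hkj => h5 k hk (hkj.trans h3)⟩
      constructor
      · rintro ⟨-, -, hR⟩
        exact ⟨j, hj, h16, h3, hR⟩
      · rintro ⟨k, hk, -, hk', hR⟩
        rw [eq_of_mem_best hanti hj hk (by simpa [h3] using h16) (hk'.trans h3.symm)]
        exact ⟨by omega, by omega, hR⟩

lemma deleteDownProg_spec (h1 : s.reg 1 = p) :
    Tri deleteDownProg s (p * 27 + 5) fun s' => ∀ i : Fin p, i ∈ members p (s'.arr 18) ↔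
      i ∈ members p (s.arr 18) ∧ (s.arr 16 i ≠ 0 ∨ s.arr 17 i ≠ 0 →
        i ∈ members p (s.arr 19)) := by
  refine Tri.mono (Tri.forCells (T := 20) (a := 18) (fun k x => 0 < x ↔ 0 < s.arr 18 k ∧
    (s.arr 16 k ≠ 0 ∨ s.arr 17 k ≠ 0 → 0 < s.arr 19 k))
    h1 (by decide) (by decide) rfl (by decide) ?_) le_rfl fun s' _ h i => ?_
  · intro k s' hk hx hF h18
    simp only [Prog.run, Expr.eval, hx, hF.arr 16 (by decide),
      hF.arr 17 (by decide), hF.arr 19 (by decide)]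
    refine ⟨fun j hj => ?_, ?_⟩
    · split_ifs <;> simp [hj]
    · split_ifs <;> simp [h18] <;> omega
  · rw [mem_members, h i i.2, mem_members, mem_members]

lemma upProg_spec (hT : HasTable R s) (hanti : ∀ i j, R i j → R j i → i = j) {v : ℕ}
    (h2 : s.reg 2 = v) (h6 : s.arr 6 v = v * p)
    (hP : OrdersFibres R (row p (s.arr 7) v)) (hN : OrdersFibres R (row p (s.arr 8) v)) :
    Tri upProg s (p * (p * 206 + 42) + p * 233 + 60) fun s' => members p (s'.arr 18) =
      bottomUp R (proposer (row p (s.arr 7) v) (row p (s.arr 8) v) (s.arr 12 v))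
        (acceptor (row p (s.arr 7) v) (row p (s.arr 8) v) (s.arr 12 v)) (s.arr 12 v)
        (members p (s.arr 18)) := by
  obtain ⟨hP', hA'⟩ := ordersFibres_star hP hN (s.arr 12 v)
  refine Tri.seq_le (starProg_spec hT.reg_one h2 h6) (fun s1 hF1 h1 => ?_)
    (T₂ := p * (p * 206 + 42) + p * 170 + 30) (by omega)
  obtain ⟨h4, h16, h17⟩ := h1
  set pr := proposer (row p (s.arr 7) v) (row p (s.arr 8) v) (s.arr 12 v)
  set ac := acceptor (row p (s.arr 7) v) (row p (s.arr 8) v) (s.arr 12 v)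
  have hT1 : HasTable R s1 := hT.frame hF1 (by decide) (by decide) (by decide)
  refine Tri.seq_le (candUpProg_spec hT1.reg_one) (fun s2 hF2 h15 => ?_)
    (T₂ := p * (p * 206 + 42) + p * 141 + 25) (by omega)
  have hT2 : HasTable R s2 := hT1.frame hF2 (by decide) (by decide) (by decide)
  have e16 : (fun i : Fin p => s2.arr 16 i) = pr := by rw [hF2.arr 16 (by decide), h16]
  have e17 : (fun i : Fin p => s2.arr 17 i) = ac := by rw [hF2.arr 17 (by decide), h17]
  refine Tri.seq_le (daProg_spec hT2 hanti (by rw [e16]; exact hP') (by rw [e17]; exact hA'))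
    (fun s3 hF3 h3 => ?_) (T₂ := p * 47 + 5) (by omega)
  have hT3 : HasTable R s3 := hT2.frame hF3 (by decide) (by decide) (by decide)
  rw [e16, e17] at h3
  have e16' : (fun i : Fin p => s3.arr 16 i) = pr := by rw [hF3.arr 16 (by decide), e16]
  have e17' : (fun i : Fin p => s3.arr 17 i) = ac := by rw [hF3.arr 17 (by decide), e17]
  refine Tri.mono (deleteUpProg_spec hT3 hanti (by rw [e16']; exact h3.2)) le_rfl
    fun s4 hF4 h4' => ?_
  have e15 : ∀ i, i ∈ members p (s2.arr 15) ↔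
      i ∈ members p (s.arr 18) ∧ (pr i ≠ 0 ∨ ac i ≠ 0) ∧ ac i ≠ s.arr 12 v := fun i => by
    rw [h15 i, hF1.arr 18 (by decide), h4, ← h16, ← h17]
  ext i
  rw [h4' i, mem_bottomUp e15, e16', hF3.arr 18 (by decide), hF2.arr 18 (by decide),
    hF1.arr 18 (by decide), hF3.reg 4 (by decide), hF2.reg 4 (by decide), h4, ← e16', ← e17']
  rfl

/-- The bound of the bottom-up step is reused, although the top-down loops are shorter, so that both
passes obey one estimate. -/
lemma downProg_spec (hT : HasTable R s) (hanti : ∀ i j, R i j → R j i → i = j) {v : ℕ}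
    (h2 : s.reg 2 = v) (h6 : s.arr 6 v = v * p)
    (hP : OrdersFibres R (row p (s.arr 7) v)) (hN : OrdersFibres R (row p (s.arr 8) v)) :
    Tri downProg s (p * (p * 206 + 42) + p * 233 + 60) fun s' => members p (s'.arr 18) =
      topDown R (proposer (row p (s.arr 7) v) (row p (s.arr 8) v) (s.arr 12 v))
        (acceptor (row p (s.arr 7) v) (row p (s.arr 8) v) (s.arr 12 v))
        (members p (s.arr 18)) := by
  obtain ⟨hP', hA'⟩ := ordersFibres_star hP hN (s.arr 12 v)
  refine Tri.seq_le (starProg_spec hT.reg_one h2 h6) (fun s1 hF1 h1 => ?_)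
    (T₂ := p * (p * 206 + 42) + p * 170 + 30) (by omega)
  obtain ⟨h4, h16, h17⟩ := h1
  set pr := proposer (row p (s.arr 7) v) (row p (s.arr 8) v) (s.arr 12 v)
  set ac := acceptor (row p (s.arr 7) v) (row p (s.arr 8) v) (s.arr 12 v)
  have hT1 : HasTable R s1 := hT.frame hF1 (by decide) (by decide) (by decide)
  refine Tri.seq_le (candDownProg_spec hT1.reg_one) (fun s2 hF2 h15 => ?_)
    (T₂ := p * (p * 206 + 42) + p * 141 + 25) (by omega)
  have hT2 : HasTable R s2 := hT1.frame hF2 (by decide) (by decide) (by decide)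
  have e16 : (fun i : Fin p => s2.arr 16 i) = pr := by rw [hF2.arr 16 (by decide), h16]
  have e17 : (fun i : Fin p => s2.arr 17 i) = ac := by rw [hF2.arr 17 (by decide), h17]
  refine Tri.seq_le (daProg_spec hT2 hanti (by rw [e16]; exact hP') (by rw [e17]; exact hA'))
    (fun s3 hF3 h3 => ?_) (T₂ := p * 27 + 5) (by omega)
  have hT3 : HasTable R s3 := hT2.frame hF3 (by decide) (by decide) (by decide)
  rw [e16, e17] at h3
  have e16' : (fun i : Fin p => s3.arr 16 i) = pr := by rw [hF3.arr 16 (by decide), e16]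
  have e17' : (fun i : Fin p => s3.arr 17 i) = ac := by rw [hF3.arr 17 (by decide), e17]
  refine Tri.mono (deleteDownProg_spec hT3.reg_one) le_rfl fun s4 hF4 h4' => ?_
  have e15 : ∀ i, i ∈ members p (s2.arr 15) ↔
      i ∈ members p (s.arr 18) ∧ (pr i ≠ 0 ∨ ac i ≠ 0) := fun i => by
    rw [h15 i, hF1.arr 18 (by decide), ← h16, ← h17]
  ext i
  rw [h4' i, mem_topDown e15, ← h3.1, hF3.arr 18 (by decide),
    hF2.arr 18 (by decide), hF1.arr 18 (by decide), ← e16', ← e17']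

end

end DipathKernel

/-! ### The incidence tables -/

namespace DipathKernel

/-- Store the multiples of `p` below `(n + p) * p` in array 6. -/
def multiplesProg : Prog :=
  .seq (.seq (.set 10 (.add (.reg 0) (.reg 1))) (.set 11 (.const 0)))
    (forLoop 20 10 (.seq (.put 6 (.reg 20) (.reg 11)) (.set 11 (.add (.reg 11) (.reg 1)))))

/-- Store the arcs of the path in register 20, whose vertex sequence starts at the position in
register 12. -/
def pathProg : Prog :=
  .seq (.set 13 (.sub (.get 2 (.reg 20)) (.const 1)))
  (.seq (forLoop 21 13
    (.seq (.set 14 (.get 3 (.add (.reg 12) (.reg 21))))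
    (.seq (.set 15 (.get 3 (.add (.add (.reg 12) (.reg 21)) (.const 1))))
    (.seq (.put 8 (.add (.get 6 (.reg 14)) (.reg 20)) (.add (.reg 15) (.const 1)))
      (.put 7 (.add (.get 6 (.reg 15)) (.reg 20)) (.add (.reg 14) (.const 1)))))))
    (.set 12 (.add (.reg 12) (.get 2 (.reg 20)))))

/-- Store the arcs of all paths in arrays 7 and 8. -/
def tablesProg : Prog := .seq (.set 12 (.const 0)) (forLoop 20 1 pathProg)

/-- The arrays `f` and `g`, read as tables with rows of length `p`, give for path `i` and vertex `v`
the successors of the numbers of the vertices before and after `v` in the arcs `L i`. -/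
def Tabulates {p : ℕ} (L : Fin p → List (ℕ × ℕ)) (f g : ℕ → ℕ) : Prop :=
  ∀ i v w, (row p g v i = w + 1 ↔ (v, w) ∈ L i) ∧ (row p f w i = v + 1 ↔ (v, w) ∈ L i)

lemma mul_add_inj {p : ℕ} {v v' : ℕ} {i i' : Fin p} :
    v * p + i = v' * p + i' ↔ v = v' ∧ i = i' := by
  constructor
  · intro h
    have hv : v = v' := by
      have h1 : (v * p + i) / p = v := by
        rw [Nat.add_comm, Nat.add_mul_div_right _ _ (by have := i.2; omega),
          Nat.div_eq_of_lt i.2, zero_add]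
      have h2 : (v' * p + i') / p = v' := by
        rw [Nat.add_comm, Nat.add_mul_div_right _ _ (by have := i.2; omega),
          Nat.div_eq_of_lt i'.2, zero_add]
      rw [← h1, h, h2]
    subst hv
    exact ⟨rfl, Fin.ext (by omega)⟩
  · rintro ⟨rfl, rfl⟩; rfl

/-- Nothing is overwritten: path `i` has so far no arc leaving `a` and none entering `b`, and
different pairs of vertex and path have different cells. -/
lemma Tabulates.insert {p : ℕ} {L L' : Fin p → List (ℕ × ℕ)} {f g : ℕ → ℕ} (h : Tabulates L f g)
    {i : Fin p} {a b : ℕ} (ha : ∀ w, (a, w) ∉ L i) (hb : ∀ v, (v, b) ∉ L i)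
    (hL : ∀ j e, e ∈ L' j ↔ e ∈ L j ∨ (j = i ∧ e = (a, b))) :
    Tabulates L' (Function.update f (b * p + i) (a + 1)) (Function.update g (a * p + i) (b + 1)) := by
  intro j v w
  obtain ⟨h1, h2⟩ := h j v w
  simp only [row, Function.update_apply, mul_add_inj] at h1 h2 ⊢
  rw [hL]
  constructor
  · split_ifs with hc
    · obtain ⟨rfl, rfl⟩ := hc
      have := ha w
      simp only [this, true_and, Prod.mk.injEq, false_or]
      omega
    · rw [h1]
      constructor
      · exact Or.inl
      · rintro (h | ⟨rfl, h⟩)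
        · exact h
        · exact absurd ⟨(Prod.mk.inj h).1, rfl⟩ hc
  · split_ifs with hc
    · obtain ⟨rfl, rfl⟩ := hc
      have := hb v
      simp only [this, true_and, Prod.mk.injEq, false_or, and_true]
      omega
    · rw [h2]
      constructor
      · exact Or.inl
      · rintro (h | ⟨rfl, h⟩)
        · exact h
        · exact absurd ⟨(Prod.mk.inj h).2, rfl⟩ hc

section

variable {n p : ℕ} {s : State}

/-- Multiples are accumulated by addition. The range `n + p` covers both uses: rows indexed by
vertices in the incidence tables and rows indexed by paths in the table of `R`. -/
lemma multiplesProg_spec (h0 : s.reg 0 = n) (h1 : s.reg 1 = p) :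
    Tri multiplesProg s ((n + p) * 14 + 11) fun s' => ∀ j < n + p, s'.arr 6 j = j * p := by
  refine Tri.seq_le (T₁ := 6) (T₂ := (n + p) * 14 + 5)
    (Q := fun s' => s'.reg 10 = n + p ∧ s'.reg 11 = 0)
    (Tri.of_run rfl (by decide) (by simp [Prog.run, Expr.eval, h0, h1])) (fun s1 hF1 h => ?_)
    (by omega)
  refine Tri.mono (Tri.forLoop (N := n + p) (T := 7)
    (fun l s' => s'.reg 11 = l * p ∧ ∀ j < l, s'.arr 6 j = j * p)
    h.1 (by decide) (by decide) ⟨by simp [h.2], fun j hj => absurd hj (by omega)⟩ ?_) le_rfl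
    fun s' _ h => h.2
  rintro l s' hl hx hF ⟨h2, h3⟩
  have e1 : s'.reg 1 = p := (hF.reg 1 (by decide)).trans ((hF1.reg 1 (by decide)).trans h1)
  refine Tri.of_run rfl (by decide) ⟨?_, fun j hj => ?_⟩
  · simp [Prog.run, Expr.eval, h2, e1, Nat.succ_mul]
  · simp only [Prog.run, Expr.eval, State.arr_setReg, State.arr_setArr, if_true, hx]
    split_ifs with hjl
    · rw [h2, hjl]
    · exact h3 j (by omega)

lemma mem_take_zip_tail {l : List ℕ} {k a b : ℕ} (h : (a, b) ∈ (l.zip l.tail).take k) :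
    ∃ j, j < k ∧ ∃ hj : j + 1 < l.length, l[j] = a ∧ l[j + 1] = b := by
  obtain ⟨j, hj, he⟩ := List.mem_iff_getElem.1 h
  rw [List.length_take, List.length_zip, List.length_tail] at hj
  simp only [List.getElem_take, List.getElem_zip, List.getElem_tail, Prod.mk.injEq] at he
  exact ⟨j, by omega, by omega, he⟩

/-- The vertex sequences lie back to back, `off i` being the start of the `i`-th one. None has more
than `n` vertices, which bounds the inner loop. -/
lemma tablesProg_spec {ls : Fin p → List ℕ} {off : ℕ → ℕ} (h1 : s.reg 1 = p)
    (h2 : ∀ i : Fin p, s.arr 2 i = (ls i).length)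
    (hoff0 : off 0 = 0) (hoff : ∀ i : Fin p, off (i + 1) = off i + (ls i).length)
    (h3 : ∀ (i : Fin p) (j : ℕ) (hj : j < (ls i).length), s.arr 3 (off i + j) = (ls i)[j])
    (hnd : ∀ i, (ls i).Nodup) (hlen : ∀ i, (ls i).length ≤ n) (hlt : ∀ i, ∀ v ∈ ls i, v < n)
    (h6 : ∀ v < n, s.arr 6 v = v * p) (h7 : ∀ k, s.arr 7 k = 0) (h8 : ∀ k, s.arr 8 k = 0) :
    Tri tablesProg s (p * (n * 35 + 22) + 7) fun s' =>
      Tabulates (fun i => (ls i).zip (ls i).tail) (s'.arr 7) (s'.arr 8) := by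
  refine Tri.seq_le (T₁ := 2) (T₂ := p * (n * 35 + 15 + 7) + 5)
    (Q := fun s' => s'.reg 12 = 0)
    (Tri.of_run rfl (by decide) (by simp [Prog.run, Expr.eval])) (fun s1 hF1 h12 => ?_)
    (by rw [show n * 35 + 15 + 7 = n * 35 + 22 from rfl]; omega)
  refine Tri.mono (Tri.forLoop (N := p) (T := n * 35 + 15)
    (fun l s' => s'.reg 12 = off l ∧
      Tabulates (fun i : Fin p => if (i : ℕ) < l then (ls i).zip (ls i).tail else [])
        (s'.arr 7) (s'.arr 8))
    ((hF1.reg 1 (by decide)).trans h1) (by decide) (by decide) ⟨by simp [h12, hoff0], ?_⟩ ?_) le_rfl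
    fun s' _ h => ?_
  · intro i v w
    simp [row, hF1.arr 7 (by decide), hF1.arr 8 (by decide), h7, h8]
  swap
  · simpa using h.2
  rintro l s2 hl hx hF ⟨hr12, htab⟩
  obtain ⟨i, rfl⟩ : ∃ i : Fin p, (i : ℕ) = l := ⟨⟨l, hl⟩, rfl⟩
  have e2 : s2.arr 2 = s.arr 2 := (hF.arr 2 (by decide)).trans (hF1.arr 2 (by decide))
  refine Tri.seq_le (T₁ := 5) (T₂ := n * 35 + 10)
    (Q := fun s' => s'.reg 13 = (ls i).length - 1 ∧ s'.arr = s2.arr)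
    (Tri.of_run rfl (by decide) (by simp [Prog.run, Expr.eval, hx, e2, h2]))
    (fun s3 hF3 h13 => ?_) (by omega)
  have e12 : s3.reg 12 = off i := (hF3.reg 12 (by decide)).trans hr12
  have e20 : s3.reg 20 = i := (hF3.reg 20 (by decide)).trans hx
  have e2' : s3.arr 2 = s.arr 2 := by rw [h13.2, e2]
  have e3' : s3.arr 3 = s.arr 3 := by
    rw [h13.2, hF.arr 3 (by decide), hF1.arr 3 (by decide)]
  have e6' : s3.arr 6 = s.arr 6 := by
    rw [h13.2, hF.arr 6 (by decide), hF1.arr 6 (by decide)]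
  refine Tri.seq_le (T₂ := 5) (Q := fun s' =>
    Tabulates (fun j : Fin p => if (j : ℕ) < i + 1 then (ls j).zip (ls j).tail else [])
        (s'.arr 7) (s'.arr 8)) (Tri.mono (Tri.forLoop (N := (ls i).length - 1) (T := 28)
    (fun k s' => Tabulates (fun j : Fin p => if (j : ℕ) < i then (ls j).zip (ls j).tail else
        if j = i then ((ls i).zip (ls i).tail).take k else [])
        (s'.arr 7) (s'.arr 8)) h13.1 (by decide) (by decide) ?_ ?_)
        (show _ ≤ n * 35 + 5 from ?_) fun s' _ h => ?_)
    (fun s4 hF4 h4 => Tri.of_run rfl (by decide) ⟨?_, ?_⟩) (by omega)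
  · intro j v w
    simpa [h13.2] using htab j v w
  · intro k s5 hk hx5 hF5 h5
    have hk' : k + 1 < (ls i).length := by omega
    have g12 : s5.reg 12 = off i := (hF5.reg 12 (by decide)).trans e12
    have g20 : s5.reg 20 = i := (hF5.reg 20 (by decide)).trans e20
    have g3 : s5.arr 3 = s.arr 3 := (hF5.arr 3 (by decide)).trans e3'
    have g6 : s5.arr 6 = s.arr 6 := (hF5.arr 6 (by decide)).trans e6'
    refine Tri.of_run rfl (by decide) ?_
    have ha : s.arr 3 (off i + k) = (ls i)[k] := h3 i k (by omega)
    have hb : s.arr 3 (off i + k + 1) = (ls i)[k + 1] := h3 i (k + 1) hk'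
    have ha6 : s.arr 6 (ls i)[k] = (ls i)[k] * p := h6 _ (hlt i _ (List.getElem_mem _))
    have hb6 : s.arr 6 (ls i)[k + 1] = (ls i)[k + 1] * p := h6 _ (hlt i _ (List.getElem_mem _))
    -- The two freshness conditions hold because the vertices of a path are distinct and its arcs
    -- are inserted in order.
    have hins := h5.insert (i := i) (a := (ls i)[k]) (b := (ls i)[k + 1])
      (L' := fun j : Fin p => if (j : ℕ) < i then (ls j).zip (ls j).tail else
        if j = i then ((ls i).zip (ls i).tail).take (k + 1) else []) ?_ ?_ ?_
    · convert hins using 1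
      · funext c
        simp [Prog.run, Expr.eval, g12, g20, g3, g6, hx5, ha, hb, ha6, hb6, Function.update_apply]
      · funext c
        simp [Prog.run, Expr.eval, g12, g20, g3, g6, hx5, ha, hb, ha6, Function.update_apply]
    · intro w hw
      simp only [lt_irrefl, if_false, if_true] at hw
      obtain ⟨j, hj, hj', h1, -⟩ := mem_take_zip_tail hw
      have := (hnd i).getElem_inj_iff.1 h1
      omega
    · intro w hw
      simp only [lt_irrefl, if_false, if_true] at hw
      obtain ⟨j, hj, hj', -, h1⟩ := mem_take_zip_tail hw
      have := (hnd i).getElem_inj_iff.1 h1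
      omega
    · intro j e
      by_cases hji : j = i
      · subst hji
        simp only [lt_irrefl, if_false, if_true, true_and]
        rw [List.take_add_one, List.mem_append, List.getElem?_eq_getElem (by
          rw [List.length_zip, List.length_tail]; omega)]
        simp
      · simp [hji]
  · have : ((ls i).length - 1) * (28 + 7) ≤ n * 35 :=
      Nat.mul_le_mul_right _ (by have := hlen i; omega)
    omega
  · have hall : ((ls i).zip (ls i).tail).take ((ls i).length - 1) = (ls i).zip (ls i).tail :=
      List.take_of_length_le (by rw [List.length_zip, List.length_tail]; omega)
    intro j v w
    have := h j v w
    rw [hall] at this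
    by_cases hji : j = i
    · subst hji
      simpa using this
    · have hji' : (j : ℕ) < i + 1 ↔ (j : ℕ) < i :=
        ⟨fun h => lt_of_le_of_ne (by omega) fun e => hji (Fin.ext e), fun h => by omega⟩
      simpa [hji, hji'] using this
  · simp [Prog.run, Expr.eval, hF4.reg 12 (by decide), e12, hF4.reg 20 (by decide), e20,
      hF4.arr 2 (by decide), e2', h2, hoff]
  · simpa [Prog.run, Expr.eval] using h4

end

end DipathKernel

/-! ### Peeling off leaves -/

namespace DipathKernel

/-- The vertices that occur before position `h` in the enumeration `o`. -/
def peeledBefore (o : ℕ → ℕ) (h : ℕ) : Finset ℕ := (Finset.range h).image o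

/-- The state after peeling off `h` vertices in the order given by the queue `o` of length `cnt`:
`dg` and `sm` are the degrees and the sums of the neighbours among the remaining vertices, and `pr`
gives the parent codes. -/
structure Peeling (n : ℕ) (nb : ℕ → Finset ℕ) (h cnt : ℕ) (o dg sm pr : ℕ → ℕ) : Prop where
  le : h ≤ cnt
  inj : ∀ i < cnt, ∀ j < cnt, o i = o j → i = j
  lt : ∀ i < cnt, o i < n
  deg : ∀ v < n, v ∉ peeledBefore o h → dg v = (nb v \ peeledBefore o h).card
  sum : ∀ v < n, v ∉ peeledBefore o h → sm v = ∑ u ∈ nb v \ peeledBefore o h, u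
  queued : ∀ v < n, v ∉ peeledBefore o h →
    ((∃ i < cnt, o i = v) ↔ (nb v \ peeledBefore o h).card < 2)
  par : ∀ j < h, (pr (o j) = n + 1 ∧ nb (o j) \ peeledBefore o j = ∅) ∨
    ∃ u, nb (o j) \ peeledBefore o j = {u} ∧ pr (o j) = u + 1
  par_none : ∀ v < n, v ∉ peeledBefore o h → pr v = n + 1

lemma mem_peeledBefore {o : ℕ → ℕ} {h v : ℕ} : v ∈ peeledBefore o h ↔ ∃ i < h, o i = v := by
  simp [peeledBefore]

lemma peeledBefore_succ {o : ℕ → ℕ} {h : ℕ} :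
    peeledBefore o (h + 1) = insert (o h) (peeledBefore o h) := by
  simp [peeledBefore, Finset.range_add_one]

lemma peeledBefore_congr {o o' : ℕ → ℕ} {h : ℕ} (H : ∀ i < h, o' i = o i) :
    peeledBefore o' h = peeledBefore o h :=
  Finset.image_congr fun i hi => H i (by simpa using hi)

namespace Peeling

variable {n : ℕ} {nb : ℕ → Finset ℕ} {h cnt : ℕ} {o dg sm pr : ℕ → ℕ}

lemma not_mem (hp : Peeling n nb h cnt o dg sm pr) (hc : h < cnt) : o h ∉ peeledBefore o h := by
  rw [mem_peeledBefore]
  rintro ⟨i, hi, he⟩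
  have := hp.inj i (by omega) h hc he
  omega

/-- The queue never runs dry early: some remaining vertex has at most one remaining neighbour and is
therefore queued, whereas an exhausted queue contains only peeled vertices. -/
lemma lt_cnt (hp : Peeling n nb h cnt o dg sm pr)
    (hac : ∀ W ⊆ Finset.range n, W.Nonempty → ∃ v ∈ W, (nb v ∩ W).card < 2)
    (hnb : ∀ v, nb v ⊆ Finset.range n) (hn : h < n) : h < cnt := by
  by_contra hc
  have hcnt : cnt = h := le_antisymm (by omega) hp.le
  subst hcnt
  obtain ⟨v, hv, hcard⟩ := hac (Finset.range n \ peeledBefore o cnt) Finset.sdiff_subset (by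
    rw [← Finset.card_pos]
    have h1 := Finset.le_card_sdiff (peeledBefore o cnt) (Finset.range n)
    have h2 : (peeledBefore o cnt).card ≤ cnt := by
      simpa [peeledBefore] using Finset.card_image_le (s := Finset.range cnt) (f := o)
    rw [Finset.card_range] at h1
    omega)
  rw [Finset.mem_sdiff, Finset.mem_range] at hv
  rw [← Finset.inter_sdiff_assoc, Finset.inter_eq_left.2 (hnb v)] at hcard
  exact hv.2 (mem_peeledBefore.2 ((hp.queued v hv.1 hv.2).2 hcard))

/-- The remaining neighbourhoods of vertices that are not adjacent to a peeled vertex. -/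
lemma sdiff_succ_of_not_adj {v : ℕ} (hv : o h ∉ nb v) :
    nb v \ peeledBefore o (h + 1) = nb v \ peeledBefore o h := by
  rw [peeledBefore_succ]
  ext x
  simp only [Finset.mem_sdiff, Finset.mem_insert]
  constructor
  · rintro ⟨h1, h2⟩
    exact ⟨h1, fun h => h2 (Or.inr h)⟩
  · rintro ⟨h1, h2⟩
    refine ⟨h1, ?_⟩
    rintro (rfl | h)
    · exact hv h1
    · exact h2 h

/-- A vertex without remaining neighbours affects no other vertex when it is peeled, and it keeps
the default code `n + 1` for having no parent. -/
lemma step_isolated (hp : Peeling n nb h cnt o dg sm pr) (hc : h < cnt)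
    (hsymm : ∀ u v, u ∈ nb v → v ∈ nb u) (h0 : dg (o h) = 0) :
    Peeling n nb (h + 1) cnt o dg sm pr := by
  have hw := hp.not_mem hc
  have hwn := hp.lt h hc
  have hemp : nb (o h) \ peeledBefore o h = ∅ := by
    rw [← Finset.card_eq_zero, ← hp.deg _ hwn hw, h0]
  have hsub : ∀ v, v ∉ peeledBefore o (h + 1) → v ∉ peeledBefore o h := fun v hv hv' =>
    hv (by rw [peeledBefore_succ]; exact Finset.mem_insert_of_mem hv')
  have hnadj : ∀ v, v ∉ peeledBefore o (h + 1) → o h ∉ nb v := fun v hv hv' => by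
    have : v ∈ nb (o h) \ peeledBefore o h := Finset.mem_sdiff.2 ⟨hsymm _ _ hv', hsub v hv⟩
    rw [hemp] at this
    simp at this
  refine ⟨hc, hp.inj, hp.lt, fun v hv hv' => ?_, fun v hv hv' => ?_, fun v hv hv' => ?_,
    fun j hj => ?_, fun v hv hv' => hp.par_none v hv (hsub v hv')⟩
  · rw [sdiff_succ_of_not_adj (hnadj v hv'), hp.deg v hv (hsub v hv')]
  · rw [sdiff_succ_of_not_adj (hnadj v hv'), hp.sum v hv (hsub v hv')]
  · rw [sdiff_succ_of_not_adj (hnadj v hv'), hp.queued v hv (hsub v hv')]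
  · rcases Nat.lt_succ_iff_lt_or_eq.1 hj with hj | rfl
    · exact hp.par j hj
    · exact Or.inl ⟨hp.par_none _ hwn hw, hemp⟩

/-- For a leaf the sum of the remaining neighbours is its only remaining neighbour, so the parent is
found without adjacency lists. The parent joins the queue exactly when its degree drops from 2 to 1;
if it drops to 0, the parent was queued already. -/
lemma step_leaf (hp : Peeling n nb h cnt o dg sm pr) (hc : h < cnt)
    (hsymm : ∀ u v, u ∈ nb v → v ∈ nb u) (hirr : ∀ v, v ∉ nb v)
    (hnb : ∀ v, nb v ⊆ Finset.range n) (h0 : 0 < dg (o h)) {u : ℕ} (hu : u = sm (o h)) :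
    if 0 < dg u - 1 ∧ dg u - 1 < 2 then
      Peeling n nb (h + 1) (cnt + 1) (Function.update o cnt u) (Function.update dg u (dg u - 1))
        (Function.update sm u (sm u - o h)) (Function.update pr (o h) (u + 1))
    else
      Peeling n nb (h + 1) cnt o (Function.update dg u (dg u - 1))
        (Function.update sm u (sm u - o h)) (Function.update pr (o h) (u + 1)) := by
  have hw := hp.not_mem hc
  have hwn := hp.lt h hc
  have hone : (nb (o h) \ peeledBefore o h).card = 1 := by
    have h1 := (hp.queued _ hwn hw).1 ⟨h, hc, rfl⟩
    rw [hp.deg _ hwn hw] at h0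
    omega
  obtain ⟨x, hx⟩ := Finset.card_eq_one.1 hone
  have hux : u = x := by rw [hu, hp.sum _ hwn hw, hx, Finset.sum_singleton]
  subst hux
  have humem : u ∈ nb (o h) \ peeledBefore o h := by rw [hx]; simp
  obtain ⟨hu1, hu2⟩ := Finset.mem_sdiff.1 humem
  have hun : u < n := Finset.mem_range.1 (hnb _ hu1)
  have huw : u ≠ o h := fun e => hirr (o h) (by rwa [e] at hu1)
  have hu3 : u ∉ peeledBefore o (h + 1) := by
    rw [peeledBefore_succ, Finset.mem_insert, not_or]; exact ⟨huw, hu2⟩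
  have hsub : ∀ v, v ∉ peeledBefore o (h + 1) → v ∉ peeledBefore o h := fun v hv hv' =>
    hv (by rw [peeledBefore_succ]; exact Finset.mem_insert_of_mem hv')
  have hnadj : ∀ v, v ∉ peeledBefore o (h + 1) → v ≠ u → o h ∉ nb v := fun v hv hvu hv' => by
    have : v ∈ nb (o h) \ peeledBefore o h := Finset.mem_sdiff.2 ⟨hsymm _ _ hv', hsub v hv⟩
    rw [hx] at this
    exact hvu (by simpa using this)
  have hwu : o h ∈ nb u \ peeledBefore o h := Finset.mem_sdiff.2 ⟨hsymm _ _ hu1, hw⟩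
  have herase : nb u \ peeledBefore o (h + 1) = (nb u \ peeledBefore o h).erase (o h) := by
    rw [peeledBefore_succ]
    ext y
    simp only [Finset.mem_sdiff, Finset.mem_insert, Finset.mem_erase]
    tauto
  have hcard : (nb u \ peeledBefore o (h + 1)).card = dg u - 1 := by
    rw [herase, Finset.card_erase_of_mem hwu, hp.deg u hun hu2]
  have hpos : 0 < dg u := by
    rw [hp.deg u hun hu2]; exact Finset.card_pos.2 ⟨_, hwu⟩
  have hdeg : ∀ v < n, v ∉ peeledBefore o (h + 1) →
      Function.update dg u (dg u - 1) v = (nb v \ peeledBefore o (h + 1)).card := by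
    intro v hv hv'
    by_cases hvu : v = u
    · subst hvu; rw [Function.update_self, hcard]
    · rw [Function.update_of_ne hvu, sdiff_succ_of_not_adj (hnadj v hv' hvu),
        hp.deg v hv (hsub v hv')]
  have hsum : ∀ v < n, v ∉ peeledBefore o (h + 1) →
      Function.update sm u (sm u - o h) v = ∑ y ∈ nb v \ peeledBefore o (h + 1), y := by
    intro v hv hv'
    by_cases hvu : v = u
    · subst hvu
      rw [Function.update_self, herase, hp.sum v hun hu2, ← Finset.add_sum_erase _ _ hwu]
      simp
    · rw [Function.update_of_ne hvu, sdiff_succ_of_not_adj (hnadj v hv' hvu),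
        hp.sum v hv (hsub v hv')]
  have hpar : ∀ j < h + 1,
      (Function.update pr (o h) (u + 1) (o j) = n + 1 ∧ nb (o j) \ peeledBefore o j = ∅) ∨
      ∃ y, nb (o j) \ peeledBefore o j = {y} ∧
        Function.update pr (o h) (u + 1) (o j) = y + 1 := by
    intro j hj
    rcases Nat.lt_succ_iff_lt_or_eq.1 hj with hj | rfl
    · have hne : o j ≠ o h := fun e => by
        have := hp.inj j (by omega) h hc e
        omega
      rw [Function.update_of_ne hne]
      exact hp.par j hj
    · exact Or.inr ⟨u, hx, by rw [Function.update_self]⟩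
  have hnone : ∀ v < n, v ∉ peeledBefore o (h + 1) →
      Function.update pr (o h) (u + 1) v = n + 1 := by
    intro v hv hv'
    have hne : v ≠ o h := fun e => hv' (mem_peeledBefore.2 ⟨h, by omega, e.symm⟩)
    rw [Function.update_of_ne hne]
    exact hp.par_none v hv (hsub v hv')
  have hqueue : ∀ v < n, v ∉ peeledBefore o (h + 1) → v ≠ u →
      ((∃ i < cnt, o i = v) ↔ (nb v \ peeledBefore o (h + 1)).card < 2) := by
    intro v hv hv' hvu
    rw [sdiff_succ_of_not_adj (hnadj v hv' hvu), hp.queued v hv (hsub v hv')]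
  have huq := hp.queued u hun hu2
  rw [← hp.deg u hun hu2] at huq
  split_ifs with hif
  -- The old degree of `u` was 2, so `u` is not yet in the queue and the entries stay distinct.
  · have hnq : ¬ ∃ i < cnt, o i = u := by rw [huq]; omega
    have hold : ∀ i < cnt, Function.update o cnt u i = o i := fun i hi =>
      Function.update_of_ne (by omega) _ _
    have hb : ∀ j ≤ cnt, peeledBefore (Function.update o cnt u) j = peeledBefore o j := fun j hj =>
      peeledBefore_congr fun i hi => hold i (by omega)
    refine ⟨by omega, ?_, ?_, ?_, ?_, ?_, ?_, ?_⟩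
    · intro i hi j hj he
      rcases Nat.lt_succ_iff_lt_or_eq.1 hi with hi | rfl <;>
        rcases Nat.lt_succ_iff_lt_or_eq.1 hj with hj | rfl
      · rw [hold i hi, hold j hj] at he
        exact hp.inj i hi j hj he
      · rw [hold i hi, Function.update_self] at he
        exact absurd ⟨i, hi, he⟩ hnq
      · rw [hold j hj, Function.update_self] at he
        exact absurd ⟨j, hj, he.symm⟩ hnq
      · rfl
    · intro i hi
      rcases Nat.lt_succ_iff_lt_or_eq.1 hi with hi | rfl
      · rw [hold i hi]; exact hp.lt i hi
      · rwa [Function.update_self]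
    · rw [hb (h + 1) hc]; exact hdeg
    · rw [hb (h + 1) hc]; exact hsum
    · rw [hb (h + 1) hc]
      intro v hv hv'
      by_cases hvu : v = u
      · subst hvu
        exact iff_of_true ⟨cnt, by omega, Function.update_self _ _ _⟩ (by omega)
      · rw [← hqueue v hv hv' hvu]
        constructor
        · rintro ⟨i, hi, he⟩
          rcases Nat.lt_succ_iff_lt_or_eq.1 hi with hi | rfl
          · exact ⟨i, hi, by rw [← he, hold i hi]⟩
          · rw [Function.update_self] at he
            exact absurd he.symm hvu
        · rintro ⟨i, hi, he⟩
          exact ⟨i, by omega, by rw [hold i hi, he]⟩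
    · intro j hj
      rw [hb j (by omega), hold j (by omega)]
      exact hpar j hj
    · rw [hb (h + 1) hc]; exact hnone
  · refine ⟨hc, hp.inj, hp.lt, hdeg, hsum, ?_, hpar, hnone⟩
    intro v hv hv'
    by_cases hvu : v = u
    · subst hvu
      refine huq.trans ?_
      rw [hcard]
      clear huq
      omega
    · exact hqueue v hv hv' hvu

end Peeling

/-! ### Degrees, queue and peeling on the machine -/

/-- The neighbours of `v` in the undirected graph with edge list `E`. -/
def neighbours (n : ℕ) (E : List (ℕ × ℕ)) (v : ℕ) : Finset ℕ :=
  (Finset.range n).filter fun u => (u, v) ∈ E ∨ (v, u) ∈ E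

/-- Add the edge between the vertices in registers 13 and 14. -/
def addEdgeProg : Prog :=
  .seq (.put 9 (.reg 13) (.add (.get 9 (.reg 13)) (.const 1)))
  (.seq (.put 9 (.reg 14) (.add (.get 9 (.reg 14)) (.const 1)))
  (.seq (.put 10 (.reg 13) (.add (.get 10 (.reg 13)) (.reg 14)))
    (.put 10 (.reg 14) (.add (.get 10 (.reg 14)) (.reg 13)))))

/-- Compute the degrees in array 9 and the sums of the neighbours in array 10. -/
def degreesProg : Prog :=
  forLoop 20 0 (.seq (.set 13 (.get 0 (.reg 20))) (.seq (.set 14 (.get 1 (.reg 20)))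
    (.ite (.reg 13) (.reg 14) addEdgeProg (.ite (.reg 14) (.reg 13) addEdgeProg .skip))))

/-- Queue the vertices of degree at most one in array 11, with their number in register 15. -/
def queueProg : Prog :=
  .seq (.set 15 (.const 0))
    (forLoop 20 0 (.seq (.put 12 (.reg 20) (.add (.reg 0) (.const 1)))
      (.ite (.get 9 (.reg 20)) (.const 2)
        (.seq (.put 11 (.reg 15) (.reg 20)) (.set 15 (.add (.reg 15) (.const 1)))) .skip)))

/-- Peel off leaves; array 11 gets the order and array 12 the parent codes. -/
def peelProg : Prog :=
  forLoop 20 0 (.seq (.set 13 (.get 11 (.reg 20)))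
    (.ite (.const 0) (.get 9 (.reg 13))
      (.seq (.set 14 (.get 10 (.reg 13)))
      (.seq (.put 12 (.reg 13) (.add (.reg 14) (.const 1)))
      (.seq (.put 9 (.reg 14) (.sub (.get 9 (.reg 14)) (.const 1)))
      (.seq (.put 10 (.reg 14) (.sub (.get 10 (.reg 14)) (.reg 13)))
      (.ite (.const 0) (.get 9 (.reg 14))
        (.ite (.get 9 (.reg 14)) (.const 2)
          (.seq (.put 11 (.reg 15) (.reg 14)) (.set 15 (.add (.reg 15) (.const 1)))) .skip) .skip)))))
      .skip))

section

variable {n : ℕ} {s : State}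

lemma mem_neighbours {E : List (ℕ × ℕ)} {u v : ℕ} :
    u ∈ neighbours n E v ↔ u < n ∧ ((u, v) ∈ E ∨ (v, u) ∈ E) := by
  simp [neighbours]

lemma degreesProg_spec {E : List (ℕ × ℕ)} (h0 : s.reg 0 = n)
    (ha0 : ∀ k, s.arr 0 k = (E.map Prod.fst).getD k 0)
    (ha1 : ∀ k, s.arr 1 k = (E.map Prod.snd).getD k 0)
    (h9 : ∀ k, s.arr 9 k = 0) (h10 : ∀ k, s.arr 10 k = 0) (hnd : E.Nodup) (hlen : E.length ≤ n)
    (hlt : ∀ u v, (u, v) ∈ E → u < n ∧ v < n) (hor : ∀ u v, (u, v) ∈ E → (v, u) ∉ E) :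
    Tri degreesProg s (n * 50 + 5) fun s' => ∀ v, s'.arr 9 v = (neighbours n E v).card ∧
      s'.arr 10 v = ∑ u ∈ neighbours n E v, u := by
  refine Tri.mono (Tri.forLoop (N := n) (T := 43)
    (fun l s' => ∀ v, s'.arr 9 v = (neighbours n (E.take l) v).card ∧
      s'.arr 10 v = ∑ u ∈ neighbours n (E.take l) v, u) h0 (by decide) (by decide) ?_ ?_) le_rfl
    fun s' _ h => ?_
  · intro v
    have : neighbours n (E.take 0) v = ∅ := by
      ext u; simp [mem_neighbours]
    rw [this]
    simp [h9, h10]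
  · intro l s' hl hx hF hI
    refine Tri.of_run rfl (by decide) ?_
    have e0 : s'.arr 0 l = (E.map Prod.fst).getD l 0 := by rw [hF.arr 0 (by decide), ha0]
    have e1 : s'.arr 1 l = (E.map Prod.snd).getD l 0 := by rw [hF.arr 1 (by decide), ha1]
    by_cases hlE : l < E.length
    · obtain ⟨t, h, hth⟩ : ∃ t h, E[l] = (t, h) := ⟨_, _, rfl⟩
      have e0' : s'.arr 0 l = t := by
        rw [e0, List.getD_eq_getElem _ _ (by simpa using hlE), List.getElem_map, hth]
      have e1' : s'.arr 1 l = h := by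
        rw [e1, List.getD_eq_getElem _ _ (by simpa using hlE), List.getElem_map, hth]
      have hmem : (t, h) ∈ E := hth ▸ List.getElem_mem _
      have hne : t ≠ h := fun e => hor t h hmem (by rw [e] at hmem ⊢; exact hmem)
      obtain ⟨htn, hhn⟩ := hlt t h hmem
      have htake : E.take (l + 1) = E.take l ++ [(t, h)] := by
        rw [List.take_add_one, List.getElem?_eq_getElem hlE, hth]; rfl
      have hnot : (t, h) ∉ E.take l := by
        have := hnd.sublist (List.take_sublist (l + 1) E)
        rw [htake, List.nodup_append] at this
        exact fun hm => this.2.2 _ hm _ (by simp) rfl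
      have hnot' : (h, t) ∉ E.take l := fun hm => hor t h hmem (List.mem_of_mem_take hm)
      have nt : neighbours n (E.take (l + 1)) t = insert h (neighbours n (E.take l) t) := by
        ext u
        simp only [mem_neighbours, htake, List.mem_append, List.mem_singleton, Prod.mk.injEq,
          Finset.mem_insert]
        grind
      have nh : neighbours n (E.take (l + 1)) h = insert t (neighbours n (E.take l) h) := by
        ext u
        simp only [mem_neighbours, htake, List.mem_append, List.mem_singleton, Prod.mk.injEq,
          Finset.mem_insert]
        grind
      have nv : ∀ v, v ≠ t → v ≠ h →
          neighbours n (E.take (l + 1)) v = neighbours n (E.take l) v := by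
        intro v hvt hvh
        ext u
        simp only [mem_neighbours, htake, List.mem_append, List.mem_singleton, Prod.mk.injEq]
        grind
      have nt' : h ∉ neighbours n (E.take l) t := by simp [mem_neighbours, hnot, hnot']
      have nh' : t ∉ neighbours n (E.take l) h := by simp [mem_neighbours, hnot, hnot']
      have hrun : ∀ v, (addEdgeProg.run ((s'.setReg 13 t).setReg 14 h)).arr 9 v =
            (neighbours n (E.take (l + 1)) v).card ∧
          (addEdgeProg.run ((s'.setReg 13 t).setReg 14 h)).arr 10 v =
            ∑ u ∈ neighbours n (E.take (l + 1)) v, u := by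
        intro v
        by_cases hvt : v = t
        · subst hvt
          rw [nt, Finset.card_insert_of_notMem nt', Finset.sum_insert nt']
          simp [addEdgeProg, Prog.run, Expr.eval, hne, (hI v).1, (hI v).2, add_comm]
        · by_cases hvh : v = h
          · subst hvh
            rw [nh, Finset.card_insert_of_notMem nh', Finset.sum_insert nh']
            simp [addEdgeProg, Prog.run, Expr.eval, hvt, (hI v).1, (hI v).2, add_comm]
          · rw [nv v hvt hvh]
            simp [addEdgeProg, Prog.run, Expr.eval, hvt, hvh, (hI v).1, (hI v).2]
      have hcond : t < h ∨ h < t := by omega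
      intro v
      simp only [Prog.run, Expr.eval, hx, e0', State.arr_setReg, State.reg_setReg,
        if_neg (show (20 : ℕ) ≠ 13 by decide), e1']
      have := hrun v
      rcases hcond with hc | hc
      · simpa [hc] using this
      · have hc' : ¬ t < h := by omega
        simpa [hc, hc'] using this
    · have e0' : s'.arr 0 l = 0 := by
        rw [e0, List.getD_eq_default _ _ (by simpa using hlE)]
      have e1' : s'.arr 1 l = 0 := by
        rw [e1, List.getD_eq_default _ _ (by simpa using hlE)]
      intro v
      have := hI v
      rw [List.take_of_length_le (by omega)] at this ⊢
      simpa [Prog.run, Expr.eval, hx, e0', e1'] using this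
  · rwa [List.take_of_length_le hlen] at h

lemma queueProg_spec {nb : ℕ → Finset ℕ} (h0 : s.reg 0 = n)
    (h9 : ∀ v, s.arr 9 v = (nb v).card) (h10 : ∀ v, s.arr 10 v = ∑ u ∈ nb v, u) :
    Tri queueProg s (n * 25 + 7) fun s' =>
      Peeling n nb 0 (s'.reg 15) (s'.arr 11) (s'.arr 9) (s'.arr 10) (s'.arr 12) := by
  refine Tri.seq_le (T₁ := 2) (T₂ := n * 25 + 5) (Q := fun s' => s'.reg 15 = 0)
    (Tri.of_run rfl (by decide) (by simp [Prog.run, Expr.eval])) (fun s1 hF1 h15 => ?_) (by omega)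
  have e0 : s1.reg 0 = n := (hF1.reg 0 (by decide)).trans h0
  refine Tri.mono (Tri.forLoop (N := n) (T := 18)
    (fun l s' => (∀ i < s'.reg 15, s'.arr 11 i < l) ∧
      (∀ i < s'.reg 15, ∀ j < s'.reg 15, s'.arr 11 i = s'.arr 11 j → i = j) ∧
      (∀ v < l, ((∃ i < s'.reg 15, s'.arr 11 i = v) ↔ (nb v).card < 2)) ∧
      ∀ v < l, s'.arr 12 v = n + 1)
    e0 (by decide) (by decide) ?_ ?_) le_rfl fun s' hF' h => ?_
  · simp [h15]
  · rintro l s' hl hx hF ⟨i1, i2, i3, i4⟩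
    have e9 : s'.arr 9 l = (nb l).card := by
      rw [hF.arr 9 (by decide), hF1.arr 9 (by decide), h9]
    have e0' : s'.reg 0 = n := (hF.reg 0 (by decide)).trans e0
    refine Tri.of_run rfl (by decide) ?_
    by_cases hc : (nb l).card < 2
    · have hold : ∀ i, i < s'.reg 15 → i ≠ s'.reg 15 := fun i hi => by omega
      simp only [Prog.run, Expr.eval, hx, e0', State.arr_setArr, State.reg_setArr, e9, hc, if_true,
        State.arr_setReg, State.reg_setReg, if_neg (show (9 : ℕ) ≠ 12 by decide),
        if_neg (show (15 : ℕ) ≠ 20 by decide), if_neg (show (11 : ℕ) ≠ 12 by decide),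
        if_neg (show (12 : ℕ) ≠ 11 by decide)]
      refine ⟨fun i hi => ?_, fun i hi j hj => ?_, fun v hv => ?_, fun v hv => ?_⟩
      · split_ifs with h
        · omega
        · have := i1 i (by omega)
          omega
      · have hi' := i1 i
        have hj' := i1 j
        split_ifs with h h' h'
        · omega
        · intro e
          have := hj' (by omega)
          omega
        · intro e
          have := hi' (by omega)
          omega
        · exact i2 i (by omega) j (by omega)
      · rcases Nat.lt_succ_iff_lt_or_eq.1 hv with hv | rfl
        · rw [← i3 v hv]
          constructor
          · rintro ⟨i, hi, he⟩
            split_ifs at he with h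
            · omega
            · exact ⟨i, by omega, he⟩
          · rintro ⟨i, hi, he⟩
            exact ⟨i, by omega, by rw [if_neg (by omega)]; exact he⟩
        · exact iff_of_true ⟨s'.reg 15, by omega, by rw [if_pos rfl]⟩ hc
      · split_ifs with h
        · rfl
        · exact i4 v (by omega)
    · simp only [Prog.run, Expr.eval, hx, e0', State.arr_setArr, State.reg_setArr, e9, hc, if_false,
        State.arr_setReg, State.reg_setReg, if_neg (show (9 : ℕ) ≠ 12 by decide),
        if_neg (show (15 : ℕ) ≠ 20 by decide), if_neg (show (11 : ℕ) ≠ 12 by decide), if_true]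
      refine ⟨fun i hi => ?_, i2, fun v hv => ?_, fun v hv => ?_⟩
      · have := i1 i hi
        omega
      · rcases Nat.lt_succ_iff_lt_or_eq.1 hv with hv | rfl
        · exact i3 v hv
        · refine iff_of_false ?_ hc
          rintro ⟨i, hi, he⟩
          have := i1 i hi
          omega
      · split_ifs with h
        · rfl
        · exact i4 v (by omega)
  · obtain ⟨i1, i2, i3, i4⟩ := h
    have e9 : s'.arr 9 = s.arr 9 := (hF'.arr 9 (by decide)).trans (hF1.arr 9 (by decide))
    have e10 : s'.arr 10 = s.arr 10 := (hF'.arr 10 (by decide)).trans (hF1.arr 10 (by decide))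
    have hemp : peeledBefore (s'.arr 11) 0 = ∅ := by simp [peeledBefore]
    refine ⟨Nat.zero_le _, i2, i1, fun v hv _ => ?_, fun v hv _ => ?_, fun v hv _ => ?_,
      fun j hj => absurd hj (by omega), fun v hv _ => i4 v hv⟩
    · rw [hemp, Finset.sdiff_empty, e9, h9]
    · rw [hemp, Finset.sdiff_empty, e10, h10]
    · rw [hemp, Finset.sdiff_empty, i3 v hv]

lemma State.arr_setArr_self (s : State) (a i v : ℕ) :
    (s.setArr a i v).arr a = Function.update (s.arr a) i v := by
  simp [State.setArr]

lemma State.arr_setArr_of_ne (s : State) {a b : ℕ} (h : b ≠ a) (i v : ℕ) :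
    (s.setArr a i v).arr b = s.arr b := by
  simp [State.setArr, h]

lemma peelProg_spec {nb : ℕ → Finset ℕ} (h0 : s.reg 0 = n)
    (hac : ∀ W ⊆ Finset.range n, W.Nonempty → ∃ v ∈ W, (nb v ∩ W).card < 2)
    (hsymm : ∀ u v, u ∈ nb v → v ∈ nb u) (hirr : ∀ v, v ∉ nb v)
    (hnb : ∀ v, nb v ⊆ Finset.range n)
    (hp : Peeling n nb 0 (s.reg 15) (s.arr 11) (s.arr 9) (s.arr 10) (s.arr 12)) :
    Tri peelProg s (n * 60 + 5) fun s' =>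
      Peeling n nb n (s'.reg 15) (s'.arr 11) (s'.arr 9) (s'.arr 10) (s'.arr 12) := by
  refine Tri.mono (Tri.forLoop (N := n) (T := 53)
    (fun l s' => Peeling n nb l (s'.reg 15) (s'.arr 11) (s'.arr 9) (s'.arr 10) (s'.arr 12))
    h0 (by decide) (by decide) hp ?_) le_rfl fun s' _ h => h
  intro l s' hl hx hF hI
  have hc := hI.lt_cnt hac hnb hl
  refine Tri.of_run rfl (by decide) ?_
  by_cases h9 : 0 < s'.arr 9 (s'.arr 11 l)
  · have := hI.step_leaf hc hsymm hirr hnb h9 rfl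
    simp only [Prog.run, Expr.eval, hx, State.arr_setReg, State.reg_setReg, if_true, h9,
      State.reg_setArr, if_neg (show (13 : ℕ) ≠ 14 by decide), State.arr_setArr_self,
      State.arr_setArr_of_ne _ (show (9 : ℕ) ≠ 12 by decide),
      State.arr_setArr_of_ne _ (show (9 : ℕ) ≠ 10 by decide),
      State.arr_setArr_of_ne _ (show (10 : ℕ) ≠ 12 by decide),
      State.arr_setArr_of_ne _ (show (10 : ℕ) ≠ 9 by decide), Function.update_self]
    split_ifs at this with hif
    · rw [if_pos hif.1, if_pos hif.2]
      simpa [State.arr_setArr_self, State.arr_setArr_of_ne] using this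
    · have e : ∀ x y : State, (if 0 < s'.arr 9 (s'.arr 10 (s'.arr 11 l)) - 1 then
          if s'.arr 9 (s'.arr 10 (s'.arr 11 l)) - 1 < 2 then x else y else y) = y := by
        intro x y
        split_ifs with h1 h2
        · exact absurd ⟨h1, h2⟩ hif
        · rfl
        · rfl
      rw [e]
      simpa [State.arr_setArr_self, State.arr_setArr_of_ne] using this
  · have := hI.step_isolated hc hsymm (by omega)
    simpa [Prog.run, Expr.eval, hx, h9] using this

end

end DipathKernel

/-! ### Dipaths of a directed tree -/

namespace DipathKernel

/-- In a tree, every nonempty set contains a vertex with at most one neighbour in the set. -/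
lemma exists_at_most_one_neighbour {V : Type} {G : SimpleGraph V} (hG : G.IsTree)
    {W : Finset V} (hW : W.Nonempty) :
    ∃ v ∈ W, ∀ a ∈ W, ∀ b ∈ W, G.Adj v a → G.Adj v b → a = b := by
  obtain ⟨r, hr⟩ := hW
  -- A vertex of the set farthest from `r` works: a neighbour of it in the set is not farther from
  -- `r`, so it must precede `v` on the path from `r`.
  obtain ⟨v, hv, hmax⟩ := Finset.exists_max_image W (G.dist r) ⟨r, hr⟩
  refine ⟨v, hv, ?_⟩
  obtain ⟨p, hp, hpl⟩ := (hG.connected r v).exists_path_of_dist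
  have key_lemma : ∀ a ∈ W, G.Adj v a → a = p.penultimate := by
    intro a ha hadj
    obtain ⟨q, hq, hql⟩ := (hG.connected r a).exists_path_of_dist
    have hvq : v ∉ q.support := fun h => by
      have h1 := congrArg SimpleGraph.Walk.length (hG.isAcyclic.path_concat hp hq hadj h)
      rw [SimpleGraph.Walk.length_concat, hpl, hql] at h1
      have := hmax a ha
      omega
    exact hG.isAcyclic.eq_penultimate_of_adj_end hp hadj
      (hG.isAcyclic.mem_support_of_ne_mem_support_of_adj_of_isPath hp hq hadj hvq)
  intro a ha b hb h1 h2
  rw [key_lemma a ha h1, key_lemma b hb h2]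

/-- A sequence without valleys that is larger at `b > a` than at `a` increases at `a`. -/
lemma lt_succ_of_no_valley {m : ℕ} {f : ℕ → ℕ} (hinj : ∀ a < m, ∀ b < m, f a = f b → a = b)
    (hv : ∀ b, b + 2 < m → f (b + 1) < f b → ¬ f (b + 1) < f (b + 2)) {a b : ℕ} (hab : a < b)
    (hb : b < m) (h : f a < f b) : f a < f (a + 1) := by
  by_contra hcon
  have hlt : f (a + 1) < f a := by
    refine lt_of_le_of_ne (by omega) fun e => ?_
    have := hinj _ (by omega) _ (by omega) e
    omega
  have key_lemma : ∀ c, a ≤ c → c + 1 < m → f (c + 1) < f c := by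
    intro c hac
    induction c, hac using Nat.le_induction with
    | base => exact fun _ => hlt
    | succ c hac ih =>
      intro hc
      refine lt_of_le_of_ne (not_lt.1 (hv c hc (ih (by omega)))) fun e => ?_
      have := hinj _ (by omega) _ (by omega) e
      omega
  have key_lemma' : ∀ c, a ≤ c → c < m → f c ≤ f a := by
    intro c hac
    induction c, hac using Nat.le_induction with
    | base => exact fun _ => le_rfl
    | succ c hac ih =>
      intro hc
      have := key_lemma c hac hc
      have := ih (by omega)
      omega
  have := key_lemma' b hab.le hb
  omega

/-- The absence of valleys is invariant under reversal, so this is the preceding lemma for `t ↦ f (m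
- 1 - t)`. -/
lemma lt_pred_of_no_valley {m : ℕ} {f : ℕ → ℕ} (hinj : ∀ a < m, ∀ b < m, f a = f b → a = b)
    (hv : ∀ b, b + 2 < m → f (b + 1) < f b → ¬ f (b + 1) < f (b + 2)) {a b : ℕ} (hba : b < a)
    (ha : a < m) (h : f a < f b) : f a < f (a - 1) := by
  have := lt_succ_of_no_valley (m := m) (f := fun t => f (m - 1 - t)) (a := m - 1 - a)
    (b := m - 1 - b)
    (fun x hx y hy e => by
      have := hinj _ (by omega) _ (by omega) e
      omega)
    (fun x hx h1 h2 => by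
      have e1 : m - 1 - (x + 1) = m - 1 - (x + 2) + 1 := by omega
      have e2 : m - 1 - x = m - 1 - (x + 2) + 2 := by omega
      rw [e1] at h1 h2
      rw [e2] at h1
      exact hv _ (by omega) h2 h1) (by omega) (by omega)
    (by rw [show m - 1 - (m - 1 - a) = a by omega, show m - 1 - (m - 1 - b) = b by omega]; exact h)
  rwa [show m - 1 - (m - 1 - a) = a by omega, show m - 1 - (m - 1 - a + 1) = a - 1 by omega] at this

/-! ### Dipaths as lists of numbers, and their layout -/

section

variable {n : ℕ} {T : Digraph (Fin n)}

/-- The vertices of a dipath, as natural numbers. -/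
def Dipath.nums (P : Dipath T) : List ℕ := P.verts.map Fin.val

lemma Dipath.mem_zip_nums {P : Dipath T} {a b : ℕ} :
    (a, b) ∈ P.nums.zip P.nums.tail ↔ ∃ u v : Fin n, (u, v) ∈ P.arcs ∧ (u : ℕ) = a ∧ (v : ℕ) = b := by
  rw [Dipath.nums, ← List.map_tail, List.zip_map, List.mem_map]
  simp [Dipath.arcs]

lemma Dipath.val_mem_zip_nums {P : Dipath T} {u v : Fin n} :
    ((u : ℕ), (v : ℕ)) ∈ P.nums.zip P.nums.tail ↔ (u, v) ∈ P.arcs := by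
  rw [P.mem_zip_nums]
  constructor
  · rintro ⟨u', v', h, h1, h2⟩
    rwa [← Fin.ext h1, ← Fin.ext h2]
  · exact fun h => ⟨u, v, h, rfl, rfl⟩

lemma Dipath.adj_of_mem_arcs {P : Dipath T} {u v : Fin n} (h : (u, v) ∈ P.arcs) : T.Adj u v := by
  obtain ⟨j, hj, he⟩ := List.mem_iff_getElem.1 h
  have hj' : j + 1 < P.verts.length := by
    simp only [Dipath.arcs, List.length_zip, List.length_tail] at hj
    omega
  have := List.isChain_iff_getElem.1 P.chain j hj'
  simp only [Dipath.arcs, List.getElem_zip, List.getElem_tail, Prod.mk.injEq] at he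
  rwa [he.1, he.2] at this

lemma Dipath.nums_nodup (P : Dipath T) : P.nums.Nodup :=
  P.nodup.map Fin.val_injective

lemma Dipath.lt_of_mem_nums {P : Dipath T} {a : ℕ} (h : a ∈ P.nums) : a < n := by
  obtain ⟨v, -, rfl⟩ := List.mem_map.1 h
  exact v.2

lemma Dipath.length_nums_le (P : Dipath T) : P.nums.length ≤ n := by
  rw [Dipath.nums, List.length_map]
  simpa using P.nodup.length_le_card

/-- The arcs of a digraph, as pairs of natural numbers. -/
def numArcs (A : List (Fin n × Fin n)) : List (ℕ × ℕ) := A.map fun e => ((e.1 : ℕ), (e.2 : ℕ))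

lemma mem_numArcs {A : List (Fin n × Fin n)} {a b : ℕ} :
    (a, b) ∈ numArcs A ↔ ∃ u v : Fin n, (u, v) ∈ A ∧ (u : ℕ) = a ∧ (v : ℕ) = b := by
  simp [numArcs]

variable (hT : IsDirectedTree T) {A : List (Fin n × Fin n)} (hAT : ∀ u v, (u, v) ∈ A ↔ T.Adj u v)
include hT hAT

lemma val_mem_neighbours {u v : Fin n} :
    (u : ℕ) ∈ neighbours n (numArcs A) v ↔ T.toSimpleGraphInclusive.Adj v u := by
  rw [mem_neighbours, Digraph.toSimpleGraphInclusive, SimpleGraph.fromRel_adj]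
  have h1 : ∀ u v : Fin n, ((u : ℕ), (v : ℕ)) ∈ numArcs A ↔ T.Adj u v := by
    intro u v
    rw [mem_numArcs, ← hAT]
    constructor
    · rintro ⟨u', v', h, h1, h2⟩
      rwa [← Fin.ext h1, ← Fin.ext h2]
    · exact fun h => ⟨u, v, h, rfl, rfl⟩
  rw [h1, h1]
  constructor
  · rintro ⟨-, h⟩
    refine ⟨?_, h.symm⟩
    rintro rfl
    have : T.Adj v v := h.elim id id
    exact hT.oriented _ _ this this
  · exact fun h => ⟨u.2, h.2.symm⟩

omit hT hAT in
lemma neighbours_subset (E : List (ℕ × ℕ)) (v : ℕ) : neighbours n E v ⊆ Finset.range n :=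
  Finset.filter_subset _ _

omit hT hAT in
lemma neighbours_symm {E : List (ℕ × ℕ)} (hE : ∀ u v, (u, v) ∈ E → u < n ∧ v < n) {u v : ℕ}
    (h : u ∈ neighbours n E v) : v ∈ neighbours n E u := by
  rw [mem_neighbours] at h ⊢
  exact ⟨h.2.elim (fun h => (hE _ _ h).2) fun h => (hE _ _ h).1, h.2.symm⟩

omit hT hAT in
lemma numArcs_lt {u v : ℕ} (h : (u, v) ∈ numArcs A) : u < n ∧ v < n := by
  obtain ⟨a, b, -, rfl, rfl⟩ := mem_numArcs.1 h
  exact ⟨a.2, b.2⟩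

lemma numArcs_oriented {u v : ℕ} (h : (u, v) ∈ numArcs A) : (v, u) ∉ numArcs A := by
  obtain ⟨a, b, hab, rfl, rfl⟩ := mem_numArcs.1 h
  intro h'
  obtain ⟨c, d, hcd, h1, h2⟩ := mem_numArcs.1 h'
  rw [Fin.ext h1, Fin.ext h2] at hcd
  exact hT.oriented _ _ ((hAT _ _).1 hab) ((hAT _ _).1 hcd)

lemma not_mem_neighbours_self (v : ℕ) : v ∉ neighbours n (numArcs A) v := by
  rw [mem_neighbours]
  rintro ⟨-, h⟩
  have h := h.elim id id
  exact numArcs_oriented hT hAT h h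

lemma exists_card_neighbours_lt {W : Finset ℕ} (hW : W ⊆ Finset.range n) (hne : W.Nonempty) :
    ∃ v ∈ W, (neighbours n (numArcs A) v ∩ W).card < 2 := by
  obtain ⟨w, hw⟩ := hne
  have hw' := Finset.mem_range.1 (hW hw)
  obtain ⟨v, hv, h⟩ := exists_at_most_one_neighbour hT.isTree
    (W := Finset.univ.filter fun v : Fin n => (v : ℕ) ∈ W) ⟨⟨w, hw'⟩, by simpa using hw⟩
  simp only [Finset.mem_filter, Finset.mem_univ, true_and] at hv h
  refine ⟨v, hv, ?_⟩
  by_contra hcon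
  obtain ⟨a, ha, b, hb, hab⟩ := Finset.one_lt_card.1
    (by omega : 1 < (neighbours n (numArcs A) v ∩ W).card)
  rw [Finset.mem_inter] at ha hb
  have han := Finset.mem_range.1 (hW ha.2)
  have hbn := Finset.mem_range.1 (hW hb.2)
  have := h ⟨a, han⟩ ha.2 ⟨b, hbn⟩ hb.2
    ((val_mem_neighbours hT hAT (u := ⟨a, han⟩)).1 ha.1)
    ((val_mem_neighbours hT hAT (u := ⟨b, hbn⟩)).1 hb.1)
  exact hab (by simpa using this)

/-- Distinct arcs lie over distinct edges because no edge carries both directions, and a tree has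
fewer edges than vertices. -/
lemma length_arcs_le (hA : A.Nodup) : A.length ≤ n := by
  classical
  have hcard := hT.isTree.card_edgeFinset
  rw [Fintype.card_fin] at hcard
  have hmap : (A.map fun e => s(e.1, e.2)).Nodup := by
    refine List.Nodup.map_on ?_ hA
    rintro ⟨a, b⟩ hab ⟨c, d⟩ hcd he
    rcases Sym2.eq_iff.1 he with ⟨h1, h2⟩ | ⟨h1, h2⟩
    · simp only at h1 h2
      rw [h1, h2]
    · simp only at h1 h2
      subst h1 h2
      exact absurd ((hAT _ _).1 hcd) (hT.oriented _ _ ((hAT _ _).1 hab))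
  have hsub : (A.map fun e => s(e.1, e.2)).toFinset ⊆ T.toSimpleGraphInclusive.edgeFinset := by
    intro e he
    obtain ⟨⟨a, b⟩, hab, rfl⟩ := List.mem_map.1 (List.mem_toFinset.1 he)
    rw [SimpleGraph.mem_edgeFinset, SimpleGraph.mem_edgeSet, Digraph.toSimpleGraphInclusive,
      SimpleGraph.fromRel_adj]
    have hadj := (hAT _ _).1 hab
    refine ⟨fun h => ?_, Or.inl hadj⟩
    simp only at h
    subst h
    exact hT.oriented _ _ hadj hadj
  have := Finset.card_le_card hsub
  rw [List.toFinset_card_of_nodup hmap, List.length_map] at this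
  omega

omit hT in
/-- A dipath that has arcs at `o j` and at a vertex that was peeled off later contains the arc
between `o j` and its parent. -/
lemma passes_parent_of_peeling {cnt : ℕ} {o dg sm pr : ℕ → ℕ}
    (hp : Peeling n (neighbours n (numArcs A)) n cnt o dg sm pr)
    (hsurj : ∀ v < n, ∃ k < n, o k = v) (P : Dipath T) {j k : ℕ} (hjk : j < k) (hk : k < n)
    (hj' : o j ∈ P.nums) (hk' : o k ∈ P.nums) :
    (∃ w, (o j, w) ∈ P.nums.zip P.nums.tail ∧ pr (o j) = w + 1) ∨
      ∃ w, (w, o j) ∈ P.nums.zip P.nums.tail ∧ pr (o j) = w + 1 := by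
  have hoinj : ∀ i < n, ∀ j < n, o i = o j → i = j := fun i hi j hj =>
    hp.inj i (lt_of_lt_of_le hi hp.le) j (lt_of_lt_of_le hj hp.le)
  -- The function `f` gives the times at which the successive vertices of the path are peeled.
  obtain ⟨f, hf⟩ : ∃ f : ℕ → ℕ, ∀ a (ha : a < P.nums.length), f a < n ∧ o (f a) = P.nums[a] := by
    have : ∀ a, ∃ k, ∀ ha : a < P.nums.length, k < n ∧ o k = P.nums[a] := fun a => by
      by_cases ha : a < P.nums.length
      · obtain ⟨k, hk⟩ := hsurj P.nums[a] (P.lt_of_mem_nums (List.getElem_mem ha))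
        exact ⟨k, fun _ => hk⟩
      · exact ⟨0, fun h => absurd h ha⟩
    choose f hf using this
    exact ⟨f, hf⟩
  have hinj : ∀ a < P.nums.length, ∀ b < P.nums.length, f a = f b → a = b := by
    intro a ha b hb e
    have := (hf a ha).2.symm.trans ((congrArg o e).trans (hf b hb).2)
    exact P.nums_nodup.getElem_inj_iff.1 this
  have harc : ∀ a, a + 1 < P.nums.length →
      (o (f a), o (f (a + 1))) ∈ P.nums.zip P.nums.tail := by
    intro a ha
    rw [(hf a (by omega)).2, (hf (a + 1) ha).2]
    refine List.mem_iff_getElem.2 ⟨a, by rw [List.length_zip, List.length_tail]; omega, ?_⟩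
    simp [List.getElem_zip, List.getElem_tail]
  have hadj : ∀ a, a + 1 < P.nums.length →
      o (f a) ∈ neighbours n (numArcs A) (o (f (a + 1))) := by
    intro a ha
    obtain ⟨u, v, huv, h1, h2⟩ := P.mem_zip_nums.1 (harc a ha)
    rw [← h1, ← h2, mem_neighbours]
    exact ⟨u.2, Or.inl (mem_numArcs.2 ⟨u, v, (hAT _ _).2 (P.adj_of_mem_arcs huv), rfl, rfl⟩)⟩
  have hadj' : ∀ a, a + 1 < P.nums.length →
      o (f (a + 1)) ∈ neighbours n (numArcs A) (o (f a)) := fun a ha =>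
    neighbours_symm (fun _ _ h => numArcs_lt h) (hadj a ha)
  -- A neighbour peeled later is still present when `o i` is peeled, and at most one neighbour is:
  -- the parent.
  have hparent : ∀ i < n, ∀ l < n, i < l → o l ∈ neighbours n (numArcs A) (o i) →
      pr (o i) = o l + 1 := by
    intro i hi l hl hil hnb
    have hmem : o l ∈ neighbours n (numArcs A) (o i) \ peeledBefore o i := by
      refine Finset.mem_sdiff.2 ⟨hnb, fun h => ?_⟩
      obtain ⟨m, hm, he⟩ := mem_peeledBefore.1 h
      have := hoinj m (by omega) l hl he
      omega
    rcases hp.par i hi with ⟨-, h⟩ | ⟨u, h, h'⟩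
    · rw [h] at hmem; simp at hmem
    · rw [h, Finset.mem_singleton] at hmem
      rw [h', hmem]
  -- At a valley of `f` both neighbours on the path would be parents of the same vertex.
  have hvalley : ∀ b, b + 2 < P.nums.length → f (b + 1) < f b → ¬ f (b + 1) < f (b + 2) := by
    intro b hb h1 h2
    have g1 := hparent _ (hf (b + 1) (by omega)).1 _ (hf b (by omega)).1 h1 (hadj b (by omega))
    have g2 := hparent _ (hf (b + 1) (by omega)).1 _ (hf (b + 2) hb).1 h2 (hadj' (b + 1) hb)
    have := hoinj _ (hf b (by omega)).1 _ (hf (b + 2) hb).1 (by omega)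
    have := hinj _ (by omega) _ hb this
    omega
  obtain ⟨a, ha, hea⟩ := List.mem_iff_getElem.1 hj'
  obtain ⟨b, hb, heb⟩ := List.mem_iff_getElem.1 hk'
  have hfa : f a = j := hoinj _ (hf a ha).1 _ (by omega) ((hf a ha).2.trans hea)
  have hfb : f b = k := hoinj _ (hf b hb).1 _ hk ((hf b hb).2.trans heb)
  have hab : a ≠ b := fun e => by subst e; omega
  rcases lt_or_gt_of_ne hab with hab | hab
  · have hlt := lt_succ_of_no_valley hinj hvalley hab hb (by omega)
    refine Or.inl ⟨o (f (a + 1)), hfa ▸ harc a (by omega), ?_⟩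
    rw [← hfa]
    exact hparent _ (hf a ha).1 _ (hf (a + 1) (by omega)).1 hlt (hadj' a (by omega))
  · have hlt := lt_pred_of_no_valley hinj hvalley hab ha (by omega)
    obtain ⟨c, rfl⟩ : ∃ c, a = c + 1 := ⟨a - 1, by omega⟩
    rw [Nat.add_sub_cancel] at hlt
    refine Or.inr ⟨o (f c), hfa ▸ harc c ha, ?_⟩
    rw [← hfa]
    exact hparent _ (hf (c + 1) ha).1 _ (hf c (by omega)).1 hlt (hadj c ha)

variable {p : ℕ} {P : Fin p → Dipath T} {R : Fin p → Fin p → Prop}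

omit hT hAT in
lemma mem_nums_of_on {f g : ℕ → ℕ} (htab : Tabulates (fun i => (P i).nums.zip (P i).nums.tail) f g)
    {v : ℕ} {i : Fin p} (h : row p f v i ≠ 0 ∨ row p g v i ≠ 0) : v ∈ (P i).nums := by
  rcases h with h | h
  · obtain ⟨u, hu⟩ := Nat.exists_eq_succ_of_ne_zero h
    exact List.mem_of_mem_tail (List.of_mem_zip ((htab i u v).2.1 hu)).2
  · obtain ⟨u, hu⟩ := Nat.exists_eq_succ_of_ne_zero h
    exact (List.of_mem_zip ((htab i v u).1.1 hu)).1

-- Here `e c a` reads: the code `c` stands for the arc `a`. A nonzero key thus names an arc, and its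
-- fibre consists of paths containing that arc, on which `R` is a linear order.
omit hT hAT in
lemma ordersFibres_of_arcs (hR : InducesTotalOrders P R) {key : Fin p → ℕ}
    (e : ℕ → Fin n × Fin n → Prop)
    (hkey : ∀ i, key i ≠ 0 → ∃ a, e (key i) a) (he : ∀ i a, e (key i) a → a ∈ (P i).arcs) :
    OrdersFibres R key := by
  constructor
  · intro i j hi hji
    obtain ⟨a, ha⟩ := hkey i hi
    have hai := he i a ha
    have := hR a ((P i).adj_of_mem_arcs hai)
    exact total_of (fun i j : {i : Fin p // a ∈ (P i).arcs} => R i.1 j.1) ⟨i, hai⟩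
      ⟨j, he j a (hji ▸ ha)⟩
  · intro i j k hi hji hki h1 h2
    obtain ⟨a, ha⟩ := hkey i hi
    have hai := he i a ha
    have := hR a ((P i).adj_of_mem_arcs hai)
    exact trans_of (fun i j : {i : Fin p // a ∈ (P i).arcs} => R i.1 j.1) (a := ⟨i, hai⟩)
      (b := ⟨j, he j a (hji ▸ ha)⟩) (c := ⟨k, he k a (hki ▸ ha)⟩) h1 h2

/-- This is the bridge from the computed tables to the abstract passes. The tree structure enters
through the peeling, which makes a path leave an earlier star towards a later one only along the
parent arc. -/
theorem layout_of_peeling (hanti : ∀ i j, R i j → R j i → i = j) (hR : InducesTotalOrders P R)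
    {f g : ℕ → ℕ} (htab : Tabulates (fun i => (P i).nums.zip (P i).nums.tail) f g)
    {cnt : ℕ} {o dg sm pr : ℕ → ℕ}
    (hp : Peeling n (neighbours n (numArcs A)) n cnt o dg sm pr) :
    Layout R n (row p f) (row p g) pr o := by
  have hsurj : ∀ v < n, ∃ k < n, o k = v := by
    have : peeledBefore o n = Finset.range n := by
      refine Finset.eq_of_subset_of_card_le (fun v hv => ?_) ?_
      · obtain ⟨i, hi, rfl⟩ := mem_peeledBefore.1 hv
        exact Finset.mem_range.2 (hp.lt i (lt_of_lt_of_le hi hp.le))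
      · rw [peeledBefore, Finset.card_image_of_injOn]
        intro i hi j hj he
        simp only [Finset.coe_range, Set.mem_Iio] at hi hj
        exact hp.inj i (lt_of_lt_of_le hi hp.le) j (lt_of_lt_of_le hj hp.le) he
    intro v hv
    rw [← Finset.mem_range, ← this, mem_peeledBefore] at hv
    exact hv
  have hcode : ∀ i v, (∀ u, row p f v i = u + 1 → u < n) ∧ (∀ u, row p g v i = u + 1 → u < n) :=
    fun i v => ⟨fun u hu => (P i).lt_of_mem_nums (List.of_mem_zip ((htab i u v).2.1 hu)).1,
      fun u hu => (P i).lt_of_mem_nums (List.mem_of_mem_tail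
        (List.of_mem_zip ((htab i v u).1.1 hu)).2)⟩
  refine ⟨hanti, fun u v i => ((htab i u v).1.trans (htab i u v).2.symm), ?_, ?_, ?_, ?_, ?_, ?_⟩
  · intro v i j h0 he
    obtain ⟨u, hu⟩ := Nat.exists_eq_succ_of_ne_zero h0
    obtain ⟨a, b, hab, h1, h2⟩ := (P i).mem_zip_nums.1 ((htab i v u).1.1 hu)
    obtain ⟨c, d, hcd, h3, h4⟩ := (P j).mem_zip_nums.1 ((htab j u v).2.1 (he ▸ hu))
    have e1 : c = b := Fin.ext (by omega)
    have e2 : d = a := Fin.ext (by omega)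
    subst e1 e2
    exact hT.oriented _ _ ((P i).adj_of_mem_arcs hab) ((P j).adj_of_mem_arcs hcd)
  · intro v
    refine ordersFibres_of_arcs hR (fun c a => c = a.1 + 1 ∧ (a.2 : ℕ) = v) (fun i hi => ?_) ?_
    · obtain ⟨u, hu⟩ := Nat.exists_eq_succ_of_ne_zero hi
      obtain ⟨a, b, hab, rfl, rfl⟩ := (P i).mem_zip_nums.1 ((htab i u v).2.1 hu)
      exact ⟨(a, b), hu, rfl⟩
    · rintro i ⟨a, b⟩ ⟨h1, rfl⟩
      exact (P i).val_mem_zip_nums.1 ((htab i a b).2.1 h1)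
  · intro v
    refine ordersFibres_of_arcs hR (fun c a => c = a.2 + 1 ∧ (a.1 : ℕ) = v) (fun i hi => ?_) ?_
    · obtain ⟨u, hu⟩ := Nat.exists_eq_succ_of_ne_zero hi
      obtain ⟨a, b, hab, rfl, rfl⟩ := (P i).mem_zip_nums.1 ((htab i v u).1.1 hu)
      exact ⟨(a, b), hu, rfl⟩
    · rintro i ⟨a, b⟩ ⟨h1, rfl⟩
      exact (P i).val_mem_zip_nums.1 ((htab i a b).1.1 h1)
  · intro i j k hjk hk hj' hk'
    rcases passes_parent_of_peeling hAT hp hsurj (P i) hjk hk (mem_nums_of_on htab hj')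
      (mem_nums_of_on htab hk') with ⟨w, hw, he⟩ | ⟨w, hw, he⟩
    · exact Or.inr (((htab i _ w).1.2 hw).trans he.symm)
    · exact Or.inl (((htab i w _).2.2 hw).trans he.symm)
  · intro i j hj h
    rcases hp.par j hj with ⟨h1, -⟩ | ⟨u, h1, h2⟩
    -- The code `n + 1` of a missing parent would belong to a vertex numbered `n`, so no incidence
    -- can equal it.
    · rw [h1] at h
      rcases h with h | h
      · exact absurd ((hcode i _).1 _ h) (lt_irrefl _)
      · exact absurd ((hcode i _).2 _ h) (lt_irrefl _)
    · have hu : u ∈ neighbours n (numArcs A) (o j) \ peeledBefore o j := by rw [h1]; simp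
      obtain ⟨hu1, hu2⟩ := Finset.mem_sdiff.1 hu
      obtain ⟨k, hk, rfl⟩ := hsurj u (mem_neighbours.1 hu1).1
      refine ⟨k, ?_, hk, h2⟩
      by_contra hkj
      rcases eq_or_lt_of_le (not_lt.1 hkj) with rfl | hkj
      · exact not_mem_neighbours_self hT hAT _ hu1
      · exact hu2 (mem_peeledBefore.2 ⟨k, hkj, rfl⟩)
  · intro v i h
    obtain ⟨k, hk, he⟩ := hsurj v ((P i).lt_of_mem_nums (mem_nums_of_on htab h))
    exact ⟨k, hk, he.symm⟩

omit hT hAT in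
/-- Two paths share an arc at some vertex if and only if they share an arc. -/
lemma exists_meets_iff {f g : ℕ → ℕ}
    (htab : Tabulates (fun i => (P i).nums.zip (P i).nums.tail) f g) {i j : Fin p} :
    (∃ v, Meets (row p f v) (row p g v) i j) ↔ ∃ a, a ∈ (P i).arcs ∧ a ∈ (P j).arcs := by
  constructor
  · rintro ⟨v, ⟨h0, he⟩ | ⟨h0, he⟩⟩
    · obtain ⟨u, hu⟩ := Nat.exists_eq_succ_of_ne_zero h0
      obtain ⟨a, b, hab, rfl, rfl⟩ := (P i).mem_zip_nums.1 ((htab i u v).2.1 hu)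
      exact ⟨(a, b), hab, (P j).val_mem_zip_nums.1 ((htab j a b).2.1 (he.trans hu))⟩
    · obtain ⟨u, hu⟩ := Nat.exists_eq_succ_of_ne_zero h0
      obtain ⟨a, b, hab, rfl, rfl⟩ := (P i).mem_zip_nums.1 ((htab i v u).1.1 hu)
      exact ⟨(a, b), hab, (P j).val_mem_zip_nums.1 ((htab j a b).1.1 (he.trans hu))⟩
  · rintro ⟨⟨a, b⟩, hi, hj⟩
    have h1 := (htab i a b).2.2 ((P i).val_mem_zip_nums.2 hi)
    have h2 := (htab j a b).2.2 ((P j).val_mem_zip_nums.2 hj)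
    exact ⟨b, Or.inl ⟨by rw [h1]; simp, h2.trans h1.symm⟩⟩

end

end DipathKernel

/-! ### The algorithm -/

namespace DipathKernel

/-- Compute the tables, and the order in which the vertices are peeled off. -/
def setupProg : Prog :=
  .seq multiplesProg (.seq (forLoop 20 1 (.put 18 (.reg 20) (.const 1)))
    (.seq tablesProg (.seq degreesProg (.seq queueProg peelProg))))

/-- Process all vertices bottom-up, and then top-down. -/
def passesProg : Prog :=
  .seq (forLoop 23 0 (.seq (.set 2 (.get 11 (.reg 23))) upProg))
    (forLoop 23 0 (.seq (.set 2 (.get 11 (.sub (.sub (.reg 0) (.const 1)) (.reg 23)))) downProg))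

/-- Write the surviving paths to array 5. -/
def outputProg : Prog :=
  forLoop 20 1 (.ite (.const 0) (.get 18 (.reg 20)) (.put 5 (.reg 20) (.const 1)) .skip)

/-- The program that computes a kernel. -/
def kernelProg : Prog :=
  .ite (.const 0) (.reg 1) (.seq setupProg (.seq passesProg outputProg)) .skip

/-- In a concatenation, block `i` begins after the total length of the earlier blocks; this locates
both the rows of the table and the vertex sequences in the input. -/
lemma getD_flatMap {α : Type} (f : α → List ℕ) (l : List α) {i j : ℕ} (hi : i < l.length)
    (hj : j < (f l[i]).length) :
    (l.flatMap f).getD (((l.take i).flatMap f).length + j) 0 = (f l[i])[j] := by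
  have h : l.flatMap f = (l.take i).flatMap f ++ (f l[i] ++ (l.drop (i + 1)).flatMap f) := by
    rw [← List.flatMap_cons, ← List.flatMap_append, ← List.drop_eq_getElem_cons hi,
      List.take_append_drop]
  rw [h, List.getD_append_right _ _ _ _ (by omega), Nat.add_sub_cancel_left,
    List.getD_append _ _ _ _ hj, List.getD_eq_getElem _ _ hj]

lemma length_flatMap_take_succ {α : Type} (f : α → List ℕ) (l : List α) {i : ℕ}
    (hi : i < l.length) :
    ((l.take (i + 1)).flatMap f).length = ((l.take i).flatMap f).length + (f l[i]).length := by
  rw [List.take_succ_eq_append_getElem hi, List.flatMap_append, List.length_append]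
  simp

section

variable {n p : ℕ} {T : Digraph (Fin n)} {A : List (Fin n × Fin n)} {P : Fin p → Dipath T}
  {R : Fin p → Fin p → Prop} {s : State}

/-- The programs write none of the incidence tables, the order or the parent codes, so every step
sees the same layout. Fetching the vertex costs 3 steps upwards and 7 downwards; with the loop
overhead this makes `144 = 60 + 3 + 7 + 60 + 7 + 7`. -/
lemma passesProg_spec (hT : HasTable R s) (h0 : s.reg 0 = n) (h6 : ∀ v < n, s.arr 6 v = v * p)
    (hL : Layout R n (row p (s.arr 7)) (row p (s.arr 8)) (s.arr 12) (s.arr 11))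
    (hord : ∀ k < n, s.arr 11 k < n) (h18 : ∀ i : Fin p, 0 < s.arr 18 i) :
    Tri passesProg s (n * (p * (p * 412 + 84) + p * 466 + 144) + 10) fun s' =>
      members p (s'.arr 18) =
        downSeq R n (row p (s.arr 7)) (row p (s.arr 8)) (s.arr 12) (s.arr 11) n := by
  have hvertex : ∀ s' v, Frame passesProg.regs passesProg.arrs s s' → v < n → s'.reg 2 = v →
      HasTable R s' ∧ s'.arr 6 v = v * p ∧ OrdersFibres R (row p (s'.arr 7) v) ∧
        OrdersFibres R (row p (s'.arr 8) v) := by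
    intro s' v hF hv h2
    refine ⟨hT.frame hF (by decide) (by decide) (by decide), ?_, ?_, ?_⟩
    · rw [hF.arr 6 (by decide), h6 v hv]
    · rw [hF.arr 7 (by decide)]; exact hL.prv_orders v
    · rw [hF.arr 8 (by decide)]; exact hL.nxt_orders v
  refine Tri.seq_le
    (Tri.forLoop (N := n) (T := p * (p * 206 + 42) + p * 233 + 63) (fun l s' =>
      members p (s'.arr 18) = upSeq R (row p (s.arr 7)) (row p (s.arr 8)) (s.arr 12) (s.arr 11) l)
      h0 (by decide) (by decide) ?_ ?_) (fun s1 hF1 h1 => ?_)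
    (T₂ := n * (p * (p * 206 + 42) + p * 233 + 67 + 7) + 5) ?_
  · ext i; simp [upSeq, h18]
  · intro l s' hl hx hF hI
    refine Tri.seq_le (T₁ := 3) (Q := fun s2 => s2.reg 2 = s.arr 11 l)
      (Tri.of_run rfl (by decide)
        (by simp [Prog.run, Expr.eval, hx, hF.arr 11 (by decide)]))
      (fun s2 hF2 h2 => ?_) (T₂ := p * (p * 206 + 42) + p * 233 + 60) (by omega)
    have hF' : Frame passesProg.regs passesProg.arrs s s2 :=
      (hF.mono (by decide) (by decide)).trans (hF2.mono (by decide) (by decide))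
    obtain ⟨g1, g2, g3, g4⟩ := hvertex s2 _ hF' (hord l hl) h2
    refine Tri.mono (upProg_spec g1 hL.anti h2 g2 g3 g4) le_rfl fun s3 _ h3 => ?_
    rw [State.arr_setReg, h3, hF'.arr 7 (by decide), hF'.arr 8 (by decide),
      hF'.arr 12 (by decide), hF2.arr 18 (by decide), hI]
    rfl
  · refine Tri.mono (Tri.forLoop (N := n) (T := p * (p * 206 + 42) + p * 233 + 67) (fun l s' =>
      members p (s'.arr 18) =
        downSeq R n (row p (s.arr 7)) (row p (s.arr 8)) (s.arr 12) (s.arr 11) l)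
      ((hF1.reg 0 (by decide)).trans h0) (by decide) (by decide) h1 ?_) le_rfl fun _ _ h => h
    intro l s' hl hx hF hI
    have hF1' : Frame passesProg.regs passesProg.arrs s s' :=
      (hF1.mono (by decide) (by decide)).trans (hF.mono (by decide) (by decide))
    refine Tri.seq_le (T₁ := 7) (Q := fun s2 => s2.reg 2 = s.arr 11 (n - 1 - l))
      (Tri.of_run rfl (by decide)
        (by simp [Prog.run, Expr.eval, hx, hF1'.arr 11 (by decide), hF1'.reg 0 (by decide), h0]))
      (fun s2 hF2 h2 => ?_) (T₂ := p * (p * 206 + 42) + p * 233 + 60) (by omega)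
    have hF' : Frame passesProg.regs passesProg.arrs s s2 :=
      hF1'.trans (hF2.mono (by decide) (by decide))
    obtain ⟨g1, g2, g3, g4⟩ := hvertex s2 _ hF' (hord _ (by omega)) h2
    refine Tri.mono (downProg_spec g1 hL.anti h2 g2 g3 g4) le_rfl fun s3 _ h3 => ?_
    rw [State.arr_setReg, h3, hF'.arr 7 (by decide), hF'.arr 8 (by decide),
      hF'.arr 12 (by decide), hF2.arr 18 (by decide), hI]
    rfl
  · ring_nf
    omega

variable (A P R) in
lemma input_tables : (input A P R).reg 0 = n ∧ (input A P R).reg 1 = p ∧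
    (∀ k, (input A P R).arr 0 k = ((numArcs A).map Prod.fst).getD k 0) ∧
    (∀ k, (input A P R).arr 1 k = ((numArcs A).map Prod.snd).getD k 0) ∧
    (∀ i : Fin p, (input A P R).arr 2 i = (P i).nums.length) ∧
    (∀ i j : Fin p, 0 < (input A P R).arr 4 (i * p + j) ↔ R i j) ∧
    ∀ a k, 5 ≤ a → (input A P R).arr a k = 0 := by
  classical
  refine ⟨rfl, rfl, fun k => ?_, fun k => ?_, fun i => ?_, fun i j => ?_, fun a k ha => ?_⟩
  · simp [input, numArcs, Function.comp_def]
  · simp [input, numArcs, Function.comp_def]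
  · simp [input, Dipath.nums]
  · have hoff : ∀ i ≤ p, (((List.finRange p).take i).flatMap fun i =>
        (List.finRange p).map fun j => if R i j then 1 else 0).length = i * p := by
      intro i
      induction i with
      | zero => simp
      | succ i ih =>
        intro hi
        rw [length_flatMap_take_succ _ _ (by simpa using hi), ih (by omega), Nat.succ_mul]
        simp
    have := getD_flatMap (fun i => (List.finRange p).map fun j => if R i j then 1 else 0)
      (List.finRange p) (i := i) (j := j) (by simp) (by simp)
    rw [hoff i i.2.le] at this
    simp only [List.getElem_map, List.getElem_finRange, Fin.cast_mk, Fin.eta] at this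
    have e : (input A P R).arr 4 (i * p + j) = if R i j then 1 else 0 := by
      rw [← this]
      simp only [input, List.getD_cons_succ, List.getD_cons_zero]
    rw [e]
    split_ifs <;> simp [*]
  · obtain ⟨b, rfl⟩ := Nat.exists_eq_add_of_le' ha
    simp [input]

variable (A P R) in
lemma input_vertices : ∃ off : ℕ → ℕ, off 0 = 0 ∧
    (∀ i : Fin p, off (i + 1) = off i + (P i).nums.length) ∧
    ∀ (i : Fin p) (j : ℕ) (hj : j < (P i).nums.length),
      (input A P R).arr 3 (off i + j) = (P i).nums[j] := by
  refine ⟨fun k => (((List.finRange p).take k).flatMap fun i => (P i).nums).length, by simp,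
    fun i => ?_, fun i j hj => ?_⟩
  · simp only
    rw [length_flatMap_take_succ _ _ (by simp)]
    simp
  · have := getD_flatMap (fun i => (P i).nums) (List.finRange p) (i := i) (j := j) (by simp)
      (by simpa using hj)
    simpa [input, Dipath.nums, List.map_eq_flatMap, Function.comp_def] using this

lemma setupProg_spec (hT : IsDirectedTree T) (hA : A.Nodup) (hAT : ∀ u v, (u, v) ∈ A ↔ T.Adj u v) :
    Tri setupProg (input A P R) (n * p * 35 + n * 149 + p * 47 + 45) fun s' =>
      (∀ j < n + p, s'.arr 6 j = j * p) ∧ (∀ i : Fin p, 0 < s'.arr 18 i) ∧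
      Tabulates (fun i => (P i).nums.zip (P i).nums.tail) (s'.arr 7) (s'.arr 8) ∧
      Peeling n (neighbours n (numArcs A)) n (s'.reg 15) (s'.arr 11) (s'.arr 9) (s'.arr 10)
        (s'.arr 12) := by
  obtain ⟨h0, h1, ha0, ha1, h2, -, hz⟩ := input_tables A P R
  obtain ⟨off, hoff0, hoff, h3⟩ := input_vertices A P R
  refine Tri.seq_le (multiplesProg_spec h0 h1) (fun s1 hF1 h6 => ?_)
    (T₂ := n * p * 35 + n * 135 + p * 33 + 34) (by ring_nf; omega)
  refine Tri.seq_le (Tri.forCells (T := 4) (a := 18) (fun _ x => 0 < x)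
    ((hF1.reg 1 (by decide)).trans h1) (by decide) (by decide) rfl (by decide) ?_)
    (fun s2 hF2 h18 => ?_) (T₂ := n * p * 35 + n * 135 + p * 22 + 29) (by ring_nf; omega)
  · intro k s' hk hx hF _
    simp only [Prog.run, Expr.eval, hx, State.arr_setArr, if_true]
    exact ⟨fun j hj => by simp [hj], Nat.one_pos⟩
  have hF2' : Frame [10, 11, 20] [6, 18] (input A P R) s2 :=
    (hF1.mono (by decide) (by decide)).trans (hF2.mono (by decide) (by decide))
  refine Tri.seq_le (tablesProg_spec (n := n) (ls := fun i => (P i).nums) (off := off)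
    ((hF2'.reg 1 (by decide)).trans h1) (fun i => by rw [hF2'.arr 2 (by decide), h2]) hoff0 hoff
    (fun i j hj => by rw [hF2'.arr 3 (by decide), h3]) (fun i => (P i).nums_nodup)
    (fun i => (P i).length_nums_le) (fun i v hv => (P i).lt_of_mem_nums hv)
    (fun v hv => by rw [hF2.arr 6 (by decide), h6 v (by omega)])
    (fun k => by rw [hF2'.arr 7 (by decide), hz 7 k (by omega)])
    (fun k => by rw [hF2'.arr 8 (by decide), hz 8 k (by omega)]))
    (fun s3 hF3 htab => ?_) (T₂ := n * 135 + 22) (by ring_nf; omega)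
  have hF3' : Frame [10, 11, 12, 13, 14, 15, 20, 21] [6, 7, 8, 18] (input A P R) s3 :=
    (hF2'.mono (by decide) (by decide)).trans (hF3.mono (by decide) (by decide))
  refine Tri.seq_le (degreesProg_spec (E := numArcs A) ((hF3'.reg 0 (by decide)).trans h0)
    (fun k => by rw [hF3'.arr 0 (by decide), ha0]) (fun k => by rw [hF3'.arr 1 (by decide), ha1])
    (fun k => by rw [hF3'.arr 9 (by decide), hz 9 k (by omega)])
    (fun k => by rw [hF3'.arr 10 (by decide), hz 10 k (by omega)])
    (hA.map fun a b h => by simpa [Prod.ext_iff, Fin.ext_iff] using h)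
    (by rw [numArcs, List.length_map]; exact length_arcs_le hT hAT hA)
    (fun u v h => numArcs_lt h) (fun u v h => numArcs_oriented hT hAT h))
    (fun s4 hF4 hdeg => ?_) (T₂ := n * 85 + 12) (by omega)
  refine Tri.seq_le (queueProg_spec (nb := neighbours n (numArcs A))
    ((hF4.reg 0 (by decide)).trans ((hF3'.reg 0 (by decide)).trans h0))
    (fun v => (hdeg v).1) (fun v => (hdeg v).2)) (fun s5 hF5 hp => ?_) (T₂ := n * 60 + 5)
    (by omega)
  refine Tri.mono (peelProg_spec ((hF5.reg 0 (by decide)).trans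
    ((hF4.reg 0 (by decide)).trans ((hF3'.reg 0 (by decide)).trans h0)))
    (fun W hW hne => exists_card_neighbours_lt hT hAT hW hne)
    (fun u v h => neighbours_symm (fun _ _ h => numArcs_lt h) h)
    (not_mem_neighbours_self hT hAT) (neighbours_subset _) hp) le_rfl fun s6 hF6 hp' => ?_
  have hF6' : Frame [13, 14, 15, 20] [9, 10, 11, 12] s3 s6 :=
    ((hF4.mono (by decide) (by decide)).trans (hF5.mono (by decide) (by decide))).trans
      (hF6.mono (by decide) (by decide))
  refine ⟨fun j hj => ?_, fun i => ?_, ?_, hp'⟩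
  · rw [hF6'.arr 6 (by decide), hF3.arr 6 (by decide), hF2.arr 6 (by decide), h6 j hj]
  · rw [hF6'.arr 18 (by decide), hF3.arr 18 (by decide)]
    exact h18 i i.2
  · rwa [hF6'.arr 7 (by decide), hF6'.arr 8 (by decide)]

/-- Array 5 is untouched until now, so the cells that are skipped still hold 0. -/
lemma outputProg_spec (h1 : s.reg 1 = p) (h5 : ∀ i, s.arr 5 i = 0) :
    Tri outputProg s (p * 15 + 5) fun s' =>
      ∀ i, i ∈ output p s' ↔ i ∈ members p (s.arr 18) := by
  refine Tri.mono (Tri.forCells (T := 8) (a := 5) (fun k x => x = 1 ↔ 0 < s.arr 18 k)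
    h1 (by decide) (by decide) rfl (by decide) ?_) le_rfl fun s' _ h i => ?_
  · intro k s' hk hx hF h
    simp only [Prog.run, Expr.eval, hx, hF.arr 18 (by decide)]
    rw [h5] at h
    refine ⟨fun j hj => ?_, ?_⟩
    · split_ifs <;> simp [hj]
    · split_ifs <;> simp [*]
  · rw [mem_members, ← h i i.2]
    rfl

/-- On every input the program computes, within the time bound, a set of paths without common arcs
that dominates all other paths. -/
theorem kernelProg_spec (hT : IsDirectedTree T) (hA : A.Nodup)
    (hAT : ∀ u v, (u, v) ∈ A ↔ T.Adj u v) (hanti : ∀ i j, R i j → R j i → i = j)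
    (hR : InducesTotalOrders P R) :
    Tri kernelProg (input A P R) (2000 * (n * p ^ 2 + 1)) fun s' =>
      (∀ i ∈ output p s', ∀ j ∈ output p s', i ≠ j →
        ∀ a, a ∈ (P i).arcs → a ∉ (P j).arcs) ∧
      ∀ j, j ∉ output p s' →
        ∃ i ∈ output p s', ∃ a, a ∈ (P i).arcs ∧ a ∈ (P j).arcs ∧ R j i := by
  obtain ⟨h0, h1, -, -, -, h4, hz⟩ := input_tables A P R
  -- Without paths the time bound is a constant, which even reading the tree would exceed; the
  -- program then stops at once.
  rcases Nat.eq_zero_or_pos p with rfl | hp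
  · refine ⟨_, _, .iteFalse ?_ (.skip _), ?_, fun i => i.elim0, fun i => i.elim0⟩
    · simp [Expr.eval, h1]
    · simp only [Expr.cost]; omega
  -- A path has a vertex, so `n` is positive, and all lower-order terms can be absorbed in `n * p ^
  -- 2`.
  have hn : 0 < n := by
    obtain ⟨v, -⟩ := List.exists_mem_of_ne_nil _ (P ⟨0, hp⟩).ne_nil
    have := v.2
    omega
  have key_lemma : Tri (.seq setupProg (.seq passesProg outputProg)) (input A P R)
      (2000 * (n * p ^ 2)) fun s' =>
      (∀ i ∈ output p s', ∀ j ∈ output p s', i ≠ j →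
        ∀ a, a ∈ (P i).arcs → a ∉ (P j).arcs) ∧
      ∀ j, j ∉ output p s' →
        ∃ i ∈ output p s', ∃ a, a ∈ (P i).arcs ∧ a ∈ (P j).arcs ∧ R j i := by
    refine Tri.seq_le (setupProg_spec hT hA hAT) (fun s1 hF1 hs1 => ?_)
      (T₂ := n * (p * (p * 412 + 84) + p * 466 + 144) + p * 15 + 15) ?_
    · obtain ⟨h6, h18, htab, hpeel⟩ := hs1
      have hL := layout_of_peeling hT hAT hanti hR htab hpeel
      refine Tri.seq_le (passesProg_spec ⟨(hF1.reg 1 (by decide)).trans h1,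
        fun j hj => h6 j (by omega), fun i j => by rw [hF1.arr 4 (by decide), h4]⟩
        ((hF1.reg 0 (by decide)).trans h0) (fun v hv => h6 v (by omega)) hL
        (fun k hk => hpeel.lt k (lt_of_lt_of_le hk hpeel.le)) h18) (fun s2 hF2 h2 => ?_)
        (T₂ := p * 15 + 5) (by omega)
      refine Tri.mono (outputProg_spec (p := p)
        ((hF2.reg 1 (by decide)).trans ((hF1.reg 1 (by decide)).trans h1))
        (fun i => by rw [hF2.arr 5 (by decide), hF1.arr 5 (by decide), hz 5 i le_rfl])) le_rfl
        fun s3 _ h3 => ?_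
      obtain ⟨hstab, hdom⟩ := hL.downSeq_kernel
      simp only [h3, h2]
      refine ⟨fun i hi j hj hij a hai haj => hij ?_, fun j hj => ?_⟩
      · obtain ⟨v, hv⟩ := (exists_meets_iff htab).2 ⟨a, hai, haj⟩
        exact hstab i hi j hj v hv
      · obtain ⟨i, hi, v, hv, hji⟩ := hdom j hj
        obtain ⟨a, haj, hai⟩ := (exists_meets_iff htab).1 ⟨v, hv⟩
        exact ⟨i, hi, a, hai, haj, hji⟩
    -- After this absorption the coefficients of both stages add up to 1412, within the 2000
    -- allowed.
    · have e1 : n * p ≤ n * p ^ 2 := Nat.mul_le_mul_left _ (Nat.le_self_pow two_ne_zero p)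
      have e2 : n ≤ n * p := Nat.le_mul_of_pos_right _ hp
      have e3 : p ≤ n * p := Nat.le_mul_of_pos_left _ hn
      have e4 : n * (p * (p * 412 + 84) + p * 466 + 144) =
          412 * (n * p ^ 2) + 550 * (n * p) + 144 * n := by ring
      rw [e4]
      omega
  obtain ⟨s', t, hex, ht, hQ⟩ := key_lemma
  refine ⟨s', _, .iteTrue ?_ hex, ?_, hQ⟩
  · simpa [Expr.eval, h1] using hp
  · simp only [Expr.cost]; omega

end

end DipathKernel

/-- One program and one constant `C` work for all directed trees `T` on `n` vertices, listed by
their arcs in any order, all families of `p` dipaths, and all admissible relations `R`, where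
`R i j` reads `P i ⪯ P j`. -/
theorem theorem5 :
    ∃ (prog : Prog) (C : ℕ),
      ∀ (n p : ℕ) (T : Digraph (Fin n)), IsDirectedTree T →
      ∀ (A : List (Fin n × Fin n)), A.Nodup → (∀ u v, (u, v) ∈ A ↔ T.Adj u v) →
      ∀ (P : Fin p → Dipath T) (R : Fin p → Fin p → Prop),
        (∀ i, R i i) → (∀ i j, R i j → R j i → i = j) → InducesTotalOrders P R →
        ∃ (s : State) (t : ℕ),
          Exec prog (input A P R) s t ∧
          t ≤ C * (n * p ^ 2 + 1) ∧
          (∀ i ∈ output p s, ∀ j ∈ output p s, i ≠ j →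
            ∀ a, a ∈ (P i).arcs → a ∉ (P j).arcs) ∧
          (∀ j, j ∉ output p s →
            ∃ i ∈ output p s, ∃ a, a ∈ (P i).arcs ∧ a ∈ (P j).arcs ∧ R j i) ∧
          IsKernel (orientation P R) (output p s) := by
  refine ⟨kernelProg, 2000, fun n p T hT A hA hAT P R _ hanti hR => ?_⟩
  obtain ⟨s, t, hex, ht, hstab, hdom⟩ := kernelProg_spec hT hA hAT hanti hR
  refine ⟨s, t, hex, ht, hstab, hdom, fun i hi j hj h => ?_, fun j hj => ?_⟩
  · obtain ⟨⟨hij, a, hai, haj⟩, -⟩ := h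
    exact hstab i hi j hj hij a hai haj
  · obtain ⟨i, hi, a, hai, haj, hji⟩ := hdom j hj
    exact ⟨i, hi, ⟨fun e => hj (e ▸ hi), a, haj, hai⟩, hji⟩
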